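/- **Setting.** An $n$-component welded string link is a virtual string link diagram (Gauss diagram on $n$ upward oriented strands) up to the Reidemeister moves, the detour move and the OC move (two consecutive overcrossings may be exchanged). $wSL(n)$ is the monoid of welded string links under stacking. A $w_k$-tree for a diagram $D$ is a planarly immersed unitrivalent tree with $k$ tails and one head on $D$ (away from the crossings), with edges oriented from the tails towards the head, meeting $D$ and itself otherwise only in virtual crossings, with a cyclic order at each trivalent vertex, and possibly with beads $\bullet$ on its edges, two consecutive beads cancelling. Surgery along a $w_1$-tree adds one classical crossing, at which the strand of the tail passes over the strand of the head; its sign is $+1$ if the head is attached to the right side of its strand and there is no bead, and each bead, or attaching the head to the left side instead, changes the sign. A tree of higher degree, its head being attached to the right side of a strand, is expanded into $w_1$-trees: to a tail $a$ assign the one-letter word $a$, to a vertex whose edges are, counterclockwise, the outgoing edge and the edges of the subtrees $l, r$ assign the word $l\,r^{-1}\,l^{-1}\,r$, and to a bead on the outgoing edge assign the inversion of the word; the letters $a^{\pm1}$ of the word of the whole tree are the heads, in this order along the strand, of $w_1$-trees parallel to the tail $a$, with a bead for the exponent $-1$. Two elements $L, L'$ of $wSL(n)$ are $w_k$-equivalent,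 written $L \stackrel{k}{\sim} L'$, if a finite sequence of surgeries along $w_l$-trees with $l \ge k$ (and of welded moves) leads from $L$ to $L'$. **The trees.** Write $[l, r]$ for a vertex with outgoing edge, $l$, $r$ in counterclockwise order, and let $h$ be the head, always attached to the right side. Below, each $w_3$-tree for the trivial diagram is given by the order of its endpoints along strand $1$ and (after the bar) strand $2$, followed by the tree; the same letter denotes the tree and the welded string link obtained by surgery along it. On one strand: - $F$: $(a,b,h,c)$, $[b,[a,c]]$; $\quad F'$: $(a,h,b,c)$, $[[a,c],b]$. On two strands: - $A$: $(a,h \mid b,c)$, $[[a,b],c]$; $\quad B$: $(h,a \mid b,c)$, $[b,[c,a]]$; - $C$: $(a,b \mid c,h)$, $[b,[a,c]]$; $\quad D$: $(a,b \mid h,c)$, $[[c,b],a]$; - $TO_1$: $(a,b,h \mid c)$, $[b,[a,c]]$; $\quad TO_2$: $(a,h,b \mid c)$, $[[a,c],b]$; - $TO_3$: $(a,h,b \mid c)$, $[a,[c,b]]$; $\quad TO_4$: $(h,a,b \mid c)$, $[[c,b],a]$; - $OT_1$: $(c \mid a,b,h)$, $[[c,a],b]$; $\quad OT_2$: $(c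 \mid a,h,b)$, $[b,[c,a]]$; - $OT_3$: $(c \mid a,h,b)$, $[[b,c],a]$; $\quad OT_4$: $(c \mid h,a,b)$, $[a,[b,c]]$. For each of these, $X^{-1}$ denotes the welded string link obtained by surgery along the same tree with a bead inserted next to its head (it is the inverse of $X$ up to $w_4$-equivalence). **Proposition.** In $wSL(1)$, $$F' \stackrel{4}{\sim} F^{-1},$$ and in $wSL(2)$, $$TO_1 \stackrel{4}{\sim} TO_2^{-1}, \qquad TO_3 \stackrel{4}{\sim} TO_4^{-1},$$ $$OT_1 \stackrel{4}{\sim} OT_2^{-1}, \qquad OT_3 \stackrel{4}{\sim} OT_4^{-1},$$ $$A\cdot OT_3 \stackrel{4}{\sim} B\cdot OT_2, \qquad C\cdot TO_3 \stackrel{4}{\sim} D\cdot TO_2 .$$ -/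

import Mathlib

namespace Welded

/-! ### Gauss diagrams of string links

A virtual string link diagram is recorded, up to detour moves, by its Gauss diagram: for every
component, the sequence of its passages through the classical crossings, read along the orientation.
Virtual crossings leave no trace in it. -/

/-- A passage through the classical crossing with label `a`: `tail a` is the passage over the
crossing, `head a s` the passage under it, and `s` is the sign of the crossing. -/
inductive Letter where
  | tail (a : ℕ)
  | head (a : ℕ) (s : ℤˣ)

namespace Letter

/-- Rename the crossings. -/
def relabel (φ : ℕ → ℕ) : Letter → Letter
  | tail a => tail (φ a)
  | head a s => head (φ a) s

/-- The label of an over-passage. -/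
def tailLabel : Letter → Option ℕ
  | tail a => some a
  | head _ _ => none

/-- The label of an under-passage. -/
def headLabel : Letter → Option ℕ
  | tail _ => none
  | head a _ => some a

end Letter

/-- All components of a family of lists, one after the other. -/
def concat {n : ℕ} {α : Type} (w : Fin n → List α) : List α := (List.finRange n).flatMap w

/-- Every element of `β` occurs exactly once in the list. -/
abbrev ListsAll {β : Type} (l : List β) : Prop := l.Nodup ∧ ∀ b, b ∈ l

/-- The Gauss diagram of an `n`-component virtual string link diagram: every crossing has exactly one
over-passage and exactly one under-passage. -/
structure Diagram (n : ℕ) where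
  strand : Fin n → List Letter
  tails_nodup : ((concat strand).filterMap Letter.tailLabel).Nodup
  heads_perm : ((concat strand).filterMap Letter.headLabel).Perm
    ((concat strand).filterMap Letter.tailLabel)

/-- The trivial diagram: no crossing. -/
def Diagram.trivial (n : ℕ) : Diagram n where
  strand := fun _ => []
  tails_nodup := by
    have h : concat (fun _ : Fin n => ([] : List Letter)) = [] := by simp [concat]
    rw [h]; exact List.nodup_nil
  heads_perm := by
    have h : concat (fun _ : Fin n => ([] : List Letter)) = [] := by simp [concat]
    rw [h]; exact List.Perm.refl _

/-! ### Generalized Reidemeister moves and the OC move -/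

/-- Strands of a diagram with marked places on them; each marker in `β` occurs exactly once. -/
structure Template (n : ℕ) (β : Type) where
  strand : Fin n → List (Letter ⊕ β)
  once : ListsAll ((concat strand).filterMap Sum.getRight?)

/-- Put the list `f b` at the place marked `b`, for all markers `b`. -/
def Template.fill {n : ℕ} {β : Type} (P : Template n β) (f : β → List Letter) :
    Fin n → List Letter :=
  fun i => (P.strand i).flatMap (Sum.elim (fun x => [x]) f)

/-- The list `[x, y]` or `[y, x]`, according to the sign `s`. -/
def ordered (s : ℤˣ) (x y : Letter) : List Letter := if s = 1 then [x, y] else [y, x]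

/-- The local moves on Gauss diagrams: `LocalMove m f g` says that the portions `f 0, …, f (m - 1)` of
strands may be replaced by `g 0, …, g (m - 1)`. All orientations and signs are allowed. -/
inductive LocalMove : (m : ℕ) → (Fin m → List Letter) → (Fin m → List Letter) → Prop
  /-- First Reidemeister move, a kink that starts with the over-passage. -/
  | r1_over (a : ℕ) (s : ℤˣ) :
      LocalMove 1 ![[]] ![[.tail a, .head a s]]
  /-- First Reidemeister move, a kink that starts with the under-passage. -/
  | r1_under (a : ℕ) (s : ℤˣ) :
      LocalMove 1 ![[]] ![[.head a s, .tail a]]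
  /-- Second Reidemeister move, strands oriented in parallel. -/
  | r2_parallel (a b : ℕ) (s : ℤˣ) :
      LocalMove 2 ![[], []] ![[.tail a, .tail b], [.head a s, .head b (-s)]]
  /-- Second Reidemeister move, strands oriented oppositely. -/
  | r2_antiparallel (a b : ℕ) (s : ℤˣ) :
      LocalMove 2 ![[], []] ![[.tail a, .tail b], [.head b (-s), .head a s]]
  /-- Third Reidemeister move: place `0` is on the top strand, `1` on the middle one, `2` on the bottom
  one; `a`, `b`, `c` are the crossings top/middle, top/bottom, middle/bottom, with signs `s`, `t`, `u`.
  These signs and the side `δ` of the triangle determine the order of the crossings on each strand. -/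
  | r3 (a b c : ℕ) (s t u δ : ℤˣ) :
      LocalMove 3
        ![ordered (δ * s * t) (.tail a) (.tail b),
          ordered (δ * s * u) (.head a s) (.tail c),
          ordered (δ * t * u) (.head b t) (.head c u)]
        ![ordered (-δ * s * t) (.tail a) (.tail b),
          ordered (-δ * s * u) (.head a s) (.tail c),
          ordered (-δ * t * u) (.head b t) (.head c u)]
  /-- Overcrossings commute. -/
  | oc (a b : ℕ) :
      LocalMove 1 ![[.tail a, .tail b]] ![[.tail b, .tail a]]

/-- One move between Gauss diagrams. -/
inductive Diagram.Move {n : ℕ} : Diagram n → Diagram n → Prop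
  /-- The names of the crossings are immaterial. -/
  | relabel (D D' : Diagram n) (φ : ℕ → ℕ) (hφ : Function.Injective φ)
      (h : ∀ i, D'.strand i = (D.strand i).map (Letter.relabel φ)) : Move D D'
  | replace (D D' : Diagram n) (m : ℕ) (f g : Fin m → List Letter) (hm : LocalMove m f g)
      (P : Template n (Fin m)) (h : D.strand = P.fill f) (h' : D'.strand = P.fill g) : Move D D'

/-- Two diagrams represent the same welded string link if they are related by generalized Reidemeister
and OC moves. -/
def Diagram.setoid (n : ℕ) : Setoid (Diagram n) := Relation.EqvGen.setoid Diagram.Move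

/-- `n`-component welded string links. -/
def WeldedStringLink (n : ℕ) : Type := Quotient (Diagram.setoid n)

/-- The welded string link represented by a diagram. -/
def Diagram.toLink {n : ℕ} (D : Diagram n) : WeldedStringLink n := Quotient.mk (Diagram.setoid n) D

/-! ### The stacking product -/

theorem filterMap_concat {n : ℕ} {α β : Type} (w : Fin n → List α) (g : α → Option β) :
    (concat w).filterMap g = concat (fun i => (w i).filterMap g) := by
  simp [concat, List.filterMap_flatMap]

theorem concat_append_perm {n : ℕ} {α : Type} (v w : Fin n → List α) :
    (concat (fun i => v i ++ w i)).Perm (concat v ++ concat w) := by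
  simpa [concat] using (List.flatMap_append_perm (List.finRange n) v w).symm

theorem tailLabel_map (φ : ℕ → ℕ) (l : List Letter) :
    (l.map (Letter.relabel φ)).filterMap Letter.tailLabel
      = (l.filterMap Letter.tailLabel).map φ := by
  induction l with
  | nil => rfl
  | cons x l ih => rw [List.map_cons, List.filterMap_cons, List.filterMap_cons, ih]; cases x <;> rfl

theorem headLabel_map (φ : ℕ → ℕ) (l : List Letter) :
    (l.map (Letter.relabel φ)).filterMap Letter.headLabel
      = (l.filterMap Letter.headLabel).map φ := by
  induction l with
  | nil => rfl
  | cons x l ih => rw [List.map_cons, List.filterMap_cons, List.filterMap_cons, ih]; cases x <;> rfl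

theorem concat_map {n : ℕ} {α β : Type} (w : Fin n → List α) (g : α → β) :
    concat (fun i => (w i).map g) = (concat w).map g := by
  simp [concat, List.map_flatMap]

/-- The stacking product: first `D`, then `E`, along the orientation of the strands. -/
def Diagram.mul {n : ℕ} (D E : Diagram n) : Diagram n where
  strand := fun i => (D.strand i).map (Letter.relabel fun a => 2 * a)
    ++ (E.strand i).map (Letter.relabel fun a => 2 * a + 1)
  tails_nodup := by
    have h := (concat_append_perm (fun i => (D.strand i).map (Letter.relabel fun a => 2 * a))
      (fun i => (E.strand i).map (Letter.relabel fun a => 2 * a + 1))).filterMap Letter.tailLabel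
    refine h.nodup_iff.2 ?_
    rw [List.filterMap_append, concat_map, concat_map, tailLabel_map, tailLabel_map]
    refine List.Nodup.append (D.tails_nodup.map fun a b hab => by simpa using hab)
      (E.tails_nodup.map fun a b hab => by simpa using hab) ?_
    intro x hx hy
    obtain ⟨a, -, rfl⟩ := List.mem_map.1 hx
    obtain ⟨b, -, hb⟩ := List.mem_map.1 hy
    omega
  heads_perm := by
    have h := concat_append_perm (fun i => (D.strand i).map (Letter.relabel fun a => 2 * a))
      (fun i => (E.strand i).map (Letter.relabel fun a => 2 * a + 1))
    refine (h.filterMap Letter.headLabel).trans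
      (List.Perm.trans ?_ (h.filterMap Letter.tailLabel).symm)
    rw [List.filterMap_append, List.filterMap_append, concat_map, concat_map, tailLabel_map,
      tailLabel_map, headLabel_map, headLabel_map]
    exact (D.heads_perm.map _).append (E.heads_perm.map _)

theorem ordered_map (s : ℤˣ) (x y : Letter) (φ : ℕ → ℕ) :
    (ordered s x y).map (Letter.relabel φ) = ordered s (x.relabel φ) (y.relabel φ) := by
  unfold ordered; split <;> rfl

theorem LocalMove.map {m : ℕ} {f g : Fin m → List Letter} (h : LocalMove m f g) (φ : ℕ → ℕ) :
    LocalMove m (fun j => (f j).map (Letter.relabel φ)) (fun j => (g j).map (Letter.relabel φ)) := by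
  cases h with
  | r1_over a s =>
    convert LocalMove.r1_over (φ a) s using 1 <;> funext j <;> fin_cases j <;> rfl
  | r1_under a s =>
    convert LocalMove.r1_under (φ a) s using 1 <;> funext j <;> fin_cases j <;> rfl
  | r2_parallel a b s =>
    convert LocalMove.r2_parallel (φ a) (φ b) s using 1 <;> funext j <;> fin_cases j <;> rfl
  | r2_antiparallel a b s =>
    convert LocalMove.r2_antiparallel (φ a) (φ b) s using 1 <;> funext j <;> fin_cases j <;> rfl
  | r3 a b c s t u δ =>
    convert LocalMove.r3 (φ a) (φ b) (φ c) s t u δ using 1 <;> funext j <;> fin_cases j <;>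
      exact ordered_map _ _ _ φ
  | oc a b =>
    convert LocalMove.oc (φ a) (φ b) using 1 <;> funext j <;> fin_cases j <;> rfl

/-- Put fixed strands below and above a template whose labels are renamed. -/
def Template.extend {n : ℕ} {β : Type} (P : Template n β) (φ : ℕ → ℕ)
    (u v : Fin n → List Letter) : Template n β where
  strand := fun i => (u i).map Sum.inl ++ (P.strand i).map (Sum.map (Letter.relabel φ) id)
    ++ (v i).map Sum.inl
  once := by
    have key : ∀ w : List Letter,
        (w.map (Sum.inl : Letter → Letter ⊕ β)).filterMap Sum.getRight? = [] := by
      intro w; induction w <;> simp_all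
    have key2 : ∀ w : List (Letter ⊕ β),
        (w.map (Sum.map (Letter.relabel φ) id)).filterMap Sum.getRight?
          = w.filterMap Sum.getRight? := by
      intro w
      induction w with
      | nil => rfl
      | cons x w ih =>
        rw [List.map_cons, List.filterMap_cons, List.filterMap_cons, ih]
        cases x <;> rfl
    rw [filterMap_concat]
    simp only [List.filterMap_append, key, key2, List.nil_append, List.append_nil]
    rw [← filterMap_concat]
    exact P.once

theorem Template.extend_fill {n : ℕ} {β : Type} (P : Template n β) (φ : ℕ → ℕ)
    (u v : Fin n → List Letter) (f : β → List Letter) (i : Fin n) :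
    (P.extend φ u v).fill (fun b => (f b).map (Letter.relabel φ)) i
      = u i ++ (P.fill f i).map (Letter.relabel φ) ++ v i := by
  have key : ∀ w : List Letter, (w.map Sum.inl).flatMap
      (Sum.elim (fun x => [x]) fun b => (f b).map (Letter.relabel φ)) = w := by
    intro w; induction w <;> simp_all
  have key2 : ∀ w : List (Letter ⊕ β), (w.map (Sum.map (Letter.relabel φ) id)).flatMap
      (Sum.elim (fun x => [x]) fun b => (f b).map (Letter.relabel φ))
        = (w.flatMap (Sum.elim (fun x => [x]) f)).map (Letter.relabel φ) := by
    intro w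
    induction w with
    | nil => rfl
    | cons x w ih => cases x <;> simp_all
  simp only [Template.fill, Template.extend, List.flatMap_append, key, key2]

theorem Diagram.Move.mul_right {n : ℕ} {D D' : Diagram n} (h : D.Move D') (E : Diagram n) :
    (D.mul E).Move (D'.mul E) := by
  cases h with
  | relabel φ hφ h =>
    refine .relabel _ _ (fun x => if x % 2 = 0 then 2 * φ (x / 2) else x) ?_ ?_
    · intro x y hxy
      simp only at hxy
      split_ifs at hxy with h1 h2 h2
      · have := hφ (show φ (x / 2) = φ (y / 2) by omega)
        omega
      · omega
      · omega
      · exact hxy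
    · intro i
      simp only [Diagram.mul, h, List.map_append, List.map_map]
      congr 1 <;> refine List.map_congr_left fun x _ => ?_ <;> cases x <;>
        simp [Letter.relabel]
  | replace m f g hm P h h' =>
    refine .replace _ _ m _ _ (hm.map fun a => 2 * a)
      (P.extend (fun a => 2 * a) (fun _ => [])
        (fun i => (E.strand i).map (Letter.relabel fun a => 2 * a + 1))) ?_ ?_ <;>
    · funext i
      rw [Template.extend_fill]
      simp [Diagram.mul, h, h']

theorem Diagram.Move.mul_left {n : ℕ} {D D' : Diagram n} (h : D.Move D') (E : Diagram n) :
    (E.mul D).Move (E.mul D') := by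
  cases h with
  | relabel φ hφ h =>
    refine .relabel _ _ (fun x => if x % 2 = 1 then 2 * φ (x / 2) + 1 else x) ?_ ?_
    · intro x y hxy
      simp only at hxy
      split_ifs at hxy with h1 h2 h2
      · have := hφ (show φ (x / 2) = φ (y / 2) by omega)
        omega
      · omega
      · omega
      · exact hxy
    · intro i
      simp only [Diagram.mul, h, List.map_append, List.map_map]
      congr 1 <;> refine List.map_congr_left fun x _ => ?_ <;> cases x <;>
        simp [Letter.relabel, Nat.add_mod] <;> congr 1 <;> omega
  | replace m f g hm P h h' =>
    refine .replace _ _ m _ _ (hm.map fun a => 2 * a + 1)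
      (P.extend (fun a => 2 * a + 1)
        (fun i => (E.strand i).map (Letter.relabel fun a => 2 * a)) (fun _ => [])) ?_ ?_ <;>
    · funext i
      rw [Template.extend_fill]
      simp [Diagram.mul, h, h']

theorem eqvGen_mono_map {α β : Type} {r : α → α → Prop} {s : β → β → Prop} (f : α → β)
    (hf : ∀ x y, r x y → s (f x) (f y)) {x y : α} (h : Relation.EqvGen r x y) :
    Relation.EqvGen s (f x) (f y) := by
  induction h with
  | rel x y h => exact .rel _ _ (hf x y h)
  | refl x => exact .refl _
  | symm x y _ ih => exact .symm _ _ ih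
  | trans x y z _ _ ih1 ih2 => exact .trans _ _ _ ih1 ih2

/-- The stacking product of welded string links. -/
instance (n : ℕ) : Mul (WeldedStringLink n) where
  mul := Quotient.map₂ Diagram.mul fun _ D' h E _ h' =>
    Relation.EqvGen.trans _ _ _
      (eqvGen_mono_map (fun X : Diagram n => X.mul E) (fun _ _ k => k.mul_right E) h)
      (eqvGen_mono_map (fun X : Diagram n => D'.mul X) (fun _ _ k => k.mul_left D') h')

/-- The trivial welded string link. -/
instance (n : ℕ) : One (WeldedStringLink n) where
  one := (Diagram.trivial n).toLink

/-! ### `w`-trees and surgery -/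

/-- The underlying tree of a `w`-tree, rooted at its head, with univalent tails labelled by `β`.
At a trivalent vertex `node l r`, the three edges are, in the cyclic (counterclockwise) order: the
outgoing edge, the edge of `l`, the edge of `r`. `bead t` is `t` with a bead on its outgoing edge. -/
inductive WTree (β : Type) where
  | leaf (b : β)
  | node (l r : WTree β)
  | bead (t : WTree β)

namespace WTree

variable {β : Type}

/-- The tails of a tree. -/
def leaves : WTree β → List β
  | leaf b => [b]
  | node l r => l.leaves ++ r.leaves
  | bead t => t.leaves

/-- The formal inverse of a word in letters with exponents. -/
def inv (w : List (β × ℤˣ)) : List (β × ℤˣ) := (w.map fun x => (x.1, -x.2)).reverse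

/-- The expansion of a tree into arrows (trees with one tail): the list, along the strand that carries
the head (attached to the right side of the strand), of the heads of the arrows, each given by the tail
that it is parallel to and by its sign, `-1` if it has a bead. A trivalent vertex expands to the
commutator `l r⁻¹ l⁻¹ r`, a bead on the outgoing edge inverts the word. -/
def word : WTree β → List (β × ℤˣ)
  | leaf b => [(b, 1)]
  | node l r => l.word ++ inv r.word ++ inv l.word ++ r.word
  | bead t => inv t.word

end WTree

/-- A `w`-tree of degree `k` for the diagram `D`: a tree with `k` tails, whose endpoints are placed on
the strands of `D` away from the crossings; `none` marks the head and `some j` the tail `j`. Virtual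
crossings of the edges are not recorded, nor the sides at which tails are attached, since surgery does
not depend on them; the head is attached to the right side of its strand (a head on the left side is
the same as one on the right side with an additional bead). -/
structure WTreeFor {n : ℕ} (D : Diagram n) (k : ℕ) where
  tree : WTree (Fin k)
  leaves_once : ListsAll tree.leaves
  place : Template n (Option (Fin k))
  base : ∀ i, (place.strand i).filterMap Sum.getLeft? = D.strand i

namespace WTreeFor

variable {n k : ℕ} {D : Diagram n}

/-- The letters that surgery puts in place of a letter of `D` (labels of `D` become even), of the head
(the heads of the arrows of the expansion, the `j`-th one having label `2 * j + 1`), and of a tail (the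
tails of the arrows of the expansion that are parallel to it). -/
def subst (T : WTreeFor D k) : Letter ⊕ Option (Fin k) → List Letter
  | .inl x => [x.relabel fun a => 2 * a]
  | .inr none => T.tree.word.zipIdx.map fun p => .head (2 * p.2 + 1) p.1.2
  | .inr (some b) => (T.tree.word.zipIdx.filter fun p => p.1.1 = b).map fun p => .tail (2 * p.2 + 1)

theorem place_perm (T : WTreeFor D k) :
    (concat T.place.strand).Perm ((concat D.strand).map Sum.inl
      ++ (none :: (List.finRange k).map some).map Sum.inr) := by
  have h : ∀ l : List (Letter ⊕ Option (Fin k)), l.Perm ((l.filterMap Sum.getLeft?).map Sum.inl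
      ++ (l.filterMap Sum.getRight?).map Sum.inr) := by
    intro l
    induction l with
    | nil => simp
    | cons x l ih =>
      cases x with
      | inl x => exact ih.cons (Sum.inl x)
      | inr x => exact (ih.cons (Sum.inr x)).trans List.perm_middle.symm
  refine (h _).trans (List.Perm.append (.of_eq ?_) (List.Perm.map _ ?_))
  · rw [filterMap_concat]; simp [T.base]
  · have hn : (none :: (List.finRange k).map some : List (Option (Fin k))).Nodup := by
      refine List.nodup_cons.2 ⟨by simp, ?_⟩
      exact (List.nodup_finRange k).map (Option.some_injective _)
    refine (List.perm_ext_iff_of_nodup T.place.once.1 hn).2 fun b =>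
      iff_of_true (T.place.once.2 b) ?_
    cases b <;> simp

theorem flatMap_filter_perm {α : Type} (l : List α) (key : α → Fin k) :
    ((List.finRange k).flatMap fun b => l.filter fun p => key p = b).Perm l := by
  induction l with
  | nil => simp
  | cons x l ih =>
    have h1 : ∀ b, (x :: l).filter (fun p => key p = b)
        = (if key x = b then [x] else []) ++ l.filter (fun p => key p = b) := by
      intro b; by_cases h : key x = b <;> simp [h]
    have h2 : ((List.finRange k).flatMap fun b => if key x = b then [x] else []) = [x] := by
      have : ∀ L : List (Fin k), L.Nodup → (L.flatMap fun b => if key x = b then [x] else [])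
          = if key x ∈ L then [x] else [] := by
        intro L hL
        induction L with
        | nil => simp
        | cons b L ih =>
          rw [List.nodup_cons] at hL
          rw [List.flatMap_cons, ih hL.2]
          by_cases h : key x = b
          · subst h; simp [hL.1]
          · simp [h]
      simpa using this _ (List.nodup_finRange k)
    simp only [h1]
    refine (List.flatMap_append_perm _ _ _).symm.trans ?_
    rw [h2]
    exact ih.cons x

theorem tails_perm (T : WTreeFor D k) :
    (((concat T.place.strand).flatMap T.subst).filterMap Letter.tailLabel).Perm
      (((concat D.strand).filterMap Letter.tailLabel).map (fun a => 2 * a)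
        ++ T.tree.word.zipIdx.map fun p => 2 * p.2 + 1) := by
  refine ((T.place_perm.flatMap_right T.subst).filterMap _).trans ?_
  rw [List.flatMap_append, List.filterMap_append]
  refine List.Perm.append (.of_eq ?_) ?_
  · rw [← tailLabel_map]
    congr 1
    simp [List.flatMap_map, subst]
    induction concat D.strand <;> simp_all
  · refine List.Perm.trans (.of_eq ?_) ((flatMap_filter_perm T.tree.word.zipIdx
      (fun p => p.1.1)).map (fun p => 2 * p.2 + 1))
    have e1 : ∀ l : List ((Fin k × ℤˣ) × ℕ),
        (l.map fun p => Letter.head (2 * p.2 + 1) p.1.2).filterMap Letter.tailLabel = [] := by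
      intro l
      induction l with
      | nil => rfl
      | cons x l ih => rw [List.map_cons, List.filterMap_cons, ih]; rfl
    have e2 : ∀ l : List ((Fin k × ℤˣ) × ℕ),
        (l.map fun p => Letter.tail (2 * p.2 + 1)).filterMap Letter.tailLabel
          = l.map fun p => 2 * p.2 + 1 := by
      intro l
      induction l with
      | nil => rfl
      | cons x l ih => rw [List.map_cons, List.filterMap_cons, ih]; rfl
    simp only [List.map_cons, List.flatMap_cons, List.filterMap_append, List.map_map,
      List.flatMap_map, Function.comp, subst, e1, e2, List.nil_append, List.filterMap_flatMap,
      List.map_flatMap]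

theorem heads_perm' (T : WTreeFor D k) :
    (((concat T.place.strand).flatMap T.subst).filterMap Letter.headLabel).Perm
      (((concat D.strand).filterMap Letter.headLabel).map (fun a => 2 * a)
        ++ T.tree.word.zipIdx.map fun p => 2 * p.2 + 1) := by
  refine ((T.place_perm.flatMap_right T.subst).filterMap _).trans ?_
  rw [List.flatMap_append, List.filterMap_append]
  refine List.Perm.append (.of_eq ?_) (.of_eq ?_)
  · rw [← headLabel_map]
    congr 1
    simp [List.flatMap_map, subst]
    induction concat D.strand <;> simp_all
  · have e1 : ∀ l : List ((Fin k × ℤˣ) × ℕ),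
        (l.map fun p => Letter.head (2 * p.2 + 1) p.1.2).filterMap Letter.headLabel
          = l.map fun p => 2 * p.2 + 1 := by
      intro l
      induction l with
      | nil => rfl
      | cons x l ih => rw [List.map_cons, List.filterMap_cons, ih]; rfl
    have e2 : ∀ l : List ((Fin k × ℤˣ) × ℕ),
        (l.map fun p => Letter.tail (2 * p.2 + 1)).filterMap Letter.headLabel = [] := by
      intro l
      induction l with
      | nil => rfl
      | cons x l ih => rw [List.map_cons, List.filterMap_cons, ih]; rfl
    simp only [List.map_cons, List.flatMap_cons, List.filterMap_append, List.map_map,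
      List.flatMap_map, Function.comp, subst, e1, e2, List.filterMap_flatMap]
    simp

theorem concat_flatMap {α β : Type} (w : Fin n → List α) (g : α → List β) :
    concat (fun i => (w i).flatMap g) = (concat w).flatMap g := by
  simp [concat, List.flatMap_assoc]

/-- The diagram obtained from `D` by surgery along `T`. -/
def surgery (T : WTreeFor D k) : Diagram n where
  strand := fun i => (T.place.strand i).flatMap T.subst
  tails_nodup := by
    rw [concat_flatMap]
    refine T.tails_perm.nodup_iff.2 (List.Nodup.append
      (D.tails_nodup.map fun a b hab => by simpa using hab) ?_ ?_)
    · have : (T.tree.word.zipIdx.map fun p => 2 * p.2 + 1)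
          = (T.tree.word.zipIdx.map Prod.snd).map fun j => 2 * j + 1 := by
        rw [List.map_map]; rfl
      rw [this, List.zipIdx_map_snd]
      exact (List.nodup_range' ).map fun a b hab => by simpa using hab
    · intro x hx hy
      obtain ⟨a, -, rfl⟩ := List.mem_map.1 hx
      obtain ⟨b, -, hb⟩ := List.mem_map.1 hy
      omega
  heads_perm := by
    rw [concat_flatMap]
    exact T.heads_perm'.trans (((D.heads_perm.map _).append_right _).trans T.tails_perm.symm)

/-- The same `w`-tree with a bead inserted next to its head. -/
def headBead (T : WTreeFor D k) : WTreeFor D k where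
  tree := .bead T.tree
  leaves_once := T.leaves_once
  place := T.place
  base := T.base

/-- The welded string link obtained by surgery. -/
def link (T : WTreeFor D k) : WeldedStringLink n := T.surgery.toLink

end WTreeFor

/-! ### `w_k`-equivalence -/

/-- `L'` is obtained from `L` by surgery along a `w`-tree of degree `l ≥ k`, for some diagram of `L`. -/
def SurgeryStep {n : ℕ} (k : ℕ) (L L' : WeldedStringLink n) : Prop :=
  ∃ (D : Diagram n) (l : ℕ) (T : WTreeFor D l), k ≤ l ∧ L = D.toLink ∧ L' = T.link

/-- `w_k`-equivalence of welded string links: a finite sequence of surgeries along `w`-trees of degree at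
least `k` leads from `L` to `L'` (generalized Reidemeister and OC moves being equalities of welded string
links). -/
def WkEquiv {n : ℕ} (k : ℕ) (L L' : WeldedStringLink n) : Prop :=
  Relation.ReflTransGen (SurgeryStep k) L L'

/-! ### The `w`-trees of degree three

Each of them is given by its tree and by the order of its endpoints along the strands, which are read
along the orientation; for two strands, the left one comes first. All heads are on the right side. -/

/-- A `w`-tree for the trivial diagram, given by its tree and the positions of its endpoints. -/
def onTrivial {n k : ℕ} (pos : Fin n → List (Option (Fin k))) (t : WTree (Fin k))
    (hpos : ListsAll (concat pos)) (ht : ListsAll t.leaves) :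
    WTreeFor (Diagram.trivial n) k where
  tree := t
  leaves_once := ht
  place :=
    { strand := fun i => (pos i).map Sum.inr
      once := by
        rw [filterMap_concat]
        have : ∀ l : List (Option (Fin k)),
            (l.map (Sum.inr : _ → Letter ⊕ Option (Fin k))).filterMap Sum.getRight? = l := by
          intro l; induction l <;> simp_all
        simpa only [this] using hpos }
  base := by
    intro i
    simp only [Diagram.trivial]
    induction pos i <;> simp_all

open WTree in
/-- `F`: on one strand, tail `0`, tail `1`, head, tail `2`. -/
def treeF : WTreeFor (Diagram.trivial 1) 3 :=
  onTrivial ![[some 0, some 1, none, some 2]]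
    (node (leaf 1) (node (leaf 0) (leaf 2))) (by decide) (by decide)

open WTree in
/-- `F'`: `F` with the head and the tail next to it exchanged. -/
def treeF' : WTreeFor (Diagram.trivial 1) 3 :=
  onTrivial ![[some 0, none, some 1, some 2]]
    (node (node (leaf 0) (leaf 2)) (leaf 1)) (by decide) (by decide)

open WTree in
/-- `A`. -/
def treeA : WTreeFor (Diagram.trivial 2) 3 :=
  onTrivial ![[some 0, none], [some 1, some 2]]
    (node (node (leaf 0) (leaf 1)) (leaf 2)) (by decide) (by decide)

open WTree in
/-- `B`. -/
def treeB : WTreeFor (Diagram.trivial 2) 3 :=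
  onTrivial ![[none, some 0], [some 1, some 2]]
    (node (leaf 1) (node (leaf 2) (leaf 0))) (by decide) (by decide)

open WTree in
/-- `C`. -/
def treeC : WTreeFor (Diagram.trivial 2) 3 :=
  onTrivial ![[some 0, some 1], [some 2, none]]
    (node (leaf 1) (node (leaf 0) (leaf 2))) (by decide) (by decide)

open WTree in
/-- `D`. -/
def treeD : WTreeFor (Diagram.trivial 2) 3 :=
  onTrivial ![[some 0, some 1], [none, some 2]]
    (node (node (leaf 2) (leaf 1)) (leaf 0)) (by decide) (by decide)

open WTree in
/-- `TO_1`. -/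
def treeTO₁ : WTreeFor (Diagram.trivial 2) 3 :=
  onTrivial ![[some 0, some 1, none], [some 2]]
    (node (leaf 1) (node (leaf 0) (leaf 2))) (by decide) (by decide)

open WTree in
/-- `TO_2`. -/
def treeTO₂ : WTreeFor (Diagram.trivial 2) 3 :=
  onTrivial ![[some 0, none, some 1], [some 2]]
    (node (node (leaf 0) (leaf 2)) (leaf 1)) (by decide) (by decide)

open WTree in
/-- `TO_3`. -/
def treeTO₃ : WTreeFor (Diagram.trivial 2) 3 :=
  onTrivial ![[some 0, none, some 1], [some 2]]
    (node (leaf 0) (node (leaf 2) (leaf 1))) (by decide) (by decide)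

open WTree in
/-- `TO_4`. -/
def treeTO₄ : WTreeFor (Diagram.trivial 2) 3 :=
  onTrivial ![[none, some 0, some 1], [some 2]]
    (node (node (leaf 2) (leaf 1)) (leaf 0)) (by decide) (by decide)

open WTree in
/-- `OT_1`. -/
def treeOT₁ : WTreeFor (Diagram.trivial 2) 3 :=
  onTrivial ![[some 2], [some 0, some 1, none]]
    (node (node (leaf 2) (leaf 0)) (leaf 1)) (by decide) (by decide)

open WTree in
/-- `OT_2`. -/
def treeOT₂ : WTreeFor (Diagram.trivial 2) 3 :=
  onTrivial ![[some 2], [some 0, none, some 1]]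
    (node (leaf 1) (node (leaf 2) (leaf 0))) (by decide) (by decide)

open WTree in
/-- `OT_3`. -/
def treeOT₃ : WTreeFor (Diagram.trivial 2) 3 :=
  onTrivial ![[some 2], [some 0, none, some 1]]
    (node (node (leaf 1) (leaf 2)) (leaf 0)) (by decide) (by decide)

open WTree in
/-- `OT_4`. -/
def treeOT₄ : WTreeFor (Diagram.trivial 2) 3 :=
  onTrivial ![[some 2], [none, some 0, some 1]]
    (node (leaf 0) (node (leaf 1) (leaf 2))) (by decide) (by decide)

end Welded

/-!
The OC move lets the tails of any number of arrows share a place on a strand. A diagram is therefore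
described by listing, along the strands, places of tails and heads of arrows, each head with a sign and with
the place of its tail (`Item`, `Realizes`). Consecutive heads spell a word in the free group on the places,
of which, by the second Reidemeister move, only the value matters. Surgery along a tree inserts such a block,
whose value is an iterated commutator of the places of the tails of the tree (`treeValue`).

Blocks of left-normed commutators of weight four in the generators and their inverses may be inserted or
deleted up to `w_4`-equivalence, since they are expansions of trees of degree four (`Eqv.insert_tree`). The
normal subgroup that they generate is the fourth term of the lower central series
(`lowerCentralSeries_three_le`), so that only the values of blocks in the free nilpotent group of class three
matter (`BEqv.of_cong`). There, commutators of weight three are central, trilinear and satisfy the Jacobi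
identity (`tri_mul_left`, `tri_swap`, `tri_jacobi`).

Two operations change the places. By the third Reidemeister move, a place may be moved back over a block
of value `w` if its generator `b` is replaced by `w⁻¹ * b * w` everywhere (`BEqv.slide`). By the OC move,
the tails at adjacent places may be exchanged (`BEqv.identify`). The relations come from performing two such
slides in both orders (`BEqv.square`). Let `a₂`, `a` be two places with a block `e` between them, and `e₂`, `e`
two places with a block `⁅a, y⁆` between them, together with blocks that compensate for these two. Moving `a`
back over its block turns `⁅a, y⁆` into `⁅⁅a, e⁆, y⁆ * ⁅a, y⁆`, whereas moving `e` back over its block turns the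
block `e` into `⁅⁅y, a⁆, e⁆ * e`. What remains in the first case is `⁅⁅y, a⁆, e⁆` behind the places `a₂`, `a` and
`⁅⁅a, e⁆, y⁆` before the places `e₂`, `e`; in the second case it is the other way round.

If all four places are on one strand next to each other, two adjacent groups of them may be gathered, and the
Jacobi identity combines the two blocks. The result is that in a commutator of weight three one tail may be
exchanged between a place just before the block and a place just behind it (`BEqv.exchange_before`,
`BEqv.exchange_behind`). These are the relations between single trees; a bead at the head inverts the value,
which amounts to exchanging the first two entries of the commutator (`nil_treeValue_bead`). If the places are
on two strands, the square relation involves a block on each of them, which leads to the relations between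
products (`BEqv.exchange_strands`).
-/

namespace Welded

/-! ### Diagrams as words of letters tagged by their strands -/

section TaggedWords

variable {n : ℕ} {α : Type}

/-- The letters of a tagged word that lie on the strand `i`. -/
def strandOf (W : List (Fin n × α)) (i : Fin n) : List α :=
  W.filterMap fun p => if p.1 = i then some p.2 else none

theorem strandOf_append (V W : List (Fin n × α)) (i : Fin n) :
    strandOf (V ++ W) i = strandOf V i ++ strandOf W i := by
  simp [strandOf]

theorem strandOf_cons (p : Fin n × α) (W : List (Fin n × α)) (i : Fin n) :
    strandOf (p :: W) i = (if p.1 = i then [p.2] else []) ++ strandOf W i := by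
  by_cases h : p.1 = i <;> simp [strandOf, h]

theorem strandOf_map {α' : Type} (f : α → α') (W : List (Fin n × α)) (i : Fin n) :
    strandOf (W.map (Prod.map id f)) i = (strandOf W i).map f := by
  induction W with
  | nil => rfl
  | cons p W ih =>
    rw [List.map_cons, strandOf_cons, strandOf_cons, ih, List.map_append]
    by_cases h : p.1 = i <;> simp [h]

/-- Replace every letter of a tagged word by a list of letters on the same strand. -/
def tagBind {α' : Type} (f : α → List α') (W : List (Fin n × α)) : List (Fin n × α') :=
  W.flatMap fun p => (f p.2).map fun y => (p.1, y)

theorem strandOf_tag (i j : Fin n) (l : List α) :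
    strandOf (l.map fun y => (i, y)) j = if i = j then l else [] := by
  induction l with
  | nil => simp [strandOf]
  | cons x l ih =>
    rw [List.map_cons, strandOf_cons, ih]
    by_cases h : i = j <;> simp [h]

theorem strandOf_tagBind {α' : Type} (f : α → List α') (W : List (Fin n × α)) (i : Fin n) :
    strandOf (tagBind f W) i = (strandOf W i).flatMap f := by
  induction W with
  | nil => rfl
  | cons p W ih =>
    rw [tagBind, List.flatMap_cons, strandOf_append, ← tagBind, ih, strandOf_cons, strandOf_tag,
      List.flatMap_append]
    by_cases h : p.1 = i <;> simp [h]

theorem concat_strandOf_perm (W : List (Fin n × α)) :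
    (concat (strandOf W)).Perm (W.map Prod.snd) := by
  induction W with
  | nil => simp [concat, strandOf]
  | cons p W ih =>
    have h1 : strandOf (p :: W) = fun i => (if p.1 = i then [p.2] else []) ++ strandOf W i := by
      funext i; exact strandOf_cons p W i
    have h2 : concat (fun i => if p.1 = i then [p.2] else []) = [p.2] := by
      have : ∀ L : List (Fin n), L.Nodup → (L.flatMap fun i => if p.1 = i then [p.2] else [])
          = if p.1 ∈ L then [p.2] else [] := by
        intro L hL
        induction L with
        | nil => simp
        | cons b L ih =>
          rw [List.nodup_cons] at hL
          rw [List.flatMap_cons, ih hL.2]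
          by_cases h : p.1 = b
          · subst h; simp [hL.1]
          · simp [h]
      simpa [concat] using this _ (List.nodup_finRange n)
    rw [h1]
    refine (concat_append_perm _ _).trans ?_
    rw [h2]
    exact ih.cons _

end TaggedWords

section Words

variable {n : ℕ}

/-- Every crossing occurs exactly once as an over-passage and exactly once as an under-passage. -/
def WordValid (W : List (Fin n × Letter)) : Prop :=
  ((W.map Prod.snd).filterMap Letter.tailLabel).Nodup ∧
    ((W.map Prod.snd).filterMap Letter.headLabel).Perm
      ((W.map Prod.snd).filterMap Letter.tailLabel)

theorem WordValid.of_perm {V W : List (Fin n × Letter)} (hV : WordValid V)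
    (h : (V.map Prod.snd).Perm (W.map Prod.snd)) : WordValid W :=
  ⟨(h.filterMap _).nodup_iff.1 hV.1, ((h.filterMap _).symm.trans hV.2).trans (h.filterMap _)⟩

/-- The diagram described by a tagged word. -/
def ofWord (W : List (Fin n × Letter)) (h : WordValid W) : Diagram n where
  strand := strandOf W
  tails_nodup := ((concat_strandOf_perm W).filterMap _).nodup_iff.2 h.1
  heads_perm := ((concat_strandOf_perm W).filterMap _).trans
    (h.2.trans ((concat_strandOf_perm W).filterMap _).symm)

theorem Diagram.ext_strand {D E : Diagram n} (h : D.strand = E.strand) : D = E := by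
  cases D; cases E; cases h; rfl

theorem wordValid_of_strand {D : Diagram n} {W : List (Fin n × Letter)}
    (h : D.strand = strandOf W) : WordValid W := by
  have hp := concat_strandOf_perm W
  rw [← h] at hp
  exact ⟨(hp.filterMap _).nodup_iff.1 D.tails_nodup,
    (hp.filterMap _).symm.trans (D.heads_perm.trans (hp.filterMap _))⟩

theorem eq_ofWord {D : Diagram n} {W : List (Fin n × Letter)}
    (h : D.strand = strandOf W) : D = ofWord W (wordValid_of_strand h) :=
  Diagram.ext_strand h

/-- Fill the marked places of a tagged word. -/
def fillWord {β : Type} (K : List (Fin n × (Letter ⊕ β))) (f : β → List Letter) :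
    List (Fin n × Letter) :=
  tagBind (Sum.elim (fun x => [x]) f) K

theorem fillWord_append {β : Type} (K K' : List (Fin n × (Letter ⊕ β))) (f : β → List Letter) :
    fillWord (K ++ K') f = fillWord K f ++ fillWord K' f := by
  simp [fillWord, tagBind]

/-- A local move may be applied at the marked places of a tagged word. -/
theorem move_fillWord {m : ℕ} (K : List (Fin n × (Letter ⊕ Fin m)))
    (hK : ListsAll (K.filterMap fun p => p.2.getRight?)) {f g : Fin m → List Letter}
    (hm : LocalMove m f g) (hf : WordValid (fillWord K f)) (hg : WordValid (fillWord K g)) :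
    (ofWord _ hf).Move (ofWord _ hg) := by
  have hp : ((concat (strandOf K)).filterMap Sum.getRight?).Perm
      (K.filterMap fun p => p.2.getRight?) := by
    have := (concat_strandOf_perm K).filterMap Sum.getRight?
    rwa [List.filterMap_map] at this
  refine .replace _ _ m f g hm
    ⟨strandOf K, hp.nodup_iff.2 hK.1, fun b => hp.mem_iff.2 (hK.2 b)⟩ ?_ ?_ <;>
  · funext i
    exact strandOf_tagBind _ _ _

theorem toLink_eq_of_move {D E : Diagram n} (h : D.Move E) : D.toLink = E.toLink :=
  Quotient.sound (s := Diagram.setoid n) (.rel _ _ h)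

theorem fillWord_inl {β : Type} (W : List (Fin n × Letter)) (f : β → List Letter) :
    fillWord (W.map (Prod.map id Sum.inl)) f = W := by
  induction W with
  | nil => rfl
  | cons p W ih =>
    rw [List.map_cons, ← List.singleton_append, fillWord_append, ih]
    simp [fillWord, tagBind]

theorem filterMap_getRight_inl {β : Type} (W : List (Fin n × Letter)) :
    (W.map (Prod.map id (Sum.inl : Letter → Letter ⊕ β))).filterMap (fun p => p.2.getRight?)
      = [] := by
  induction W <;> simp_all

/-- The over-passages of consecutive crossings may be permuted. -/
theorem toLink_tails_perm (i : Fin n) {l l' : List ℕ} (h : l.Perm l') :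
    ∀ (A B : List (Fin n × Letter))
      (hA : WordValid (A ++ (l.map fun a => (i, Letter.tail a)) ++ B))
      (hB : WordValid (A ++ (l'.map fun a => (i, Letter.tail a)) ++ B)),
      (ofWord _ hA).toLink = (ofWord _ hB).toLink := by
  induction h with
  | nil => intros; rfl
  | @cons x l l' _ ih =>
    intro A B hA hB
    have e : ∀ l : List ℕ, A ++ ((x :: l).map fun a => (i, Letter.tail a)) ++ B
        = (A ++ [(i, Letter.tail x)]) ++ (l.map fun a => (i, Letter.tail a)) ++ B := by simp
    have hA' := hA
    have hB' := hB
    rw [e] at hA' hB'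
    have := ih (A ++ [(i, Letter.tail x)]) B hA' hB'
    simpa only [e] using this
  | swap x y l =>
    intro A B hA hB
    let K : List (Fin n × (Letter ⊕ Fin 1)) := A.map (Prod.map id Sum.inl) ++ [(i, .inr 0)]
      ++ ((l.map fun a => (i, Letter.tail a)) ++ B).map (Prod.map id Sum.inl)
    have e : ∀ f : Fin 1 → List Letter, fillWord K f = A ++ ((f 0).map fun y => (i, y))
        ++ ((l.map fun a => (i, Letter.tail a)) ++ B) := by
      intro f
      simp only [K, fillWord_append, fillWord_inl]
      simp [fillWord, tagBind]
    have hK : ListsAll (K.filterMap fun p => p.2.getRight?) := by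
      simp only [K, List.filterMap_append, filterMap_getRight_inl]
      change ListsAll [(0 : Fin 1)]
      decide
    have e1 : A ++ ((y :: x :: l).map fun a => (i, Letter.tail a)) ++ B
        = fillWord K ![[.tail y, .tail x]] := by rw [e]; simp
    have e2 : A ++ ((x :: y :: l).map fun a => (i, Letter.tail a)) ++ B
        = fillWord K ![[.tail x, .tail y]] := by rw [e]; simp
    have := toLink_eq_of_move (move_fillWord K hK (.oc y x) (e1 ▸ hA) (e2 ▸ hB))
    simpa only [← e1, ← e2] using this
  | @trans l₁ l₂ l₃ h₁ _ ih₁ ih₂ =>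
    intro A B hA hB
    have hC : WordValid (A ++ (l₂.map fun a => (i, Letter.tail a)) ++ B) := by
      refine hA.of_perm (List.Perm.map _ ?_)
      exact ((h₁.map _).append_left A).append_right B
    exact (ih₁ A B hA hC).trans (ih₂ A B hC hB)

end Words

/-! ### Diagrams with multiple arrow tails -/

/-- An item on a strand: the place `tail i b` on the strand `i` where the tails of all arrows with
marker `b` are attached, or the head `head i x s` on the strand `i` of an arrow of sign `s`, where `x`
tells the arrow's tail. Overcrossings commute, so that tails may share a place. -/
inductive Item (n : ℕ) (τ η : Type) where
  | tail (i : Fin n) (b : τ)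
  | head (i : Fin n) (x : η) (s : ℤˣ)

namespace Item

variable {n : ℕ} {τ η η' : Type}

/-- Apply a map to what the heads carry. -/
def mapHead (f : η → η') : Item n τ η → Item n τ η'
  | tail i b => tail i b
  | head i x s => head i (f x) s

/-- The marker of a tail place. -/
def getTail? : Item n τ η → Option τ
  | tail _ b => some b
  | head _ _ _ => none

/-- What a head carries. -/
def getHead? : Item n τ η → Option η
  | tail _ _ => none
  | head _ x _ => some x

/-- The passages through crossings that an item with labelled head stands for, where `ts b` lists the
labels of the arrows with marker `b`. -/
def letters (ts : τ → List ℕ) : Item n τ ℕ → List (Fin n × Letter)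
  | tail i b => (ts b).map fun a => (i, .tail a)
  | head i a s => [(i, .head a s)]

end Item

section Realizes

variable {n : ℕ} {τ η η' β : Type}

/-- The markers of the tail places. -/
def tailsOf (P : List (Item n τ η)) : List τ := P.filterMap Item.getTail?

/-- The markers or labels of the heads. -/
def headsOf (P : List (Item n τ η)) : List η := P.filterMap Item.getHead?

theorem tailsOf_append (P Q : List (Item n τ η)) : tailsOf (P ++ Q) = tailsOf P ++ tailsOf Q := by
  simp [tailsOf]

theorem headsOf_append (P Q : List (Item n τ η)) : headsOf (P ++ Q) = headsOf P ++ headsOf Q := by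
  simp [headsOf]

theorem tailsOf_mapHead (f : η → η') (P : List (Item n τ η)) :
    tailsOf (P.map (Item.mapHead f)) = tailsOf P := by
  simp only [tailsOf, List.filterMap_map]
  congr 1; funext x; cases x <;> rfl

theorem headsOf_mapHead (f : η → η') (P : List (Item n τ η)) :
    headsOf (P.map (Item.mapHead f)) = (headsOf P).map f := by
  simp only [headsOf, List.filterMap_map, List.map_filterMap]
  congr 1; funext x; cases x <;> rfl

/-- The list `P` of items describes the diagram `D`: the heads can be labelled by the crossings of `D`
in such a way that putting the tails at their places gives `D`. -/
def Realizes (P : List (Item n β β)) (D : Diagram n) : Prop :=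
  ∃ (L : List (Item n β ℕ)) (lab : ℕ → β) (ts : β → List ℕ),
    L.map (Item.mapHead lab) = P ∧ (headsOf L).Nodup ∧
    (∀ b, (ts b).Nodup ∧ ∀ a, a ∈ ts b ↔ a ∈ headsOf L ∧ lab a = b) ∧
    D.strand = strandOf (L.flatMap (Item.letters ts))

theorem tailLabel_letters (ts : β → List ℕ) (L : List (Item n β ℕ)) :
    ((L.flatMap (Item.letters ts)).map Prod.snd).filterMap Letter.tailLabel
      = (tailsOf L).flatMap ts := by
  induction L with
  | nil => rfl
  | cons x L ih =>
    rw [List.flatMap_cons, List.map_append, List.filterMap_append, ih]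
    cases x with
    | tail i b =>
      have : ∀ l : List ℕ, ((l.map fun a => (i, Letter.tail a)).map Prod.snd).filterMap
          Letter.tailLabel = l := by
        intro l
        induction l with
        | nil => rfl
        | cons a l ih => rw [List.map_cons, List.map_cons, List.filterMap_cons, ih]; rfl
      rw [Item.letters, this]
      rfl
    | head i a s => rfl

theorem headLabel_letters (ts : β → List ℕ) (L : List (Item n β ℕ)) :
    ((L.flatMap (Item.letters ts)).map Prod.snd).filterMap Letter.headLabel
      = headsOf L := by
  induction L with
  | nil => rfl
  | cons x L ih =>
    rw [List.flatMap_cons, List.map_append, List.filterMap_append, ih]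
    cases x with
    | tail i b =>
      have : ∀ l : List ℕ, ((l.map fun a => (i, Letter.tail a)).map Prod.snd).filterMap
          Letter.headLabel = [] := by
        intro l
        induction l with
        | nil => rfl
        | cons a l ih => rw [List.map_cons, List.map_cons, List.filterMap_cons, ih]; rfl
      rw [Item.letters, this]
      rfl
    | head i a s => rfl

theorem nodup_flatMap_fibres {T : List β} (hT : T.Nodup) {H : List ℕ} {lab : ℕ → β}
    {ts : β → List ℕ} (hts : ∀ b, (ts b).Nodup ∧ ∀ a, a ∈ ts b ↔ a ∈ H ∧ lab a = b) :
    (T.flatMap ts).Nodup := by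
  refine List.nodup_flatMap.2 ⟨fun b _ => (hts b).1, ?_⟩
  refine hT.imp_of_mem ?_
  intro b c _ _ hbc a hab hac
  exact hbc ((((hts b).2 a).1 hab).2.symm.trans (((hts c).2 a).1 hac).2)

theorem wordValid_letters {L : List (Item n β ℕ)} {lab : ℕ → β} {ts : β → List ℕ}
    (hL : ListsAll (tailsOf L)) (hH : (headsOf L).Nodup)
    (hts : ∀ b, (ts b).Nodup ∧ ∀ a, a ∈ ts b ↔ a ∈ headsOf L ∧ lab a = b) :
    WordValid (L.flatMap (Item.letters ts)) := by
  have h1 := nodup_flatMap_fibres hL.1 hts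
  refine ⟨by rw [tailLabel_letters]; exact h1, ?_⟩
  rw [tailLabel_letters, headLabel_letters]
  refine (List.perm_ext_iff_of_nodup hH h1).2 fun a => ?_
  rw [List.mem_flatMap]
  exact ⟨fun h => ⟨lab a, hL.2 _, ((hts _).2 a).2 ⟨h, rfl⟩⟩, fun ⟨b, _, h⟩ => (((hts b).2 a).1 h).1⟩

theorem exists_fibres [DecidableEq β] (H : List ℕ) (hH : H.Nodup) (lab : ℕ → β) :
    ∃ ts : β → List ℕ, ∀ b, (ts b).Nodup ∧ ∀ a, a ∈ ts b ↔ a ∈ H ∧ lab a = b :=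
  ⟨fun b => H.filter fun a => lab a = b, fun b => ⟨hH.filter _, fun a => by simp⟩⟩

/-- The heads can be labelled injectively, with the labels below `N` left unused. -/
theorem exists_labelling [Nonempty β] (P : List (Item n τ β)) :
    ∀ N : ℕ, ∃ (L : List (Item n τ ℕ)) (lab : ℕ → β), L.map (Item.mapHead lab) = P ∧
      (headsOf L).Nodup ∧ ∀ a ∈ headsOf L, N ≤ a := by
  induction P with
  | nil => exact fun N => ⟨[], fun _ => Classical.arbitrary β, rfl, List.nodup_nil, by simp [headsOf]⟩
  | cons x P ih =>
    intro N
    obtain ⟨L, lab, h1, h2, h3⟩ := ih (N + 1)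
    cases x with
    | tail i b =>
      exact ⟨.tail i b :: L, lab, by simp [h1, Item.mapHead], h2, fun a ha => by
        have := h3 a ha; omega⟩
    | head i b s =>
      have hN : N ∉ headsOf L := fun h => by have := h3 N h; omega
      refine ⟨.head i N s :: L, fun a => if a = N then b else lab a, ?_, ?_, ?_⟩
      · rw [List.map_cons]
        congr 1
        · simp [Item.mapHead]
        · rw [← h1]
          refine List.map_congr_left fun y hy => ?_
          cases y with
          | tail => rfl
          | head j a t =>
            have : a ∈ headsOf L := List.mem_filterMap.2 ⟨_, hy, rfl⟩
            have hne : a ≠ N := fun h => hN (h ▸ this)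
            simp [Item.mapHead, hne]
      · exact List.nodup_cons.2 ⟨hN, h2⟩
      · intro a ha
        rcases List.mem_cons.1 ha with rfl | ha
        · exact le_rfl
        · have := h3 a ha; omega

/-- A list of items in which every marker has exactly one tail place describes a diagram. -/
theorem exists_realizes [Nonempty β] (P : List (Item n β β)) (hP : ListsAll (tailsOf P)) :
    ∃ D, Realizes P D := by
  classical
  obtain ⟨L, lab, h1, h2, -⟩ := exists_labelling P 0
  obtain ⟨ts, hts⟩ := exists_fibres (headsOf L) h2 lab
  have hL : ListsAll (tailsOf L) := by rwa [← h1, tailsOf_mapHead] at hP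
  exact ⟨ofWord _ (wordValid_letters hL h2 hts), L, lab, ts, h1, h2, hts, rfl⟩

theorem exists_injective_map {l l' : List ℕ} (h : l.Nodup) (h' : l'.Nodup)
    (hl : l.length = l'.length) : ∃ φ : ℕ → ℕ, Function.Injective φ ∧ l.map φ = l' := by
  obtain ⟨M, hM⟩ : ∃ M, ∀ a ∈ l', a < M := ⟨l'.sum + 1, fun a ha => by
    have := List.single_le_sum (l := l') (by simp) a ha
    omega⟩
  refine ⟨fun a => if a ∈ l then l'.getD (l.idxOf a) 0 else a + M, ?_, ?_⟩
  · have key : ∀ a ∈ l, ∃ h : l.idxOf a < l'.length, l'.getD (l.idxOf a) 0 = l'[l.idxOf a] := by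
      intro a ha
      have : l.idxOf a < l'.length := hl ▸ List.idxOf_lt_length_iff.2 ha
      exact ⟨this, by simp [List.getD, this]⟩
    intro a b hab
    by_cases ha : a ∈ l <;> by_cases hb : b ∈ l <;> simp only [ha, hb, if_true, if_false] at hab
    · obtain ⟨h1, e1⟩ := key a ha
      obtain ⟨h2, e2⟩ := key b hb
      rw [e1, e2] at hab
      have := (h'.getElem_inj_iff).1 hab
      exact (List.idxOf_inj ha).1 this
    · obtain ⟨h1, e1⟩ := key a ha
      have := hM _ (List.getElem_mem h1)
      omega
    · obtain ⟨h1, e1⟩ := key b hb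
      have := hM _ (List.getElem_mem h1)
      omega
    · omega
  · refine List.ext_getElem (by simp [hl]) ?_
    intro k h1 h2
    have hk : k < l.length := by simpa using h1
    simp [h.idxOf_getElem, h2]

theorem mapHead_eq_of_heads {f f' : ℕ → β} {φ : ℕ → ℕ} : ∀ {L L' : List (Item n τ ℕ)},
    L.map (Item.mapHead f) = L'.map (Item.mapHead f') → (headsOf L).map φ = headsOf L' →
      L.map (Item.mapHead φ) = L'
  | [], [], _, _ => rfl
  | [], _ :: _, h, _ => by simp at h
  | _ :: _, [], h, _ => by simp at h
  | x :: L, y :: L', h, h' => by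
    rw [List.map_cons, List.map_cons, List.cons.injEq] at h
    cases x <;> cases y <;> simp only [Item.mapHead, reduceCtorEq, false_and] at h
    · have := mapHead_eq_of_heads h.2 h'
      rw [List.map_cons, this]
      obtain ⟨rfl, rfl⟩ := Item.tail.inj h.1
      rfl
    · have h2 := h'
      simp only [headsOf, List.filterMap_cons, Item.getHead?, List.map_cons, List.cons.injEq] at h2
      have := mapHead_eq_of_heads h.2 h2.2
      have h1 := h.1
      simp only [Item.head.injEq] at h1
      rw [List.map_cons, this, Item.mapHead, h2.1, h1.1, h1.2.2]

theorem letters_map (φ : ℕ → ℕ) (ts : β → List ℕ) (L : List (Item n β ℕ)) :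
    (L.map (Item.mapHead φ)).flatMap (Item.letters fun b => (ts b).map φ)
      = (L.flatMap (Item.letters ts)).map (Prod.map id (Letter.relabel φ)) := by
  induction L with
  | nil => rfl
  | cons x L ih =>
    rw [List.map_cons, List.flatMap_cons, List.flatMap_cons, List.map_append, ih]
    cases x <;> simp [Item.mapHead, Item.letters, Letter.relabel]

/-- By the OC move, the order of the tails at a place is irrelevant. -/
theorem toLink_letters_congr {ts ts' : β → List ℕ} (h : ∀ b, (ts b).Perm (ts' b)) :
    ∀ (L : List (Item n β ℕ)) (A : List (Fin n × Letter))
      (hA : WordValid (A ++ L.flatMap (Item.letters ts)))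
      (hB : WordValid (A ++ L.flatMap (Item.letters ts'))),
      (ofWord _ hA).toLink = (ofWord _ hB).toLink := by
  intro L
  induction L with
  | nil => intros; rfl
  | cons x L ih =>
    intro A hA hB
    have e : ∀ t : β → List ℕ, A ++ (x :: L).flatMap (Item.letters t)
        = (A ++ x.letters t) ++ L.flatMap (Item.letters t) := by simp
    have hp : (x.letters ts).Perm (x.letters ts') := by
      cases x with
      | tail i b => exact (h b).map _
      | head => exact List.Perm.refl _
    have hC : WordValid ((A ++ x.letters ts') ++ L.flatMap (Item.letters ts)) := by
      refine hA.of_perm (List.Perm.map _ ?_)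
      rw [e]
      exact (hp.append_left A).append_right _
    have h2 := ih (A ++ x.letters ts') hC (e ts' ▸ hB)
    have h1 : (ofWord _ (e ts ▸ hA)).toLink = (ofWord _ hC).toLink := by
      cases x with
      | tail i b => exact toLink_tails_perm i (h b) A _ _ _
      | head => rfl
    simpa only [e] using h1.trans h2

/-- The welded string link described by a list of items is well defined. -/
theorem Realizes.toLink_eq {P : List (Item n β β)} {D E : Diagram n} (hD : Realizes P D)
    (hE : Realizes P E) : D.toLink = E.toLink := by
  obtain ⟨L, lab, ts, h1, h2, h3, h4⟩ := hD
  obtain ⟨L', lab', ts', h1', h2', h3', h4'⟩ := hE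
  have hlab : (headsOf L).map lab = (headsOf L').map lab' := by
    rw [← headsOf_mapHead, ← headsOf_mapHead, h1, h1']
  have hlen : (headsOf L).length = (headsOf L').length := by
    simpa using congrArg List.length hlab
  obtain ⟨φ, hφ, hm⟩ := exists_injective_map h2 h2' hlen
  have hL : L.map (Item.mapHead φ) = L' := mapHead_eq_of_heads (h1.trans h1'.symm) hm
  have hlab' : ∀ a ∈ headsOf L, lab' (φ a) = lab a := by
    rw [← hm, List.map_map] at hlab
    intro a ha
    exact (List.map_inj_left.1 hlab a ha).symm
  have hs : strandOf (L'.flatMap (Item.letters fun b => (ts b).map φ))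
      = fun i => (D.strand i).map (Letter.relabel φ) := by
    funext i
    rw [← hL, letters_map, strandOf_map, h4]
  have hp : ∀ b, ((ts b).map φ).Perm (ts' b) := by
    intro b
    refine (List.perm_ext_iff_of_nodup ((h3 b).1.map hφ) (h3' b).1).2 fun a => ?_
    rw [(h3' b).2, ← hm, List.mem_map, List.mem_map]
    constructor
    · rintro ⟨c, hc, rfl⟩
      have := ((h3 b).2 c).1 hc
      exact ⟨⟨c, this.1, rfl⟩, (hlab' c this.1).trans this.2⟩
    · rintro ⟨⟨c, hc, rfl⟩, hb⟩
      exact ⟨c, ((h3 b).2 c).2 ⟨hc, (hlab' c hc).symm.trans hb⟩, rfl⟩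
  have hE' := eq_ofWord h4'
  have hV' := wordValid_of_strand h4'
  have hVm : WordValid (L'.flatMap (Item.letters fun b => (ts b).map φ)) := by
    refine hV'.of_perm (List.Perm.map _ ?_)
    refine List.Perm.flatMap_left _ fun x _ => ?_
    cases x with
    | tail i b => exact ((hp b).map _).symm
    | head => exact List.Perm.refl _
  have e1 : D.toLink = (ofWord _ hVm).toLink :=
    toLink_eq_of_move (.relabel _ _ φ hφ fun i => congrFun hs i)
  have e2 := toLink_letters_congr hp L' [] hVm hV'
  rw [e1, hE']
  exact e2

end Realizes

/-! ### Equivalence of lists of items -/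

/-- `w_k`-equivalence in both directions. -/
def WkEquivBoth {n : ℕ} (k : ℕ) (L L' : WeldedStringLink n) : Prop :=
  WkEquiv k L L' ∧ WkEquiv k L' L

section Eqv

variable {n : ℕ} {β β' β'' : Type}

/-- Lists of items are equivalent if every marker has exactly one tail place in both of them or in none,
and in the first case they describe `w_4`-equivalent welded string links. -/
def Eqv (P : List (Item n β β)) (P' : List (Item n β' β')) : Prop :=
  (ListsAll (tailsOf P) ↔ ListsAll (tailsOf P')) ∧
    (ListsAll (tailsOf P) → ListsAll (tailsOf P') →
      ∃ D D', Realizes P D ∧ Realizes P' D' ∧ WkEquivBoth 4 D.toLink D'.toLink)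

theorem Eqv.refl [Nonempty β] (P : List (Item n β β)) : Eqv P P :=
  ⟨Iff.rfl, fun h _ => by
    obtain ⟨D, hD⟩ := exists_realizes P h
    exact ⟨D, D, hD, hD, .refl, .refl⟩⟩

theorem Eqv.symm {P : List (Item n β β)} {P' : List (Item n β' β')} (h : Eqv P P') : Eqv P' P :=
  ⟨h.1.symm, fun h1 h2 => by
    obtain ⟨D, D', a, b, c⟩ := h.2 h2 h1
    exact ⟨D', D, b, a, c.2, c.1⟩⟩

theorem Eqv.trans {P : List (Item n β β)} {P' : List (Item n β' β')} {P'' : List (Item n β'' β'')}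
    (h : Eqv P P') (h' : Eqv P' P'') : Eqv P P'' :=
  ⟨h.1.trans h'.1, fun h1 h2 => by
    obtain ⟨D, D', a, b, c⟩ := h.2 h1 (h.1.1 h1)
    obtain ⟨E, E', a', b', c'⟩ := h'.2 (h.1.1 h1) h2
    have e := b.toLink_eq a'
    rw [e] at c
    exact ⟨D, E', a, b', c.1.trans c'.1, c'.2.trans c.2⟩⟩

theorem Eqv.of_eq [Nonempty β] {P P' : List (Item n β β)} (h : P = P') : Eqv P P' := h ▸ .refl P

theorem Eqv.wkEquiv {P : List (Item n β β)} {P' : List (Item n β' β')} (h : Eqv P P')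
    (hP : ListsAll (tailsOf P)) {D D' : Diagram n} (hD : Realizes P D) (hD' : Realizes P' D') :
    WkEquiv 4 D.toLink D'.toLink := by
  obtain ⟨E, E', a, b, c⟩ := h.2 hP (h.1.1 hP)
  rw [hD.toLink_eq a, hD'.toLink_eq b]
  exact c.1

theorem listsAll_of_perm {α : Type} {l l' : List α} (h : l.Perm l') : ListsAll l ↔ ListsAll l' := by
  simp only [ListsAll, h.nodup_iff, h.mem_iff]

end Eqv

/-! ### Rules for the equivalence of lists of items -/

section Rules

variable {n : ℕ} {β β' : Type}

theorem eqv_of_realizes [Nonempty β] {P : List (Item n β β)} {P' : List (Item n β' β')}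
    (ht : ListsAll (tailsOf P) ↔ ListsAll (tailsOf P'))
    (h : ListsAll (tailsOf P) → ListsAll (tailsOf P') → ∀ D, Realizes P D → ∃ D', Realizes P' D' ∧
      WkEquivBoth 4 D.toLink D'.toLink) : Eqv P P' := by
  refine ⟨ht, fun h1 h2 => ?_⟩
  obtain ⟨D, hD⟩ := exists_realizes P h1
  obtain ⟨D', hD', hw⟩ := h h1 h2 D hD
  exact ⟨D, D', hD, hD', hw⟩

theorem WkEquivBoth.of_eq {k : ℕ} {L L' : WeldedStringLink n} (h : L = L') : WkEquivBoth k L L' :=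
  h ▸ ⟨.refl, .refl⟩

/-- The strand of an item. -/
def Item.strand {τ η : Type} : Item n τ η → Fin n
  | tail i _ => i
  | head i _ _ => i

theorem strandOf_letters_eq_nil {ts : β → List ℕ} {L : List (Item n β ℕ)} {i : Fin n}
    (h : ∀ x ∈ L, x.strand ≠ i) : strandOf (L.flatMap (Item.letters ts)) i = [] := by
  induction L with
  | nil => rfl
  | cons x L ih =>
    rw [List.flatMap_cons, strandOf_append, ih fun y hy => h y (List.mem_cons_of_mem _ hy)]
    have hx := h x List.mem_cons_self
    cases x with
    | tail j b =>
      have hx : j ≠ i := hx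
      rw [Item.letters]
      have := strandOf_tag j i ((ts b).map Letter.tail)
      rw [List.map_map] at this
      simpa [hx, Function.comp_def] using this
    | head j a s =>
      have hx : j ≠ i := hx
      simp [Item.letters, strandOf, hx]

/-- Items on different strands may be exchanged. -/
theorem Eqv.swap [Nonempty β] (l₁ u v l₂ : List (Item n β β))
    (h : ∀ x ∈ u, ∀ y ∈ v, x.strand ≠ y.strand) :
    Eqv (l₁ ++ u ++ v ++ l₂) (l₁ ++ v ++ u ++ l₂) := by
  refine eqv_of_realizes (listsAll_of_perm (List.Perm.filterMap _ ?_)) ?_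
  · refine List.Perm.append_right l₂ ?_
    rw [List.append_assoc, List.append_assoc]
    exact List.perm_append_comm.append_left l₁
  rintro _ _ D ⟨L, lab, ts, h1, h2, h3, h4⟩
  obtain ⟨M, L₂, rfl, h5, rfl⟩ := List.map_eq_append_iff.1 h1
  obtain ⟨N, V, rfl, h6, rfl⟩ := List.map_eq_append_iff.1 h5
  obtain ⟨L₁, U, rfl, rfl, rfl⟩ := List.map_eq_append_iff.1 h6
  have hp : (headsOf (L₁ ++ U ++ V ++ L₂)).Perm (headsOf (L₁ ++ V ++ U ++ L₂)) := by
    refine List.Perm.filterMap _ ?_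
    refine List.Perm.append_right L₂ ?_
    rw [List.append_assoc, List.append_assoc]
    exact List.perm_append_comm.append_left L₁
  have hs : ∀ x : Item n β ℕ, (x.mapHead lab).strand = x.strand := by intro x; cases x <;> rfl
  refine ⟨D, ⟨L₁ ++ V ++ U ++ L₂, lab, ts, by simp, hp.nodup_iff.1 h2, fun b => ⟨(h3 b).1, fun a => ?_⟩,
    ?_⟩, .of_eq rfl⟩
  · rw [(h3 b).2, hp.mem_iff]
  · rw [h4]
    funext i
    simp only [List.flatMap_append, strandOf_append, List.append_assoc]
    congr 1
    rw [← List.append_assoc, ← List.append_assoc]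
    congr 1
    by_cases hi : ∃ x ∈ U, x.strand = i
    · obtain ⟨x, hx, rfl⟩ := hi
      have : strandOf (V.flatMap (Item.letters ts)) x.strand = [] := by
        refine strandOf_letters_eq_nil fun y hy => ?_
        have := h _ (List.mem_map_of_mem hx) _ (List.mem_map_of_mem hy)
        rw [hs, hs] at this
        exact this.symm
      simp [this]
    · have : strandOf (U.flatMap (Item.letters ts)) i = [] := by
        refine strandOf_letters_eq_nil fun y hy hyi => hi ⟨y, hy, hyi⟩
      simp [this]

/-- Replace every tail place by a sequence of tail places. -/
def Item.expand {τ τ' η : Type} (pre : τ' → List τ) : Item n τ' η → List (Item n τ η)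
  | tail i b => (pre b).map (tail i)
  | head i x s => [head i x s]

theorem exists_expand_lift {pre : β' → List β} {lab : ℕ → β} :
    ∀ (Q : List (Item n β' β)) (L : List (Item n β ℕ)),
      L.map (Item.mapHead lab) = Q.flatMap (Item.expand pre) →
      ∃ L' : List (Item n β' ℕ), L'.map (Item.mapHead lab) = Q ∧ L = L'.flatMap (Item.expand pre)
  | [], L, h => ⟨[], rfl, by simpa using h⟩
  | x :: Q, L, h => by
    rw [List.flatMap_cons] at h
    obtain ⟨L₁, L₂, rfl, h1, h2⟩ := List.map_eq_append_iff.1 h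
    obtain ⟨L', h3, rfl⟩ := exists_expand_lift Q L₂ h2
    cases x with
    | tail i b =>
      refine ⟨.tail i b :: L', by simp [h3, Item.mapHead], ?_⟩
      rw [List.flatMap_cons]
      congr 1
      have : ∀ (p : List β) (M : List (Item n β ℕ)), M.map (Item.mapHead lab)
          = p.map (Item.tail i) → M = p.map (Item.tail i) := by
        intro p
        induction p with
        | nil => intro M hM; simpa using hM
        | cons b p ih =>
          intro M hM
          cases M with
          | nil => simp at hM
          | cons y M =>
            rw [List.map_cons, List.map_cons, List.cons.injEq] at hM
            rw [ih M hM.2, List.map_cons]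
            cases y with
            | tail j c => exact congrArg (· :: _) (show Item.tail _ _ = Item.tail _ _ by
                have := hM.1; simp only [Item.mapHead, Item.tail.injEq] at this
                rw [this.1, this.2])
            | head j c s => have := hM.1; simp [Item.mapHead] at this
      exact this _ _ h1
    | head i b s =>
      obtain ⟨y, M, rfl, h4, h5⟩ := List.map_eq_cons_iff.1 h1
      have hM : M = [] := by simpa using h5
      subst hM
      cases y with
      | tail => simp [Item.mapHead] at h4
      | head j a t =>
        refine ⟨.head j a t :: L', ?_, rfl⟩
        rw [List.map_cons, h3]
        obtain ⟨rfl, rfl, rfl⟩ := Item.head.inj h4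
        rfl

/-- Tail places next to each other may be united. -/
theorem Realizes.merge (Q : List (Item n β' β)) (g : β → β') (pre : β' → List β)
    (hpre : ∀ b', (pre b').Nodup ∧ ∀ b, b ∈ pre b' ↔ g b = b') {D : Diagram n}
    (h : Realizes (Q.flatMap (Item.expand pre)) D) : Realizes (Q.map (Item.mapHead g)) D := by
  obtain ⟨L, lab, ts, h1, h2, h3, h4⟩ := h
  obtain ⟨L', rfl, rfl⟩ := exists_expand_lift Q L h1
  have hh : headsOf (L'.flatMap (Item.expand pre)) = headsOf L' := by
    clear h1 h2 h3 h4
    induction L' with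
    | nil => rfl
    | cons x L' ih =>
      rw [List.flatMap_cons, headsOf_append, ih]
      cases x with
      | tail i b =>
        have : headsOf ((pre b).map (Item.tail i : β → Item n β ℕ)) = [] := by
          induction pre b with
          | nil => rfl
          | cons c p ih => exact ih
        rw [Item.expand, this]; rfl
      | head => rfl
  refine ⟨L', g ∘ lab, fun b' => (pre b').flatMap ts, ?_, hh ▸ h2, ?_, ?_⟩
  · rw [List.map_map]
    congr 1; funext x; cases x <;> rfl
  · intro b'
    refine ⟨nodup_flatMap_fibres (hpre b').1 h3, fun a => ?_⟩
    simp only [List.mem_flatMap, (h3 _).2, hh, (hpre b').2, Function.comp]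
    constructor
    · rintro ⟨b, hb, ha, rfl⟩; exact ⟨ha, hb⟩
    · rintro ⟨ha, hb⟩; exact ⟨_, hb, ha, rfl⟩
  · rw [h4, List.flatMap_assoc]
    congr 2; funext x
    cases x with
    | tail i b =>
      simp [Item.expand, Item.letters, List.flatMap_map, List.map_flatMap]
    | head => simp [Item.expand, Item.letters]

theorem Eqv.merge [Nonempty β] (Q : List (Item n β' β)) (g : β → β') (pre : β' → List β)
    (hpre : ∀ b', (pre b').Nodup ∧ ∀ b, b ∈ pre b' ↔ g b = b')
    (ht : ListsAll (tailsOf (Q.flatMap (Item.expand pre))) ↔ ListsAll (tailsOf Q)) :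
    Eqv (Q.flatMap (Item.expand pre)) (Q.map (Item.mapHead g)) :=
  eqv_of_realizes (by rw [tailsOf_mapHead, ht])
    fun _ _ D hD => ⟨D, hD.merge Q g pre hpre, .of_eq rfl⟩

/-! ### The second and third Reidemeister moves in contexts

A context is a list of items in which the tail places of the form `tail i (inr k)` are holes. -/

/-- Fill the holes. -/
def Item.plug {κ η : Type} (f : Fin n → κ → List (Item n β η)) :
    Item n (β ⊕ κ) η → List (Item n β η)
  | tail i (.inl b) => [tail i b]
  | tail i (.inr k) => f i k
  | head i x s => [head i x s]

theorem tailsOf_plug {κ η : Type} {f : Fin n → κ → List (Item n β η)} {T : κ → List β}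
    (hf : ∀ i k, tailsOf (f i k) = T k) (K : List (Item n (β ⊕ κ) η)) :
    tailsOf (K.flatMap (Item.plug f)) = (tailsOf K).flatMap (Sum.elim (fun b => [b]) T) := by
  induction K with
  | nil => rfl
  | cons x K ih =>
    rw [List.flatMap_cons, tailsOf_append, ih]
    rcases x with ⟨i, b | k⟩ | ⟨i, x, s⟩
    · rfl
    · rw [Item.plug, hf]; rfl
    · rfl

theorem headsOf_plug_perm {κ η : Type} {f : Fin n → κ → List (Item n β η)} {T : κ → List η}
    (hf : ∀ i k, headsOf (f i k) = T k) (K : List (Item n (β ⊕ κ) η)) :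
    (headsOf (K.flatMap (Item.plug f))).Perm
      (((tailsOf K).filterMap Sum.getRight?).flatMap T ++ headsOf K) := by
  induction K with
  | nil => exact List.Perm.refl _
  | cons x K ih =>
    rw [List.flatMap_cons, headsOf_append]
    rcases x with ⟨i, b | k⟩ | ⟨i, x, s⟩
    · exact ih
    · rw [Item.plug, hf]
      refine (ih.append_left _).trans (.of_eq ?_)
      rw [← List.append_assoc]
      rfl
    · exact List.Perm.trans (ih.cons x) List.perm_middle.symm

theorem nodup_of_sum {κ : Type} (T : List (β ⊕ κ)) (h : (T.filterMap Sum.getLeft?).Nodup)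
    (h' : (T.filterMap Sum.getRight?).Nodup) : T.Nodup := by
  induction T with
  | nil => exact List.nodup_nil
  | cons x T ih =>
    rcases x with b | k
    · have h := List.nodup_cons.1 (show (b :: T.filterMap Sum.getLeft?).Nodup from h)
      refine List.nodup_cons.2 ⟨fun hm => h.1 (List.mem_filterMap.2 ⟨_, hm, rfl⟩), ih h.2 h'⟩
    · have h' := List.nodup_cons.1 (show (k :: T.filterMap Sum.getRight?).Nodup from h')
      refine List.nodup_cons.2 ⟨fun hm => h'.1 (List.mem_filterMap.2 ⟨_, hm, rfl⟩), ih h h'.2⟩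

theorem sublist_flatMap_sum {κ : Type} (T : List (β ⊕ κ)) (t : κ → List β) :
    (T.filterMap Sum.getLeft?).Sublist (T.flatMap (Sum.elim (fun b => [b]) t)) := by
  induction T with
  | nil => exact List.Sublist.refl _
  | cons x T ih =>
    rcases x with b | k
    · exact ih.cons_cons b
    · exact ih.trans (List.sublist_append_right _ _)

/-- If every marker occurs exactly once after the holes have been filled, then the context has no repeated
marker or hole, and a marker occurs outside of the holes if and only if it is in none of the fillings. -/
theorem context_tails {κ : Type} {T : List (β ⊕ κ)} {t : κ → List β}
    (h : ListsAll (T.flatMap (Sum.elim (fun b => [b]) t)))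
    (hk : ListsAll (T.filterMap Sum.getRight?)) :
    T.Nodup ∧ (∀ k, .inr k ∈ T) ∧ (∀ b, .inl b ∈ T ↔ ∀ k, b ∉ t k) := by
  have hT : T.Nodup := nodup_of_sum T (h.1.sublist (sublist_flatMap_sum T t)) hk.1
  have hr : ∀ k, Sum.inr k ∈ T := by
    intro k
    obtain ⟨x, hx, hxk⟩ := List.mem_filterMap.1 (hk.2 k)
    rcases x with b | k'
    · simp at hxk
    · simp only [Sum.getRight?_inr, Option.some.injEq] at hxk
      exact hxk ▸ hx
  refine ⟨hT, hr, fun b => ⟨fun hb k hbk => ?_, fun hb => ?_⟩⟩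
  · have hd := (List.nodup_flatMap.1 h.1).2
    have : Std.Symm (Function.onFun List.Disjoint (Sum.elim (fun b => [b]) t)) :=
      ⟨fun _ _ h => h.symm⟩
    exact hd.forall hb (hr k) (by simp) (List.mem_singleton_self b) hbk
  · obtain ⟨x, hx, hxb⟩ := List.mem_flatMap.1 (h.2 b)
    rcases x with b' | k
    · simp only [Sum.elim_inl, List.mem_singleton] at hxb
      exact hxb ▸ hx
    · exact absurd hxb (hb k)

theorem listsAll_flatMap {γ δ : Type} {T : List γ} (hT : T.Nodup) (h : γ → List δ)
    (h1 : ∀ x, (h x).Nodup) (h2 : ∀ x y d, d ∈ h x → d ∈ h y → x = y)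
    (h3 : ∀ d, ∃ x ∈ T, d ∈ h x) : ListsAll (T.flatMap h) := by
  refine ⟨List.nodup_flatMap.2 ⟨fun x _ => h1 x, hT.imp ?_⟩, fun d => ?_⟩
  · intro x y hxy d hx hy
    exact hxy (h2 x y d hx hy)
  · exact List.mem_flatMap.2 (h3 d)

theorem mapHead_congr {τ η η' : Type} {f g : η → η'} {K : List (Item n τ η)}
    (h : ∀ a ∈ headsOf K, f a = g a) : K.map (Item.mapHead f) = K.map (Item.mapHead g) := by
  refine List.map_congr_left fun x hx => ?_
  cases x with
  | tail => rfl
  | head i a s => rw [Item.mapHead, Item.mapHead, h a (List.mem_filterMap.2 ⟨_, hx, rfl⟩)]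

theorem map_plug {κ η η' : Type} (φ : η → η') (f : Fin n → κ → List (Item n β η))
    (K : List (Item n (β ⊕ κ) η)) :
    (K.flatMap (Item.plug f)).map (Item.mapHead φ)
      = (K.map (Item.mapHead φ)).flatMap (Item.plug fun i k => (f i k).map (Item.mapHead φ)) := by
  induction K with
  | nil => rfl
  | cons x K ih =>
    rw [List.flatMap_cons, List.map_append, ih, List.map_cons, List.flatMap_cons]
    congr 1
    rcases x with ⟨i, b | k⟩ | ⟨i, x, s⟩ <;> rfl

theorem filterMap_flatMap_tails {κ ι : Type} (E : Item n (β ⊕ κ) ℕ → List (Fin n × (Letter ⊕ ι)))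
    (h : β ⊕ κ → List ι) (hE : ∀ i x, (E (.tail i x)).filterMap (fun p => p.2.getRight?) = h x)
    (hE' : ∀ i a s, (E (.head i a s)).filterMap (fun p => p.2.getRight?) = [])
    (K : List (Item n (β ⊕ κ) ℕ)) :
    (K.flatMap E).filterMap (fun p => p.2.getRight?) = (tailsOf K).flatMap h := by
  induction K with
  | nil => rfl
  | cons x K ih =>
    rw [List.flatMap_cons, List.filterMap_append, ih]
    cases x with
    | tail i x => rw [hE]; rfl
    | head i a s => rw [hE']; rfl

theorem fillWord_flatMap {κ ι : Type} {E : Item n (β ⊕ κ) ℕ → List (Fin n × (Letter ⊕ ι))}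
    {f : Fin n → κ → List (Item n β ℕ)} {ts : β → List ℕ} {F : ι → List Letter}
    (K : List (Item n (β ⊕ κ) ℕ))
    (h : ∀ x ∈ K, fillWord (E x) F = (x.plug f).flatMap (Item.letters ts)) :
    fillWord (K.flatMap E) F = (K.flatMap (Item.plug f)).flatMap (Item.letters ts) := by
  induction K with
  | nil => rfl
  | cons x K ih =>
    rw [List.flatMap_cons, fillWord_append, h x List.mem_cons_self,
      ih fun y hy => h y (List.mem_cons_of_mem _ hy), List.flatMap_cons, List.flatMap_append]

theorem fillWord_tails {ι : Type} (i : Fin n) (l : List ℕ) (F : ι → List Letter) :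
    fillWord (l.map fun a => (i, Sum.inl (Letter.tail a))) F
      = l.map fun a => (i, Letter.tail a) := by
  have := fillWord_inl (l.map fun a => (i, Letter.tail a)) F
  rwa [List.map_map] at this

theorem filterMap_getRight_tails {ι : Type} (i : Fin n) (l : List ℕ) :
    (l.map fun a => (i, (Sum.inl (Letter.tail a) : Letter ⊕ ι))).filterMap
      (fun p => p.2.getRight?) = [] := by
  induction l <;> simp_all

/-- Two adjacent heads of arrows with the same marker and opposite signs may be created. -/
theorem Eqv.cancel_context [Nonempty β] (K : List (Item n (β ⊕ Unit) β))
    (hK : ListsAll ((tailsOf K).filterMap Sum.getRight?)) (c : β) (s : ℤˣ) :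
    Eqv (K.flatMap (Item.plug fun _ _ => []))
      (K.flatMap (Item.plug fun i _ => [.head i c s, .head i c (-s)])) := by
  classical
  have ht : tailsOf (K.flatMap (Item.plug fun i _ => [.head i c s, .head i c (-s)]))
      = tailsOf (K.flatMap (Item.plug fun _ _ => [])) := by
    rw [tailsOf_plug (T := fun _ => []) (fun _ _ => rfl), tailsOf_plug (T := fun _ => []) (fun _ _ => rfl)]
  refine ⟨by rw [ht], fun hP hP' => ?_⟩
  obtain ⟨K, lab₀, rfl, hH, hge⟩ := exists_labelling K 2
  rw [tailsOf_mapHead] at hK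
  have hT := hP
  rw [tailsOf_plug (T := fun _ => []) (fun _ _ => rfl), tailsOf_mapHead] at hT
  obtain ⟨hT1, hT2, hT3⟩ := context_tails hT hK
  set lab : ℕ → β := fun a => if a < 2 then c else lab₀ a with hlab
  have hlabK : K.map (Item.mapHead lab) = K.map (Item.mapHead lab₀) :=
    mapHead_congr fun a ha => by have := hge a ha; simp only [hlab]; rw [if_neg (by omega)]
  obtain ⟨F, hF⟩ := exists_fibres (headsOf K) hH lab
  set f : Fin n → Unit → List (Item n β ℕ) := fun i _ => []
  set f' : Fin n → Unit → List (Item n β ℕ) := fun i _ => [.head i 0 s, .head i 1 (-s)]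
  have hu : (tailsOf K).filterMap Sum.getRight? = [()] :=
    List.perm_singleton.1 ((List.perm_ext_iff_of_nodup hK.1 (List.nodup_singleton ())).2
      fun b => iff_of_true (hK.2 b) (by simp))
  have hh : (headsOf (K.flatMap (Item.plug f))).Perm (headsOf K) := by
    have := headsOf_plug_perm (f := f) (T := fun _ => []) (fun _ _ => rfl) K
    rwa [hu] at this
  have hh' : (headsOf (K.flatMap (Item.plug f'))).Perm (0 :: 1 :: headsOf K) := by
    simpa [hu] using headsOf_plug_perm (f := f') (T := fun _ => [0, 1]) (fun _ _ => rfl) K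
  have hH' : (0 :: 1 :: headsOf K).Nodup := by
    refine List.nodup_cons.2 ⟨?_, List.nodup_cons.2 ⟨?_, hH⟩⟩
    · intro h
      rcases List.mem_cons.1 h with h | h
      · omega
      · have := hge _ h; omega
    · intro h; have := hge _ h; omega
  have hFge : ∀ b a, a ∈ F b → 2 ≤ a := fun b a ha => hge a (((hF b).2 a).1 ha).1
  set ts' : β → List ℕ := fun b => (if b = c then [0, 1] else []) ++ F b with hts'
  have hF' : ∀ b, (ts' b).Nodup ∧ ∀ a, a ∈ ts' b ↔
      a ∈ headsOf (K.flatMap (Item.plug f')) ∧ lab a = b := by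
    intro b
    constructor
    · refine List.Nodup.append (by split_ifs <;> decide) (hF b).1 ?_
      intro a h1 h2
      have := hFge b a h2
      split_ifs at h1 <;> simp at h1
      omega
    · intro a
      rw [hh'.mem_iff, hts', List.mem_append, (hF b).2, List.mem_cons, List.mem_cons]
      by_cases ha : a < 2
      · have h1 : a ∉ headsOf K := fun h => by have := hge a h; omega
        have h2 : lab a = c := by rw [hlab]; exact if_pos ha
        have h3 : a = 0 ∨ a = 1 := by omega
        by_cases hb : b = c <;> simp [h1, h2, hb, h3]
        exact fun h => hb h.symm
      · have h3 : a ≠ 0 := by omega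
        have h4 : a ≠ 1 := by omega
        by_cases hb : b = c <;> simp [h3, h4, hb]
  have hFF : ∀ b, (F b).Nodup ∧ ∀ a, a ∈ F b ↔
      a ∈ headsOf (K.flatMap (Item.plug f)) ∧ lab a = b :=
    fun b => ⟨(hF b).1, fun a => by rw [(hF b).2, hh.mem_iff]⟩
  have hLt : ListsAll (tailsOf (K.flatMap (Item.plug f))) := by
    rw [tailsOf_plug (T := fun _ => []) (fun _ _ => rfl)]; exact hT
  have hLt' : ListsAll (tailsOf (K.flatMap (Item.plug f'))) := by
    rw [tailsOf_plug (T := fun _ => []) (fun _ _ => rfl)]; exact hT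
  have hW := wordValid_letters hLt (hh.nodup_iff.2 hH) hFF
  have hW' := wordValid_letters hLt' (hh'.nodup_iff.2 hH') hF'
  -- the places of the move: `0` next to the tails with marker `c`, `1` at the hole
  let E : Item n (β ⊕ Unit) ℕ → List (Fin n × (Letter ⊕ Fin 2)) := fun x => match x with
    | .tail i (.inl b) => (if b = c then [(i, .inr 0)] else [])
        ++ (F b).map fun a => (i, .inl (.tail a))
    | .tail i (.inr _) => [(i, .inr 1)]
    | .head i a s => [(i, .inl (.head a s))]
  have hE : ListsAll ((K.flatMap E).filterMap fun p => p.2.getRight?) := by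
    rw [filterMap_flatMap_tails E (Sum.elim (fun b => if b = c then [0] else []) fun _ => [1])]
    · refine listsAll_flatMap hT1 _ ?_ ?_ ?_
      · rintro (b | u)
        · by_cases hb : b = c <;> simp [hb]
        · simp
      · rintro (b | u) (b' | u') d h1 h2 <;>
          simp only [Sum.elim_inl, Sum.elim_inr] at h1 h2 <;> (try split_ifs at h1 h2) <;> simp_all
      · intro d
        fin_cases d
        · exact ⟨.inl c, (hT3 c).2 (by simp), by simp⟩
        · exact ⟨.inr (), hT2 (), by simp⟩
    · rintro i (b | u)
      · simp only [E, List.filterMap_append, filterMap_getRight_tails]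
        by_cases hb : b = c <;> simp [hb]
      · rfl
    · intro i a s; rfl
  have e1 : fillWord (K.flatMap E) ![[], []] = (K.flatMap (Item.plug f)).flatMap (Item.letters F) := by
    refine fillWord_flatMap K fun x _ => ?_
    rcases x with ⟨i, b | u⟩ | ⟨i, a, s⟩
    · simp only [E, fillWord_append, fillWord_tails, Item.plug, List.flatMap_cons, List.flatMap_nil,
        Item.letters, List.append_nil]
      by_cases hb : b = c <;> simp [hb, fillWord, tagBind]
    · rfl
    · rfl
  have e2 : fillWord (K.flatMap E) ![[.tail 0, .tail 1], [.head 0 s, .head 1 (-s)]]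
      = (K.flatMap (Item.plug f')).flatMap (Item.letters ts') := by
    refine fillWord_flatMap K fun x _ => ?_
    rcases x with ⟨i, b | u⟩ | ⟨i, a, s⟩
    · simp only [E, fillWord_append, fillWord_tails, Item.plug, List.flatMap_cons, List.flatMap_nil,
        Item.letters, List.append_nil, hts', List.map_append]
      by_cases hb : b = c <;> simp [hb, fillWord, tagBind]
    · rfl
    · rfl
  have hm := toLink_eq_of_move (move_fillWord _ hE (.r2_parallel 0 1 s) (e1 ▸ hW) (e2 ▸ hW'))
  refine ⟨ofWord _ hW, ofWord _ hW', ⟨_, lab, F, ?_, hh.nodup_iff.2 hH, hFF, rfl⟩,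
    ⟨_, lab, ts', ?_, hh'.nodup_iff.2 hH', hF', rfl⟩, .of_eq ?_⟩
  · rw [map_plug, hlabK]; rfl
  · rw [map_plug, hlabK]; simp [f', Item.mapHead, hlab]
  · simpa only [e1, e2] using hm

/-- The third Reidemeister move for heads of signs `s`, `s` and `u`; the order of the two tails on the uppermost
strand depends on the signs. -/
theorem localMove_slide (s u : ℤˣ) (a b c : ℕ) :
    LocalMove 3
      ![(if s * u = 1 then [a, b] else [b, a]).map .tail, [.head a s, .tail c],
        [.head b s, .head c u]]
      ![(if s * u = 1 then [b, a] else [a, b]).map .tail, [.tail c, .head a s],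
        [.head c u, .head b s]] := by
  have h := LocalMove.r3 a b c s s u (s * u)
  rcases Int.units_eq_one_or s with rfl | rfl <;> rcases Int.units_eq_one_or u with rfl | rfl <;>
    simpa [ordered] using h

/-- The tails of the arrows `0` and `1` are at the place `c` and that of the arrow `2` is at the place `b`, all
other tails are where `F` puts them. -/
theorem fibres_slide [DecidableEq β] {H H' : List ℕ} {lab₀ : ℕ → β} {F : β → List ℕ}
    (hF : ∀ x, (F x).Nodup ∧ ∀ a, a ∈ F x ↔ a ∈ H ∧ lab₀ a = x) (hge : ∀ a ∈ H, 3 ≤ a) {b c : β}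
    (hcb : c ≠ b) {top : List ℕ} (top_nodup : top.Nodup) (mem_top : ∀ a, a ∈ top ↔ a < 2)
    (hh : H'.Perm (0 :: 1 :: 2 :: H)) (x : β) :
    ((if x = c then top else []) ++ ((if x = b then [2] else []) ++ F x)).Nodup ∧
      ∀ a, a ∈ (if x = c then top else []) ++ ((if x = b then [2] else []) ++ F x) ↔
        a ∈ H' ∧ (if a < 2 then c else if a = 2 then b else lab₀ a) = x := by
  have hFge : ∀ b a, a ∈ F b → 3 ≤ a := fun b a ha => hge a (((hF b).2 a).1 ha).1
  have hbc : b ≠ c := hcb.symm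
  constructor
  · refine List.Nodup.append (by split_ifs <;> simp [top_nodup])
      (List.Nodup.append (by split_ifs <;> decide) (hF x).1 ?_) ?_
    · intro a h1 h2
      have := hFge x a h2
      split_ifs at h1 <;> simp at h1
      omega
    · intro a h1 h2
      have h3 : a < 2 := by
        split_ifs at h1
        · exact (mem_top a).1 h1
        · simp at h1
      rcases List.mem_append.1 h2 with h2 | h2
      · split_ifs at h2 <;> simp at h2
        omega
      · have := hFge x a h2; omega
  · intro a
    rw [hh.mem_iff, List.mem_append, List.mem_append, (hF x).2]
    simp only [List.mem_cons]
    by_cases ha : a < 2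
    · have h1 : a ∉ H := fun h => by have := hge a h; omega
      have h3 : a = 0 ∨ a = 1 := by omega
      have h4 : a ≠ 2 := by omega
      have h5 := (mem_top a).2 ha
      by_cases hx : x = c
      · simp [hx, h5, ha]; tauto
      · by_cases hx' : x = b <;> simp [hx, hx', h1, h4, ha] <;> tauto
    · have h1 : a ∉ top := fun h => ha ((mem_top a).1 h)
      have h3 : a ≠ 0 := by omega
      have h4 : a ≠ 1 := by omega
      by_cases h2 : a = 2
      · subst h2
        have h6 : 2 ∉ H := fun h => by have := hge 2 h; omega
        by_cases hx : x = b
        · simp [hx]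
        · by_cases hx' : x = c <;> simp [hx', hx, h1, h6] <;> tauto
      · by_cases hx : x = b <;> by_cases hx' : x = c <;>
          simp [hx', hx, h1, h2, h3, h4, ha, hbc, hcb]

theorem listsAll_slide [DecidableEq β] {T : List (β ⊕ Fin 2)} (hT : T.Nodup) {c : β}
    (hc : .inl c ∈ T) (h0 : .inr 0 ∈ T) (h1 : .inr 1 ∈ T) :
    ListsAll (T.flatMap (Sum.elim (fun b => if b = c then [0] else [])
      fun k => if k = 0 then [1] else [2]) : List (Fin 3)) := by
  refine listsAll_flatMap hT _ ?_ ?_ ?_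
  · rintro (x | k)
    · by_cases hb : x = c <;> simp [hb]
    · by_cases hk : k = 0 <;> simp [hk]
  · rintro (x | k) (x' | k') d h1 h2
    · simp only [Sum.elim_inl] at h1 h2
      split_ifs at h1 h2 <;> simp_all
    · simp only [Sum.elim_inl, Sum.elim_inr] at h1 h2
      split_ifs at h1 h2 <;> simp_all
    · simp only [Sum.elim_inl, Sum.elim_inr] at h1 h2
      split_ifs at h1 h2 <;> simp_all
    · simp only [Sum.elim_inr] at h1 h2
      fin_cases k <;> fin_cases k' <;> simp_all
  · intro d
    fin_cases d
    · exact ⟨_, hc, by simp⟩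
    · exact ⟨_, h0, by simp⟩
    · exact ⟨_, h1, by simp⟩

/-- The third Reidemeister move: when the tail of an arrow slides over the head of an arrow with marker
`c`, its head is exchanged with a head of an arrow with the same marker `c`. -/
theorem Eqv.slide_context [Nonempty β] (K : List (Item n (β ⊕ Fin 2) β))
    (hK : ListsAll ((tailsOf K).filterMap Sum.getRight?)) (m b c : β) (hcm : c ≠ m) (hcb : c ≠ b)
    (s u : ℤˣ) :
    Eqv (K.flatMap (Item.plug fun i => ![[.tail i m, .head i c s, .tail i b],
        [.head i c s, .head i b u]]))
      (K.flatMap (Item.plug fun i => ![[.tail i m, .head i c s, .tail i b],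
        [.head i m u, .head i c s]])) := by
  classical
  have hp1 : ∀ (i : Fin n) (k : Fin 2), tailsOf ((![[.tail i m, .head i c s, .tail i b],
      [.head i c s, .head i b u]] : Fin 2 → List (Item n β β)) k) = (![[m, b], []] : Fin 2 → List β) k := by
    intro i k; fin_cases k <;> rfl
  have hp2 : ∀ (i : Fin n) (k : Fin 2), tailsOf ((![[.tail i m, .head i c s, .tail i b],
      [.head i m u, .head i c s]] : Fin 2 → List (Item n β β)) k) = (![[m, b], []] : Fin 2 → List β) k := by
    intro i k; fin_cases k <;> rfl
  refine ⟨by rw [tailsOf_plug hp1, tailsOf_plug hp2], fun hP hP' => ?_⟩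
  obtain ⟨K, lab₀, rfl, hH, hge⟩ := exists_labelling K 3
  rw [tailsOf_mapHead] at hK
  have hT := hP
  rw [tailsOf_plug hp1, tailsOf_mapHead] at hT
  obtain ⟨hT1, hT2, hT3⟩ := context_tails hT hK
  have hmb : m ≠ b := by
    have := (List.nodup_flatMap.1 hT.1).1 _ (hT2 0)
    simpa using this
  set lab : ℕ → β := fun a => if a < 2 then c else if a = 2 then b else lab₀ a with hlab
  set lab' : ℕ → β := fun a => if a < 2 then c else if a = 2 then m else lab₀ a with hlab'
  have hlabK : K.map (Item.mapHead lab) = K.map (Item.mapHead lab₀) :=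
    mapHead_congr fun a ha => by
      have := hge a ha; simp only [hlab]; rw [if_neg (by omega), if_neg (by omega)]
  have hlabK' : K.map (Item.mapHead lab') = K.map (Item.mapHead lab₀) :=
    mapHead_congr fun a ha => by
      have := hge a ha; simp only [hlab']; rw [if_neg (by omega), if_neg (by omega)]
  obtain ⟨F, hF⟩ := exists_fibres (headsOf K) hH lab₀
  set f : Fin n → Fin 2 → List (Item n β ℕ) := fun i =>
    ![[.tail i m, .head i 0 s, .tail i b], [.head i 1 s, .head i 2 u]]
  set f' : Fin n → Fin 2 → List (Item n β ℕ) := fun i =>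
    ![[.tail i m, .head i 0 s, .tail i b], [.head i 2 u, .head i 1 s]]
  have hq1 : ∀ i k, headsOf (f i k) = (![[0], [1, 2]] : Fin 2 → List ℕ) k := by
    intro i k; fin_cases k <;> rfl
  have hq2 : ∀ i k, headsOf (f' i k) = (![[0], [2, 1]] : Fin 2 → List ℕ) k := by
    intro i k; fin_cases k <;> rfl
  have ht1 : ∀ i k, tailsOf (f i k) = (![[m, b], []] : Fin 2 → List β) k := by
    intro i k; fin_cases k <;> rfl
  have ht2 : ∀ i k, tailsOf (f' i k) = (![[m, b], []] : Fin 2 → List β) k := by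
    intro i k; fin_cases k <;> rfl
  have hu : ((tailsOf K).filterMap Sum.getRight?).Perm [0, 1] :=
    (List.perm_ext_iff_of_nodup hK.1 (by decide)).2
      fun b => iff_of_true (hK.2 b) (by revert b; decide)
  have hh : (headsOf (K.flatMap (Item.plug f))).Perm (0 :: 1 :: 2 :: headsOf K) :=
    (headsOf_plug_perm hq1 K).trans ((hu.flatMap_right _).append_right _)
  have hh' : (headsOf (K.flatMap (Item.plug f'))).Perm (0 :: 1 :: 2 :: headsOf K) :=
    ((headsOf_plug_perm hq2 K).trans ((hu.flatMap_right _).append_right _)).trans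
      ((List.Perm.swap 1 2 _).cons 0)
  have hH' : (0 :: 1 :: 2 :: headsOf K).Nodup := by
    refine List.Nodup.append (l₁ := [0, 1, 2]) (by decide) hH ?_
    intro a h1 h2
    have := hge a h2
    simp at h1
    omega
  have hFge : ∀ b a, a ∈ F b → 3 ≤ a := fun b a ha => hge a (((hF b).2 a).1 ha).1
  have hbc : b ≠ c := hcb.symm
  have hmc : m ≠ c := hcm.symm
  have hbm : b ≠ m := hmb.symm
  set top : List ℕ := if s * u = 1 then [0, 1] else [1, 0] with htop
  set top' : List ℕ := if s * u = 1 then [1, 0] else [0, 1] with htop'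
  have top_nodup : top.Nodup := by rw [htop]; split_ifs <;> decide
  have top'_nodup : top'.Nodup := by rw [htop']; split_ifs <;> decide
  have mem_top : ∀ a, a ∈ top ↔ a < 2 := by intro a; rw [htop]; split_ifs <;> simp <;> omega
  have mem_top' : ∀ a, a ∈ top' ↔ a < 2 := by intro a; rw [htop']; split_ifs <;> simp <;> omega
  set ts : β → List ℕ := fun x =>
    (if x = c then top else []) ++ ((if x = b then [2] else []) ++ F x) with hts
  set ts' : β → List ℕ := fun x =>
    (if x = c then top' else []) ++ (F x ++ (if x = m then [2] else [])) with hts'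
  have hFF : ∀ x, (ts x).Nodup ∧ ∀ a, a ∈ ts x ↔
      a ∈ headsOf (K.flatMap (Item.plug f)) ∧ lab a = x :=
    fibres_slide hF hge hcb top_nodup mem_top hh
  have hFF' : ∀ x, (ts' x).Nodup ∧ ∀ a, a ∈ ts' x ↔
      a ∈ headsOf (K.flatMap (Item.plug f')) ∧ lab' a = x := by
    intro x
    have h := fibres_slide hF hge hcm top'_nodup mem_top' hh' x
    have hp : (ts' x).Perm ((if x = c then top' else []) ++ ((if x = m then [2] else []) ++ F x)) :=
      List.perm_append_comm.append_left _
    exact ⟨hp.nodup_iff.2 h.1, fun a => hp.mem_iff.trans (h.2 a)⟩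
  have hLt : ListsAll (tailsOf (K.flatMap (Item.plug f))) := by
    rw [tailsOf_plug ht1]; exact hT
  have hLt' : ListsAll (tailsOf (K.flatMap (Item.plug f'))) := by
    rw [tailsOf_plug ht2]; exact hT
  have hW := wordValid_letters hLt (hh.nodup_iff.2 hH') hFF
  have hW' := wordValid_letters hLt' (hh'.nodup_iff.2 hH') hFF'
  -- the places of the move: `0` next to the tails with marker `c`, `1` and `2` in the holes
  let E : Item n (β ⊕ Fin 2) ℕ → List (Fin n × (Letter ⊕ Fin 3)) := fun x => match x with
    | .tail i (.inl b) => (if b = c then [(i, .inr 0)] else [])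
        ++ (F b).map fun a => (i, .inl (.tail a))
    | .tail i (.inr k) => if k = 0 then ((F m).map fun a => (i, .inl (.tail a))) ++ [(i, .inr 1)]
        ++ ((F b).map fun a => (i, .inl (.tail a))) else [(i, .inr 2)]
    | .head i a s => [(i, .inl (.head a s))]
  have hE : ListsAll ((K.flatMap E).filterMap fun p => p.2.getRight?) := by
    rw [filterMap_flatMap_tails E (Sum.elim (fun b => if b = c then [0] else [])
      fun k => if k = 0 then [1] else [2])]
    · exact listsAll_slide hT1
        ((hT3 c).2 (by intro k; fin_cases k <;> simp [hcm, hcb])) (hT2 0) (hT2 1)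
    · rintro i (x | k)
      · simp only [E, List.filterMap_append, filterMap_getRight_tails]
        by_cases hb : x = c <;> simp [hb]
      · by_cases hk : k = 0
        · subst hk
          simp only [E, if_true, List.filterMap_append, filterMap_getRight_tails]
          rfl
        · obtain rfl : k = 1 := by omega
          rfl
    · intro i a s; rfl
  have hKt : ∀ i x, Item.tail i (.inl x) ∈ K → x ≠ m ∧ x ≠ b := by
    intro i x hx
    have := (hT3 x).1 (List.mem_filterMap.2 ⟨_, hx, rfl⟩) 0
    simpa using this
  have e1 : fillWord (K.flatMap E) ![top.map .tail, [.head 0 s, .tail 2], [.head 1 s, .head 2 u]]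
      = (K.flatMap (Item.plug f)).flatMap (Item.letters ts) := by
    refine fillWord_flatMap K fun x hx => ?_
    rcases x with ⟨i, x | k⟩ | ⟨i, a, s⟩
    · obtain ⟨h1, h2⟩ := hKt i x hx
      simp only [E, fillWord_append, fillWord_tails, Item.plug, List.flatMap_cons, List.flatMap_nil,
        Item.letters, List.append_nil, hts, List.map_append]
      by_cases hb : x = c <;> simp [hb, h2, hcb, fillWord, tagBind]
    · by_cases hk : k = 0
      · subst hk
        simp only [E, if_true, fillWord_append, fillWord_tails]
        simp [f, Item.plug, Item.letters, hts, hmc, hmb, hbc, fillWord, tagBind]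
      · obtain rfl : k = 1 := by omega
        rfl
    · rfl
  have e2 : fillWord (K.flatMap E) ![top'.map .tail, [.tail 2, .head 0 s], [.head 2 u, .head 1 s]]
      = (K.flatMap (Item.plug f')).flatMap (Item.letters ts') := by
    refine fillWord_flatMap K fun x hx => ?_
    rcases x with ⟨i, x | k⟩ | ⟨i, a, s⟩
    · obtain ⟨h1, h2⟩ := hKt i x hx
      simp only [E, fillWord_append, fillWord_tails, Item.plug, List.flatMap_cons, List.flatMap_nil,
        Item.letters, List.append_nil, hts', List.map_append]
      by_cases hb : x = c <;> simp [hb, h1, hcm, fillWord, tagBind]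
    · by_cases hk : k = 0
      · subst hk
        simp only [E, if_true, fillWord_append, fillWord_tails]
        simp [f', Item.plug, Item.letters, hts', hmc, hbm, hbc, fillWord, tagBind]
      · obtain rfl : k = 1 := by omega
        rfl
    · rfl
  have hr := localMove_slide s u 0 1 2
  rw [← htop, ← htop'] at hr
  have hm := toLink_eq_of_move (move_fillWord _ hE hr (e1 ▸ hW) (e2 ▸ hW'))
  refine ⟨ofWord _ hW, ofWord _ hW', ⟨_, lab, ts, ?_, hh.nodup_iff.2 hH', hFF, rfl⟩,
    ⟨_, lab', ts', ?_, hh'.nodup_iff.2 hH', hFF', rfl⟩, .of_eq ?_⟩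
  · rw [map_plug, hlabK]
    congr 2; funext i k; fin_cases k <;> rfl
  · rw [map_plug, hlabK']
    congr 2; funext i k; fin_cases k <;> rfl
  · simpa only [e1, e2] using hm

end Rules

/-! ### Contexts with one hole -/

section Context

variable {n : ℕ} {β : Type}

/-- An item of a context that is not a hole. -/
def Item.lift {τ κ η : Type} : Item n τ η → Item n (τ ⊕ κ) η
  | tail i b => tail i (.inl b)
  | head i x s => head i x s

theorem plug_lift {κ : Type} (f : Fin n → κ → List (Item n β β)) (l : List (Item n β β)) :
    (l.map Item.lift).flatMap (Item.plug f) = l := by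
  induction l with
  | nil => rfl
  | cons x l ih => rw [List.map_cons, List.flatMap_cons, ih]; cases x <;> rfl

theorem holes_lift {κ : Type} (l : List (Item n β β)) :
    (tailsOf (l.map (Item.lift (κ := κ)))).filterMap Sum.getRight? = [] := by
  induction l with
  | nil => rfl
  | cons x l ih => cases x <;> exact ih

/-- The context with the hole on the strand `i` after `l₁` and before `l₂`. -/
def oneHole (l₁ l₂ : List (Item n β β)) (i : Fin n) : List (Item n (β ⊕ Unit) β) :=
  l₁.map Item.lift ++ [.tail i (.inr ())] ++ l₂.map Item.lift

theorem oneHole_holes (l₁ l₂ : List (Item n β β)) (i : Fin n) :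
    ListsAll ((tailsOf (oneHole l₁ l₂ i)).filterMap Sum.getRight?) := by
  rw [oneHole, tailsOf_append, tailsOf_append, List.filterMap_append, List.filterMap_append,
    holes_lift, holes_lift]
  exact ⟨List.nodup_singleton (), fun _ => List.mem_singleton_self ()⟩

theorem oneHole_plug (l₁ l₂ : List (Item n β β)) (i : Fin n)
    (f : Fin n → Unit → List (Item n β β)) :
    (oneHole l₁ l₂ i).flatMap (Item.plug f) = l₁ ++ f i () ++ l₂ := by
  rw [oneHole, List.flatMap_append, List.flatMap_append, plug_lift, plug_lift]
  simp [Item.plug]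

/-- Consecutive heads on the strand `i`. -/
def heads (i : Fin n) (w : List (β × ℤˣ)) : List (Item n β β) := w.map fun p => .head i p.1 p.2

theorem heads_append (i : Fin n) (v w : List (β × ℤˣ)) :
    heads i (v ++ w) = heads i v ++ heads i w := List.map_append

variable [Nonempty β]

/-- Second Reidemeister move. -/
theorem Eqv.cancel (l₁ l₂ : List (Item n β β)) (i : Fin n) (c : β) (s : ℤˣ) :
    Eqv (l₁ ++ l₂) (l₁ ++ heads i [(c, s), (c, -s)] ++ l₂) := by
  have h := Eqv.cancel_context _ (oneHole_holes l₁ l₂ i) c s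
  rw [oneHole_plug, oneHole_plug] at h
  simpa [heads] using h

theorem Eqv.cancel_word (i : Fin n) (w : List (β × ℤˣ)) : ∀ l₁ l₂ : List (Item n β β),
    Eqv (l₁ ++ heads i (w ++ WTree.inv w) ++ l₂) (l₁ ++ l₂) := by
  induction w with
  | nil => intro l₁ l₂; exact .of_eq (by simp [heads, WTree.inv])
  | cons p w ih =>
    intro l₁ l₂
    have h1 := ih (l₁ ++ heads i [p]) (heads i [(p.1, -p.2)] ++ l₂)
    have h2 := (Eqv.cancel l₁ l₂ i p.1 p.2).symm
    have e1 : l₁ ++ heads i (p :: w ++ WTree.inv (p :: w)) ++ l₂ = l₁ ++ heads i [p]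
        ++ heads i (w ++ WTree.inv w) ++ (heads i [(p.1, -p.2)] ++ l₂) := by
      simp [heads, WTree.inv]
    have e2 : l₁ ++ heads i [p] ++ (heads i [(p.1, -p.2)] ++ l₂)
        = l₁ ++ heads i [(p.1, p.2), (p.1, -p.2)] ++ l₂ := by
      simp [heads]
    rw [e1]
    rw [e2] at h1
    exact h1.trans h2

end Context

/-! ### Surgery along `w`-trees -/

section Surgery

variable {n k : ℕ} {β : Type}

/-- The places of the endpoints of a tree among the crossings: tails of the tree with marker `b`, which
are listed by `gs b`, are put next to the arrow tails with marker `b`, and the head into the hole. -/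
def placeItem (ts : β → List ℕ) (gs : β → List (Fin k)) :
    Item n (β ⊕ Unit) ℕ → List (Fin n × (Letter ⊕ Option (Fin k)))
  | .tail i (.inl b) => ((ts b).map fun a => (i, .inl (.tail a)))
      ++ (gs b).map fun j => (i, .inr (some j))
  | .tail i (.inr _) => [(i, .inr none)]
  | .head i a s => [(i, .inl (.head a s))]

theorem tagBind_flatMap {α α' γ : Type} (f : α → List α') (E : γ → List (Fin n × α)) (K : List γ) :
    tagBind f (K.flatMap E) = K.flatMap fun x => tagBind f (E x) := by
  simp [tagBind, List.flatMap_assoc]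

/-- The result of surgery: the heads of the expansion of the tree are put at the place of its head. As in
`WTreeFor.subst`, the crossing `a` of the diagram becomes `2 * a`, and the arrow of the letter in position
`m` of the word becomes `2 * m + 1`. -/
theorem Realizes.surgery {D : Diagram n} (T : WTreeFor D k) (K : List (Item n (β ⊕ Unit) ℕ))
    (hK : ListsAll ((tailsOf K).filterMap Sum.getRight?)) {lab : ℕ → β} {ts : β → List ℕ}
    {g : Fin k → β} {gs : β → List (Fin k)} (hgs : ∀ b, (gs b).Nodup ∧ ∀ j, j ∈ gs b ↔ g j = b)
    (hH : (headsOf K).Nodup)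
    (hts : ∀ b, (ts b).Nodup ∧ ∀ a, a ∈ ts b ↔ a ∈ headsOf K ∧ lab a = b)
    (hplace : T.place.strand = strandOf (K.flatMap (placeItem ts gs))) :
    Realizes ((K.map (Item.mapHead lab)).flatMap
      (Item.plug fun i _ => heads i (T.tree.word.map fun p => (g p.1, p.2)))) T.surgery := by
  set w := T.tree.word with hw
  set Z := w.zipIdx with hZ
  have hu : (tailsOf K).filterMap Sum.getRight? = [()] :=
    List.perm_singleton.1 ((List.perm_ext_iff_of_nodup hK.1 (List.nodup_singleton ())).2
      fun b => iff_of_true (hK.2 b) (by simp))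
  set f : Fin n → Unit → List (Item n β ℕ) := fun i _ => Z.map fun p => .head i (2 * p.2 + 1) p.1.2
  set lab' : ℕ → β := fun a => if a % 2 = 0 then lab (a / 2) else
    ((w[a / 2]?).map fun p => g p.1).getD (lab 0) with hlab'
  set ts' : β → List ℕ := fun b => ((ts b).map fun a => 2 * a)
    ++ (gs b).flatMap fun j => (Z.filter fun p => p.1.1 = j).map fun p => 2 * p.2 + 1 with hts'
  have htail : (tailsOf (K.map (Item.mapHead fun a => 2 * a))) = tailsOf K := tailsOf_mapHead _ _
  have hf : ∀ i u, headsOf (f i u) = Z.map fun p => 2 * p.2 + 1 := by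
    intro i u
    simp only [f]
    induction Z with
    | nil => rfl
    | cons p Z ih => rw [List.map_cons, List.map_cons, ← ih]; rfl
  have hh : (headsOf ((K.map (Item.mapHead fun a => 2 * a)).flatMap (Item.plug f))).Perm
      ((Z.map fun p => 2 * p.2 + 1) ++ (headsOf K).map fun a => 2 * a) := by
    have := headsOf_plug_perm (f := f) (T := fun _ => Z.map fun p => 2 * p.2 + 1) hf
      (K.map (Item.mapHead fun a => 2 * a))
    rw [htail, hu, headsOf_mapHead] at this
    simpa using this
  have hZn : (Z.map fun p => 2 * p.2 + 1).Nodup := by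
    have : (Z.map fun p => 2 * p.2 + 1) = (Z.map Prod.snd).map fun j => 2 * j + 1 := by
      rw [List.map_map]; rfl
    rw [this, hZ, List.zipIdx_map_snd]
    exact (List.nodup_range').map fun a b hab => by simpa using hab
  have hmemZ : ∀ p m, (p, m) ∈ Z ↔ w[m]? = some p := fun p m => by
    rw [hZ, List.mem_zipIdx_iff_getElem?]
  refine ⟨(K.map (Item.mapHead fun a => 2 * a)).flatMap (Item.plug f), lab', ts', ?_, ?_, ?_, ?_⟩
  · rw [map_plug, List.map_map]
    have e1 : (Item.mapHead lab' ∘ Item.mapHead fun a => 2 * a : Item n (β ⊕ Unit) ℕ → _)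
        = Item.mapHead lab := by
      funext x; cases x <;> simp [Item.mapHead, hlab']
    have e2 : (fun i u => (f i u).map (Item.mapHead lab'))
        = fun i _ => heads i (w.map fun p => (g p.1, p.2)) := by
      funext i u
      have e3 : (heads i (w.map fun p => (g p.1, p.2)) : List (Item n β β))
          = (Z.map Prod.fst).map fun p => .head i (g p.1) p.2 := by
        rw [hZ, List.zipIdx_map_fst]; simp [heads]
      rw [e3]
      simp only [f, List.map_map]
      refine List.map_congr_left fun p hp => ?_
      have := (hmemZ p.1 p.2).1 hp
      have h1 : (2 * p.2 + 1) % 2 = 1 := by omega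
      have h2 : (2 * p.2 + 1) / 2 = p.2 := by omega
      simp [Item.mapHead, hlab', h1, h2, this]
    rw [e1, e2]
  · refine hh.nodup_iff.2 (List.Nodup.append hZn (hH.map fun a b hab => by simpa using hab) ?_)
    intro x hx hy
    obtain ⟨a, -, rfl⟩ := List.mem_map.1 hx
    obtain ⟨b, -, hb⟩ := List.mem_map.1 hy
    omega
  · intro b
    have hmem2 : ∀ a, a ∈ ((gs b).flatMap fun j => (Z.filter fun p => p.1.1 = j).map
        fun p => 2 * p.2 + 1) ↔ ∃ p m, (p, m) ∈ Z ∧ g p.1 = b ∧ a = 2 * m + 1 := by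
      intro a
      simp only [List.mem_flatMap, (hgs b).2, List.mem_map, List.mem_filter, decide_eq_true_eq]
      constructor
      · rintro ⟨j, hj, ⟨p, m⟩, ⟨hp, hpj⟩, rfl⟩
        exact ⟨p, m, hp, by rw [← hj, ← hpj], rfl⟩
      · rintro ⟨p, m, hp, hg, rfl⟩
        exact ⟨p.1, hg, (p, m), ⟨hp, rfl⟩, rfl⟩
    constructor
    · refine List.Nodup.append ((hts b).1.map fun a b hab => by simpa using hab) ?_ ?_
      · refine List.nodup_flatMap.2 ⟨fun j _ => ?_, (hgs b).1.imp fun {j j'} hj => ?_⟩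
        · exact hZn.sublist (List.filter_sublist.map _)
        · intro a h1 h2
          obtain ⟨⟨p, m⟩, hp, rfl⟩ := List.mem_map.1 h1
          obtain ⟨⟨p', m'⟩, hp', hm⟩ := List.mem_map.1 h2
          rw [List.mem_filter] at hp hp'
          obtain rfl : m' = m := by simpa using hm
          have := ((hmemZ _ _).1 hp.1).symm.trans ((hmemZ _ _).1 hp'.1)
          have h3 := hp.2
          have h4 := hp'.2
          simp only [decide_eq_true_eq] at h3 h4
          rw [Option.some.injEq] at this
          exact hj (by rw [← h3, ← h4, this])
      · intro x hx hy
        obtain ⟨a, -, rfl⟩ := List.mem_map.1 hx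
        obtain ⟨p, m, -, -, hb⟩ := (hmem2 _).1 hy
        omega
    · intro a
      rw [hh.mem_iff, hts', List.mem_append, List.mem_append, hmem2]
      rcases Nat.even_or_odd' a with ⟨m, rfl | rfl⟩
      · have h1 : ∀ m', 2 * m ≠ 2 * m' + 1 := fun m' => by omega
        have h3 : ∀ m', 2 * m' + 1 ≠ 2 * m := fun m' => by omega
        have h2 : lab' (2 * m) = lab m := by simp [hlab']
        simp [h1, h2, h3, (hts b).2]
      · have h1 : ∀ m', 2 * m' ≠ 2 * m + 1 := fun m' => by omega
        have h2 : lab' (2 * m + 1) = ((w[m]?).map fun p => g p.1).getD (lab 0) := by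
          have h1 : (2 * m + 1) % 2 = 1 := by omega
          have h2 : (2 * m + 1) / 2 = m := by omega
          simp only [hlab', h1, h2]; rfl
        simp only [List.mem_map, h1, and_false, exists_false, false_or, or_false, h2]
        constructor
        · rintro ⟨p, m', hp, hg, hm⟩
          obtain rfl : m' = m := by omega
          exact ⟨⟨_, hp, rfl⟩, by simp [(hmemZ _ _).1 hp, hg]⟩
        · rintro ⟨⟨⟨p, m'⟩, hp, hm⟩, hg⟩
          obtain rfl : m' = m := by omega
          exact ⟨p, m', hp, by simpa [(hmemZ _ _).1 hp] using hg, rfl⟩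
  · funext i
    change (T.place.strand i).flatMap T.subst = _
    rw [hplace, ← strandOf_tagBind, tagBind_flatMap, List.flatMap_assoc, List.flatMap_map]
    congr 2
    funext x
    rcases x with ⟨i, b | u⟩ | ⟨i, a, s⟩
    · simp [tagBind, placeItem, Item.mapHead, Item.plug, Item.letters, WTreeFor.subst, hts',
        List.flatMap_map, List.map_flatMap, List.flatMap_append, Letter.relabel, hZ, hw, Function.comp_def]
      rw [List.map_eq_flatMap]
    · simp [tagBind, placeItem, Item.mapHead, Item.plug, Item.letters, WTreeFor.subst, f,
        List.flatMap_map, hZ, hw]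
      rw [List.map_eq_flatMap]; rfl
    · simp [tagBind, placeItem, Item.mapHead, Item.plug, Item.letters, WTreeFor.subst,
        Letter.relabel]

theorem listsAll_placeTails {T : List (β ⊕ Unit)}
    (hT : ListsAll (T.flatMap (Sum.elim (fun b => [b]) fun _ => [])))
    (hK : ListsAll (T.filterMap Sum.getRight?)) {g : Fin k → β} {gs : β → List (Fin k)}
    (hgs : ∀ b, (gs b).Nodup ∧ ∀ j, j ∈ gs b ↔ g j = b) :
    ListsAll (T.flatMap (Sum.elim (fun b => (gs b).map some) fun _ => [none])) := by
  obtain ⟨hT1, hT2, hT3⟩ := context_tails hT hK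
  refine listsAll_flatMap hT1 _ ?_ ?_ ?_
  · rintro (b | u)
    · exact (hgs b).1.map (Option.some_injective _)
    · exact List.nodup_singleton _
  · rintro (b | u) (b' | u') d h1 h2
    · obtain ⟨j, hj, rfl⟩ := List.mem_map.1 h1
      obtain ⟨j', hj', h⟩ := List.mem_map.1 h2
      obtain rfl := Option.some_injective _ h
      rw [← ((hgs b).2 _).1 hj, ← ((hgs b').2 _).1 hj']
    · simp_all
    · simp_all
    · rfl
  · rintro (_ | j)
    · exact ⟨_, hT2 (), List.mem_singleton_self _⟩
    · exact ⟨.inl (g j), (hT3 _).2 (by simp),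
        List.mem_map_of_mem (((hgs (g j)).2 j).2 rfl)⟩

/-- A tree with endpoints at prescribed markers, for a diagram described by a list of items. -/
theorem exists_wTreeFor [Nonempty β] (K : List (Item n (β ⊕ Unit) β))
    (hK : ListsAll ((tailsOf K).filterMap Sum.getRight?))
    (hP : ListsAll (tailsOf (K.flatMap (Item.plug fun _ _ => []))))
    (t : WTree (Fin k)) (ht : ListsAll t.leaves) (g : Fin k → β) :
    ∃ (D : Diagram n) (T : WTreeFor D k), Realizes (K.flatMap (Item.plug fun _ _ => [])) D ∧
      Realizes (K.flatMap (Item.plug fun i _ => heads i (t.word.map fun p => (g p.1, p.2))))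
        T.surgery := by
  classical
  obtain ⟨K, lab, rfl, hH, -⟩ := exists_labelling K 0
  rw [tailsOf_mapHead] at hK
  have hT := hP
  rw [tailsOf_plug (T := fun _ => []) (fun _ _ => rfl), tailsOf_mapHead] at hT
  obtain ⟨ts, hts⟩ := exists_fibres (headsOf K) hH lab
  set gs : β → List (Fin k) := fun b => (List.finRange k).filter fun j => g j = b
  have hgs : ∀ b, (gs b).Nodup ∧ ∀ j, j ∈ gs b ↔ g j = b :=
    fun b => ⟨(List.nodup_finRange k).filter _, fun j => by simp [gs]⟩
  set f : Fin n → Unit → List (Item n β ℕ) := fun i _ => []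
  have hu : (tailsOf K).filterMap Sum.getRight? = [()] :=
    List.perm_singleton.1 ((List.perm_ext_iff_of_nodup hK.1 (List.nodup_singleton ())).2
      fun b => iff_of_true (hK.2 b) (by simp))
  have hh : (headsOf (K.flatMap (Item.plug f))).Perm (headsOf K) := by
    have := headsOf_plug_perm (f := f) (T := fun _ => []) (fun _ _ => rfl) K
    rwa [hu] at this
  have hts' : ∀ b, (ts b).Nodup ∧ ∀ a, a ∈ ts b ↔
      a ∈ headsOf (K.flatMap (Item.plug f)) ∧ lab a = b :=
    fun b => ⟨(hts b).1, fun a => by rw [(hts b).2, hh.mem_iff]⟩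
  have hL : ListsAll (tailsOf (K.flatMap (Item.plug f))) := by
    rw [tailsOf_plug (T := fun _ => []) (fun _ _ => rfl)]; exact hT
  have hW := wordValid_letters hL (hh.nodup_iff.2 hH) hts'
  have hplace : ListsAll ((K.flatMap (placeItem ts gs)).filterMap fun p => p.2.getRight?) := by
    rw [filterMap_flatMap_tails (placeItem ts gs)
      (Sum.elim (fun b => (gs b).map some) fun _ => [none])]
    · exact listsAll_placeTails hT hK hgs
    · rintro i (b | u)
      · rw [placeItem, List.filterMap_append, filterMap_getRight_tails]
        simp [List.filterMap_map, Function.comp_def]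
      · rfl
    · intro i a s; rfl
  have hp : ((concat (strandOf (K.flatMap (placeItem ts gs)))).filterMap Sum.getRight?).Perm
      ((K.flatMap (placeItem ts gs)).filterMap fun p => p.2.getRight?) := by
    have := (concat_strandOf_perm (K.flatMap (placeItem ts gs))).filterMap Sum.getRight?
    rwa [List.filterMap_map] at this
  let T : WTreeFor (ofWord _ hW) k :=
    { tree := t
      leaves_once := ht
      place := ⟨strandOf (K.flatMap (placeItem ts gs)), (listsAll_of_perm hp).2 hplace⟩
      base := by
        intro i
        change (strandOf (K.flatMap (placeItem ts gs)) i).filterMap Sum.getLeft? = strandOf _ i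
        rw [List.filterMap_eq_flatMap_toList, ← strandOf_tagBind, tagBind_flatMap,
          List.flatMap_assoc]
        congr 2
        funext x
        rcases x with ⟨i, b | u⟩ | ⟨i, a, s⟩
        · simp [tagBind, placeItem, Item.plug, Item.letters, List.flatMap_map]
          rw [List.map_eq_flatMap]; simp
        · rfl
        · rfl }
  refine ⟨ofWord _ hW, T, ⟨_, lab, ts, ?_, hh.nodup_iff.2 hH, hts', rfl⟩, ?_⟩
  · rw [map_plug]; rfl
  · exact Realizes.surgery T K hK hgs hH hts rfl

end Surgery

section Insert

variable {n k : ℕ} {β : Type}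

theorem tailsOf_heads (i : Fin n) (w : List (β × ℤˣ)) : tailsOf (heads i w) = [] := by
  induction w with
  | nil => rfl
  | cons p w ih => exact ih

theorem word_map_bead (t : WTree (Fin k)) (g : Fin k → β) :
    (WTree.bead t).word.map (fun p => (g p.1, p.2))
      = WTree.inv (t.word.map fun p => (g p.1, p.2)) := by
  simp [WTree.word, WTree.inv, Function.comp_def]

variable [Nonempty β]

theorem exists_insert_tree (l₁ l₂ : List (Item n β β)) (i : Fin n) (hP : ListsAll (tailsOf (l₁ ++ l₂)))
    (t : WTree (Fin k)) (ht : ListsAll t.leaves) (hk : 4 ≤ k) (g : Fin k → β) :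
    ∃ D D' : Diagram n, Realizes (l₁ ++ l₂) D ∧
      Realizes (l₁ ++ heads i (t.word.map fun p => (g p.1, p.2)) ++ l₂) D' ∧
      WkEquiv 4 D.toLink D'.toLink := by
  have h := exists_wTreeFor (oneHole l₁ l₂ i) (oneHole_holes l₁ l₂ i)
    (by rw [oneHole_plug]; simpa using hP) t ht g
  rw [oneHole_plug, oneHole_plug] at h
  obtain ⟨D, T, h1, h2⟩ := h
  exact ⟨D, T.surgery, by simpa using h1, h2, .single ⟨D, k, T, hk, rfl, rfl⟩⟩

/-- The heads of the expansion of a tree of degree at least `4` may be inserted anywhere. Deleting them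
amounts to inserting those of the tree with a bead and cancelling. -/
theorem Eqv.insert_tree (l₁ l₂ : List (Item n β β)) (i : Fin n) (t : WTree (Fin k))
    (ht : ListsAll t.leaves) (hk : 4 ≤ k) (g : Fin k → β) :
    Eqv (l₁ ++ l₂) (l₁ ++ heads i (t.word.map fun p => (g p.1, p.2)) ++ l₂) := by
  set w := t.word.map fun p => (g p.1, p.2) with hw
  have htl : tailsOf (l₁ ++ heads i w ++ l₂) = tailsOf (l₁ ++ l₂) := by
    rw [tailsOf_append, tailsOf_append, tailsOf_heads, tailsOf_append, List.append_nil]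
  refine ⟨by rw [htl], fun hP hP' => ?_⟩
  obtain ⟨D, D', h1, h2, h3⟩ := exists_insert_tree l₁ l₂ i hP t ht hk g
  obtain ⟨E, E', h4, h5, h6⟩ := exists_insert_tree (l₁ ++ heads i w) l₂ i hP' (.bead t) ht hk g
  have hc := Eqv.cancel_word i w l₁ l₂
  have e : l₁ ++ heads i w ++ heads i ((WTree.bead t).word.map fun p => (g p.1, p.2)) ++ l₂
      = l₁ ++ heads i (w ++ WTree.inv w) ++ l₂ := by
    rw [word_map_bead, heads_append]; simp [hw]
  rw [e] at h5
  obtain ⟨G, G', h7, h8, h9⟩ := hc.2 (hc.1.2 hP) hP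
  refine ⟨D, D', h1, h2, h3, ?_⟩
  rw [h2.toLink_eq h4, h1.toLink_eq h8]
  rw [h5.toLink_eq h7] at h6
  exact h6.trans h9.1

end Insert

section Constructions

variable {n k : ℕ} {β γ : Type}

/-- The list of items that a tree for the trivial diagram stands for; `A₁` and `A₂` are the places of the
tails that are listed before and after the head. -/
def treeItems (A₁ : List (Fin n × Fin k)) (i : Fin n) (t : WTree (Fin k))
    (A₂ : List (Fin n × Fin k)) : List (Item n (Fin k) (Fin k)) :=
  A₁.map (fun p => .tail p.1 p.2) ++ heads i t.word ++ A₂.map (fun p => .tail p.1 p.2)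

theorem realizes_trivial [Nonempty (Fin k)] (T : WTreeFor (Diagram.trivial n) k)
    (A₁ A₂ : List (Fin n × Fin k)) (i : Fin n)
    (h : T.place.strand = fun j => (strandOf (A₁.map (Prod.map id some) ++ [(i, none)]
      ++ A₂.map (Prod.map id some)) j).map Sum.inr) :
    Realizes (treeItems A₁ i T.tree A₂) T.surgery := by
  set tl : List (Fin n × Fin k) → List (Item n (Fin k ⊕ Unit) ℕ) :=
    fun A => A.map fun p => .tail p.1 (.inl p.2) with htl
  have h1 : ∀ A, (tailsOf (tl A)).filterMap Sum.getRight? = [] := by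
    intro A
    induction A with
    | nil => rfl
    | cons p A ih => exact ih
  have h2 : ∀ A, headsOf (tl A) = [] := by
    intro A
    induction A with
    | nil => rfl
    | cons p A ih => exact ih
  have h3 : ∀ A, (tl A).flatMap (placeItem (fun _ => []) fun b => [b])
      = A.map fun p => (p.1, .inr (some p.2)) := by
    intro A
    induction A with
    | nil => rfl
    | cons p A ih => exact congrArg _ ih
  set K : List (Item n (Fin k ⊕ Unit) ℕ) := tl A₁ ++ [.tail i (.inr ())] ++ tl A₂ with hK
  have hKh : headsOf K = [] := by rw [hK, headsOf_append, headsOf_append, h2, h2]; rfl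
  have := Realizes.surgery T K (lab := fun _ => Classical.arbitrary _) (ts := fun _ => []) (g := id)
    (gs := fun b => [b]) ?_ ?_ ?_ ?_ ?_
  · convert this using 1
    rw [hK, List.map_append, List.map_append, List.flatMap_append, List.flatMap_append, treeItems]
    have h4 : ∀ (A : List (Fin n × Fin k)) (m : ℕ → Fin k) (f : Fin n → Unit → _),
        ((tl A).map (Item.mapHead m)).flatMap (Item.plug f) = A.map fun p => .tail p.1 p.2 := by
      intro A m f
      induction A with
      | nil => rfl
      | cons p A ih => exact congrArg _ ih
    rw [h4, h4]
    simp [Item.mapHead, Item.plug]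
  · rw [hK, tailsOf_append, tailsOf_append, List.filterMap_append, List.filterMap_append, h1, h1]
    exact ⟨List.nodup_singleton (), fun _ => List.mem_singleton_self ()⟩
  · intro b; simp
  · rw [hKh]; exact List.nodup_nil
  · intro b; rw [hKh]; simp
  · rw [h, hK, List.flatMap_append, List.flatMap_append, h3, h3]
    funext j
    rw [← strandOf_map]
    simp [placeItem, Function.comp_def]
    rfl

/-- Rename the markers. -/
def Item.bimap {τ τ' η η' : Type} (f : τ → τ') (g : η → η') : Item n τ η → Item n τ' η'
  | tail i b => tail i (f b)
  | head i x s => head i (g x) s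

theorem headsOf_bimap {τ τ' η η' : Type} (f : τ → τ') (g : η → η') (P : List (Item n τ η)) :
    headsOf (P.map (Item.bimap f g)) = (headsOf P).map g := by
  simp only [headsOf, List.filterMap_map, List.map_filterMap]
  congr 1; funext x; cases x <;> rfl

theorem letters_bimap (f : β → γ) (φ : ℕ → ℕ) (ts : β → List ℕ) (ts' : γ → List ℕ)
    (h : ∀ b, ts' (f b) = (ts b).map φ) (L : List (Item n β ℕ)) :
    (L.map (Item.bimap f φ)).flatMap (Item.letters ts')
      = (L.flatMap (Item.letters ts)).map (Prod.map id (Letter.relabel φ)) := by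
  induction L with
  | nil => rfl
  | cons x L ih =>
    rw [List.map_cons, List.flatMap_cons, List.flatMap_cons, List.map_append, ih]
    cases x <;> simp [Item.bimap, Item.letters, Letter.relabel, h]

/-- The markers and labels of the factors are made disjoint by `Sum.inl` and `Sum.inr`, and by doubling the
labels as in `Diagram.mul`. -/
theorem Realizes.mul {P : List (Item n β β)} {Q : List (Item n γ γ)} {D E : Diagram n}
    (hD : Realizes P D) (hE : Realizes Q E) :
    Realizes (P.map (Item.bimap Sum.inl Sum.inl) ++ Q.map (Item.bimap Sum.inr Sum.inr))
      (D.mul E) := by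
  obtain ⟨L, lab, ts, rfl, h2, h3, h4⟩ := hD
  obtain ⟨M, lab', ts', rfl, h2', h3', h4'⟩ := hE
  have hh : headsOf (L.map (Item.bimap Sum.inl fun a => 2 * a)
      ++ M.map (Item.bimap Sum.inr fun a => 2 * a + 1) : List (Item n (β ⊕ γ) ℕ))
      = (headsOf L).map (fun a => 2 * a) ++ (headsOf M).map fun a => 2 * a + 1 := by
    rw [headsOf_append, headsOf_bimap, headsOf_bimap]
  refine ⟨L.map (Item.bimap Sum.inl fun a => 2 * a) ++ M.map (Item.bimap Sum.inr fun a => 2 * a + 1),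
    fun a => if a % 2 = 0 then .inl (lab (a / 2)) else .inr (lab' (a / 2)),
    Sum.elim (fun b => (ts b).map fun a => 2 * a) (fun b => (ts' b).map fun a => 2 * a + 1),
    ?_, ?_, ?_, ?_⟩
  · rw [List.map_append, List.map_map, List.map_map, List.map_map, List.map_map]
    congr 1 <;> refine List.map_congr_left fun x _ => ?_ <;>
      cases x <;> simp [Item.bimap, Item.mapHead, Nat.add_mod] <;> congr 1 <;> omega
  · rw [hh]
    refine List.Nodup.append (h2.map fun a b hab => by simpa using hab)
      (h2'.map fun a b hab => by simpa using hab) ?_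
    intro x hx hy
    obtain ⟨a, -, rfl⟩ := List.mem_map.1 hx
    obtain ⟨b, -, hb⟩ := List.mem_map.1 hy
    omega
  · have h0 : ∀ m m', 2 * m ≠ 2 * m' + 1 := fun m m' => by omega
    have h1 : ∀ m m', 2 * m' + 1 ≠ 2 * m := fun m m' => by omega
    have h5 : ∀ m, (2 * m + 1) / 2 = m := fun m => by omega
    have h6 : ∀ m, (2 * m + 1) % 2 = 1 := fun m => by omega
    rintro (b | b)
    · refine ⟨(h3 b).1.map fun a b hab => by simpa using hab, fun a => ?_⟩
      rw [hh, List.mem_append]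
      rcases Nat.even_or_odd' a with ⟨m, rfl | rfl⟩
      · simp [h1, (h3 b).2]
      · simp [h0, h5, h6]
    · refine ⟨(h3' b).1.map fun a b hab => by simpa using hab, fun a => ?_⟩
      rw [hh, List.mem_append]
      rcases Nat.even_or_odd' a with ⟨m, rfl | rfl⟩
      · simp [h1]
      · simp [h0, h5, h6, (h3' b).2]
  · funext i
    rw [List.flatMap_append, letters_bimap Sum.inl (fun a => 2 * a) ts _ (fun _ => rfl),
      letters_bimap Sum.inr (fun a => 2 * a + 1) ts' _ (fun _ => rfl), strandOf_append, strandOf_map,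
      strandOf_map, ← h4, ← h4']
    rfl

end Constructions

open scoped commutatorElement

/-! ### Commutators of weight four -/

section LowerCentralSeries

variable {G : Type*} [Group G]

/-- If a normal subgroup contains the left-normed commutators of weight four in generators and their
inverses, then it contains the fourth term of the lower central series: successively, the commutators of
weight three, those of weight two and the generators lie in the terms of the upper central series of the
quotient. -/
theorem lowerCentralSeries_three_le (S : Set G) (hS : Subgroup.closure S = ⊤) (N : Subgroup G)
    [N.Normal] (h : ∀ a ∈ S, ∀ b ∈ S, ∀ c ∈ S, ∀ d ∈ S, ⁅⁅⁅a, b⁻¹⁆, c⁻¹⁆, d⁻¹⁆ ∈ N) :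
    (⊤ : Subgroup G).lowerCentralSeries 3 ≤ N := by
  have step : ∀ (H : Subgroup G) [H.Normal] (g : G), (∀ s ∈ S, ⁅g, s⁻¹⁆ ∈ H) → ∀ y, ⁅g, y⁆ ∈ H := by
    intro H _ g hg y
    have hy : y ∈ Subgroup.closure S := hS ▸ Subgroup.mem_top y
    have key : ∀ y, ⁅g, y⁆ ∈ H ↔ Commute (g : G ⧸ H) (y : G ⧸ H) := by
      intro y
      rw [← commutatorElement_eq_one_iff_commute, ← QuotientGroup.eq_one_iff]
      rfl
    rw [key]
    refine Subgroup.closure_induction (k := S)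
      (p := fun (y : G) _ => Commute (QuotientGroup.mk g : G ⧸ H) (QuotientGroup.mk y)) ?_ ?_ ?_ ?_ hy
    · intro s hs
      have := (key _).1 (hg s hs)
      rw [QuotientGroup.mk_inv] at this
      exact Commute.inv_right_iff.1 this
    · exact Commute.one_right _
    · intro x y _ _ hx hy; exact hx.mul_right hy
    · intro x _ hx; exact hx.inv_right
  have ex : ∀ (H : Subgroup G), H.Normal → ∃ Z : Subgroup G, Z.Normal ∧
      ∀ g, g ∈ Z ↔ ∀ y, ⁅g, y⁆ ∈ H := by
    intro H hH
    refine ⟨(Subgroup.center (G ⧸ H)).comap (QuotientGroup.mk' H), inferInstance, fun g => ?_⟩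
    rw [Subgroup.mem_comap, Subgroup.mem_center_iff]
    constructor
    · intro hg y
      rw [← QuotientGroup.eq_one_iff]
      exact commutatorElement_eq_one_iff_commute.2 (hg (y : G ⧸ H)).symm
    · intro hg y
      obtain ⟨y, rfl⟩ := QuotientGroup.mk_surjective y
      have := hg y
      rw [← QuotientGroup.eq_one_iff] at this
      exact (commutatorElement_eq_one_iff_commute.1 this).symm
  obtain ⟨Z₁, n₁, h₁⟩ := ex N inferInstance
  obtain ⟨Z₂, n₂, h₂⟩ := ex Z₁ n₁
  obtain ⟨Z₃, n₃, h₃⟩ := ex Z₂ n₂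
  have k₁ : ∀ a ∈ S, ∀ b ∈ S, ∀ c ∈ S, ⁅⁅a, b⁻¹⁆, c⁻¹⁆ ∈ Z₁ := fun a ha b hb c hc =>
    (h₁ _).2 (step N _ (h a ha b hb c hc))
  have k₂ : ∀ a ∈ S, ∀ b ∈ S, ⁅a, b⁻¹⁆ ∈ Z₂ := fun a ha b hb => (h₂ _).2 (step Z₁ _ (k₁ a ha b hb))
  have k₃ : ∀ a, a ∈ Z₃ := by
    have : Subgroup.closure S ≤ Z₃ :=
      (Subgroup.closure_le _).2 fun a ha => (h₃ _).2 (step Z₂ _ (k₂ a ha))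
    intro a
    exact this (hS ▸ Subgroup.mem_top a)
  have l₁ : (⊤ : Subgroup G).lowerCentralSeries 1 ≤ Z₂ :=
    Subgroup.commutator_le.2 fun a _ b _ => (h₃ a).1 (k₃ a) b
  have l₂ : (⊤ : Subgroup G).lowerCentralSeries 2 ≤ Z₁ :=
    Subgroup.commutator_le.2 fun a ha b _ => (h₂ a).1 (l₁ ha) b
  exact Subgroup.commutator_le.2 fun a ha b _ => (h₁ a).1 (l₂ ha) b

end LowerCentralSeries

/-! ### Blocks of heads with values in a free group -/

/-- The terms of the lower central series of the free group on the markers, beginning with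
`lcs β 0 = ⊤`. -/
abbrev lcs (β : Type) (k : ℕ) : Subgroup (FreeGroup β) := (⊤ : Subgroup (FreeGroup β)).lowerCentralSeries k

section Words

variable {n : ℕ} {β : Type}

/-- The sign of an exponent, where `true` stands for the exponent `1`. -/
def sgn (u : Bool) : ℤˣ := if u then 1 else -1

theorem sgn_not (u : Bool) : sgn (!u) = -sgn u := by cases u <;> rfl

/-- The heads on the strand `i` described by a word in the free group on the markers. -/
def wordHeads (i : Fin n) (w : List (β × Bool)) : List (Item n β β) :=
  heads i (w.map fun p => (p.1, sgn p.2))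

theorem wordHeads_append (i : Fin n) (v w : List (β × Bool)) :
    wordHeads i (v ++ w) = wordHeads i v ++ wordHeads i w := by
  simp [wordHeads, heads_append]

/-- The element of the free group that is described by letters with signs. -/
def groupWord (w : List (β × ℤˣ)) : FreeGroup β := FreeGroup.mk (w.map fun p => (p.1, decide (p.2 = 1)))

theorem sgn_decide (s : ℤˣ) : sgn (decide (s = 1)) = s := by
  rcases Int.units_eq_one_or s with rfl | rfl <;> rfl

theorem heads_eq_wordHeads (i : Fin n) (w : List (β × ℤˣ)) :
    heads i w = wordHeads i (w.map fun p => (p.1, decide (p.2 = 1))) := by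
  simp [wordHeads, sgn_decide, Function.comp_def]

theorem groupWord_append (v w : List (β × ℤˣ)) : groupWord (v ++ w) = groupWord v * groupWord w := by
  simp [groupWord]

theorem groupWord_inv (w : List (β × ℤˣ)) : groupWord (WTree.inv w) = (groupWord w)⁻¹ := by
  rw [groupWord, groupWord, FreeGroup.inv_mk, FreeGroup.invRev, WTree.inv, List.map_reverse]
  simp only [List.map_map]
  congr 3
  funext p
  rcases Int.units_eq_one_or p.2 with h | h <;> simp [h]

/-- The element of the free group that a tree expands to. -/
def treeValue : WTree β → FreeGroup β
  | .leaf b => FreeGroup.of b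
  | .node l r => ⁅treeValue l, (treeValue r)⁻¹⁆
  | .bead t => (treeValue t)⁻¹

theorem groupWord_word (t : WTree β) : groupWord t.word = treeValue t := by
  induction t with
  | leaf b => rfl
  | node l r ihl ihr =>
    simp [WTree.word, groupWord_append, groupWord_inv, ihl, ihr, treeValue, commutatorElement_def,
      mul_assoc]
  | bead t ih => rw [WTree.word, groupWord_inv, ih, treeValue]

variable [Nonempty β]

theorem Eqv.red (i : Fin n) (l₁ l₂ : List (Item n β β)) {v w : List (β × Bool)}
    (h : FreeGroup.mk v = FreeGroup.mk w) :
    Eqv (l₁ ++ wordHeads i v ++ l₂) (l₁ ++ wordHeads i w ++ l₂) := by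
  have hs : ∀ v w : List (β × Bool), FreeGroup.Red.Step v w →
      Eqv (l₁ ++ wordHeads i v ++ l₂) (l₁ ++ wordHeads i w ++ l₂) := by
    rintro _ _ (@⟨v, w, x, u⟩)
    have := (Eqv.cancel (l₁ ++ wordHeads i v) (wordHeads i w ++ l₂) i x (sgn u)).symm
    have e : v ++ (x, u) :: (x, !u) :: w = v ++ ([(x, u), (x, !u)] ++ w) := by simp
    rw [e]
    simp only [wordHeads_append]
    simpa [wordHeads, heads, sgn_not] using this
  have hr : ∀ v w : List (β × Bool), FreeGroup.Red v w →
      Eqv (l₁ ++ wordHeads i v ++ l₂) (l₁ ++ wordHeads i w ++ l₂) := by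
    intro v w h
    induction h with
    | refl => exact .refl _
    | tail _ h ih => exact ih.trans (hs _ _ h)
  obtain ⟨u, hv, hw⟩ := FreeGroup.Red.exact.1 h
  exact (hr _ _ hv).trans (hr _ _ hw).symm

variable [DecidableEq β]

/-- The elements whose words may be inserted anywhere. -/
def neutral (n : ℕ) (β : Type) [Nonempty β] [DecidableEq β] : Subgroup (FreeGroup β) where
  carrier := {g | ∀ (i : Fin n) (l₁ l₂ : List (Item n β β)),
    Eqv (l₁ ++ wordHeads i g.toWord ++ l₂) (l₁ ++ l₂)}
  one_mem' := fun i l₁ l₂ => .of_eq (by simp [wordHeads, heads])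
  mul_mem' := by
    intro g h hg hh i l₁ l₂
    have h1 := Eqv.red i l₁ l₂ (v := (g * h).toWord) (w := g.toWord ++ h.toWord)
      (by rw [← FreeGroup.mul_mk, FreeGroup.mk_toWord, FreeGroup.mk_toWord, FreeGroup.mk_toWord])
    have h2 := hg i l₁ (wordHeads i h.toWord ++ l₂)
    have h3 := hh i l₁ l₂
    rw [wordHeads_append] at h1
    simp only [List.append_assoc] at h1 h2 h3 ⊢
    exact h1.trans (h2.trans h3)
  inv_mem' := by
    intro g hg i l₁ l₂
    have h1 := hg i l₁ (wordHeads i g⁻¹.toWord ++ l₂)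
    have h2 := Eqv.red i l₁ l₂ (v := g.toWord ++ g⁻¹.toWord) (w := [])
      (by rw [← FreeGroup.mul_mk, FreeGroup.mk_toWord, FreeGroup.mk_toWord, mul_inv_cancel]; rfl)
    rw [wordHeads_append] at h2
    simp only [List.append_assoc] at h1 h2 ⊢
    exact h1.symm.trans (h2.trans (.of_eq (by simp [wordHeads, heads])))

instance : (neutral n β).Normal where
  conj_mem := by
    intro g hg h i l₁ l₂
    have h1 := Eqv.red i l₁ l₂ (v := (h * g * h⁻¹).toWord)
      (w := h.toWord ++ g.toWord ++ h⁻¹.toWord)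
      (by simp only [← FreeGroup.mul_mk, FreeGroup.mk_toWord])
    have h2 := hg i (l₁ ++ wordHeads i h.toWord) (wordHeads i h⁻¹.toWord ++ l₂)
    have h3 := Eqv.red i l₁ l₂ (v := h.toWord ++ h⁻¹.toWord) (w := [])
      (by rw [← FreeGroup.mul_mk, FreeGroup.mk_toWord, FreeGroup.mk_toWord, mul_inv_cancel]; rfl)
    simp only [wordHeads_append, List.append_assoc] at h1 h2 h3 ⊢
    exact h1.trans (h2.trans (h3.trans (.of_eq (by simp [wordHeads, heads]))))

open WTree in
theorem commutator_mem_neutral (a b c d : β) :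
    ⁅⁅⁅FreeGroup.of a, (FreeGroup.of b)⁻¹⁆, (FreeGroup.of c)⁻¹⁆, (FreeGroup.of d)⁻¹⁆ ∈ neutral n β := by
  intro i l₁ l₂
  let t : WTree (Fin 4) := node (node (node (leaf 0) (leaf 1)) (leaf 2)) (leaf 3)
  let t' : WTree β := node (node (node (leaf a) (leaf b)) (leaf c)) (leaf d)
  have h1 := Eqv.insert_tree l₁ l₂ i t (by decide) le_rfl ![a, b, c, d]
  have e : (t.word.map fun p => ((![a, b, c, d] : Fin 4 → β) p.1, p.2)) = t'.word := by rfl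
  rw [e, heads_eq_wordHeads] at h1
  refine (h1.trans (Eqv.red i l₁ l₂ ?_)).symm
  rw [FreeGroup.mk_toWord]
  exact groupWord_word t'

theorem lcs_three_le_neutral : lcs β 3 ≤ neutral n β := by
  refine lowerCentralSeries_three_le (Set.range FreeGroup.of) (FreeGroup.closure_range_of β) _ ?_
  rintro _ ⟨a, rfl⟩ _ ⟨b, rfl⟩ _ ⟨c, rfl⟩ _ ⟨d, rfl⟩
  exact commutator_mem_neutral a b c d

/-- Words with the same value modulo commutators of weight four are interchangeable. -/
theorem Eqv.congr_lcs (i : Fin n) (l₁ l₂ : List (Item n β β)) {v w : List (β × Bool)}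
    (h : (FreeGroup.mk v)⁻¹ * FreeGroup.mk w ∈ lcs β 3) :
    Eqv (l₁ ++ wordHeads i v ++ l₂) (l₁ ++ wordHeads i w ++ l₂) := by
  set g := (FreeGroup.mk v)⁻¹ * FreeGroup.mk w with hg
  have h1 := lcs_three_le_neutral h i (l₁ ++ wordHeads i v) l₂
  have h2 := Eqv.red i l₁ l₂ (v := w) (w := v ++ g.toWord)
    (by rw [← FreeGroup.mul_mk, FreeGroup.mk_toWord, hg]; group)
  refine (h2.trans ?_).symm
  rw [wordHeads_append]
  simpa only [List.append_assoc] using h1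

end Words

/-! ### Sliding a tail place over heads -/

theorem Eqv.of_valid {n : ℕ} {β β' : Type} {P : List (Item n β β)} {P' : List (Item n β' β')}
    (ht : ListsAll (tailsOf P) ↔ ListsAll (tailsOf P')) (h : ListsAll (tailsOf P) → Eqv P P') :
    Eqv P P' :=
  ⟨ht, fun h1 h2 => (h h1).2 h1 h2⟩

theorem tailsOf_expand {n : ℕ} {τ τ' η : Type} (pre : τ' → List τ) (Q : List (Item n τ' η)) :
    tailsOf (Q.flatMap (Item.expand pre)) = (tailsOf Q).flatMap pre := by
  induction Q with
  | nil => rfl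
  | cons x Q ih =>
    rw [List.flatMap_cons, tailsOf_append, ih]
    cases x with
    | tail i b =>
      have : ∀ l : List τ, tailsOf (l.map (Item.tail (η := η) i)) = l := by
        intro l
        induction l with
        | nil => rfl
        | cons y l ih => exact congrArg (y :: ·) ih
      simp only [Item.expand, this]
      rfl
    | head i x s => rfl

theorem tailsOf_bimap {n : ℕ} {τ τ' η η' : Type} (f : τ → τ') (g : η → η') (Q : List (Item n τ η)) :
    tailsOf (Q.map (Item.bimap f g)) = (tailsOf Q).map f := by
  induction Q with
  | nil => rfl
  | cons x Q ih =>
    cases x with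
    | tail i b => exact congrArg (f b :: ·) ih
    | head i x s => exact ih

section Slide

variable {n : ℕ} {β : Type} [DecidableEq β]

/-- Replace the heads with marker `b` by conjugates of heads with marker `m`. -/
def Item.conj (c b m : β) (s : ℤˣ) : Item n β β → List (Item n β β)
  | tail i x => [tail i x]
  | head i x u => if x = b then [head i c (-s), head i m u, head i c s] else [head i x u]

theorem tailsOf_conj (c b m : β) (s : ℤˣ) (l : List (Item n β β)) :
    tailsOf (l.flatMap (Item.conj c b m s)) = tailsOf l := by
  induction l with
  | nil => rfl
  | cons x l ih =>
    rw [List.flatMap_cons, tailsOf_append, ih]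
    cases x with
    | tail i x => rfl
    | head i x u =>
      rw [Item.conj]
      split_ifs <;> rfl

/-- Between the places of the markers `m` and `b` there is only the head of an arrow with marker `c`.
Therefore a tail may slide from the place of `b` to that of `m`: in front of each head with marker `b`
a cancelling pair of heads with marker `c` is created, and the third Reidemeister move is applied. -/
theorem Eqv.conj_context (l₁ l₂ : List (Item n β β)) (i : Fin n) (c b m : β) (s : ℤˣ) (hcm : c ≠ m)
    (hcb : c ≠ b) :
    Eqv (l₁ ++ [.tail i m, .head i c s, .tail i b] ++ l₂)
      (l₁.flatMap (Item.conj c b m s) ++ [.tail i m, .head i c s, .tail i b]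
        ++ l₂.flatMap (Item.conj c b m s)) := by
  have : Nonempty β := ⟨b⟩
  set Z : List (Item n β β) := [.tail i m, .head i c s, .tail i b] with hZ
  have hl : ∀ (A B C : List (Item n β β)) (j : Fin n) (u : ℤˣ),
      Eqv (A ++ [.head j b u] ++ B ++ Z ++ C)
        (A ++ [.head j c (-s), .head j m u, .head j c s] ++ B ++ Z ++ C) := by
    intro A B C j u
    have h1 := Eqv.cancel A ([.head j b u] ++ B ++ Z ++ C) j c (-s)
    have h2 := Eqv.slide_context ((A ++ [Item.head j c (-s)] : List (Item n β β)).map Item.lift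
      ++ [.tail j (.inr 1)]
      ++ B.map Item.lift ++ [.tail i (.inr 0)] ++ C.map Item.lift) (by
        simp only [tailsOf_append, List.filterMap_append, holes_lift]
        exact (by decide : ListsAll ([1, 0] : List (Fin 2)))) m b c hcm hcb s u
    simp only [List.flatMap_append, plug_lift] at h2
    simp only [heads, neg_neg] at h1
    refine Eqv.trans (.of_eq (by simp)) (h1.trans (Eqv.trans (.of_eq ?_) (h2.trans (.of_eq ?_)))) <;>
      simp [Item.plug, hZ]
  have hr : ∀ (A B C : List (Item n β β)) (j : Fin n) (u : ℤˣ),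
      Eqv (A ++ Z ++ B ++ [.head j b u] ++ C)
        (A ++ Z ++ B ++ [.head j c (-s), .head j m u, .head j c s] ++ C) := by
    intro A B C j u
    have h1 := Eqv.cancel (A ++ Z ++ B) ([.head j b u] ++ C) j c (-s)
    have h2 := Eqv.slide_context (A.map Item.lift ++ [.tail i (.inr 0)]
      ++ (B ++ [Item.head j c (-s)] : List (Item n β β)).map Item.lift ++ [.tail j (.inr 1)]
      ++ C.map Item.lift) (by
        simp only [tailsOf_append, List.filterMap_append, holes_lift]
        exact (by decide : ListsAll ([0, 1] : List (Fin 2)))) m b c hcm hcb s u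
    simp only [List.flatMap_append, plug_lift] at h2
    simp only [heads, neg_neg] at h1
    refine Eqv.trans (.of_eq (by simp)) (h1.trans (Eqv.trans (.of_eq ?_) (h2.trans (.of_eq ?_)))) <;>
      simp [Item.plug, hZ]
  have hL : ∀ X A : List (Item n β β), Eqv (A ++ X ++ Z ++ l₂)
      (A ++ X.flatMap (Item.conj c b m s) ++ Z ++ l₂) := by
    intro X
    induction X with
    | nil => intro A; exact .refl _
    | cons x X ih =>
      intro A
      have h1 := ih (A ++ Item.conj c b m s x)
      have h0 : Eqv (A ++ [x] ++ X ++ Z ++ l₂) (A ++ Item.conj c b m s x ++ X ++ Z ++ l₂) := by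
        cases x with
        | tail j x => exact .refl _
        | head j x u =>
          by_cases hx : x = b
          · subst hx
            simpa [Item.conj] using hl A X l₂ j u
          · exact .of_eq (by simp [Item.conj, hx])
      refine Eqv.trans (.of_eq (by simp)) (h0.trans (h1.trans (.of_eq (by simp))))
  have hR : ∀ X A : List (Item n β β), Eqv (l₁.flatMap (Item.conj c b m s) ++ Z ++ A ++ X)
      (l₁.flatMap (Item.conj c b m s) ++ Z ++ A ++ X.flatMap (Item.conj c b m s)) := by
    intro X
    induction X with
    | nil => intro A; exact .refl _
    | cons x X ih =>
      intro A
      have h1 := ih (A ++ Item.conj c b m s x)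
      have h0 : Eqv (l₁.flatMap (Item.conj c b m s) ++ Z ++ A ++ [x] ++ X)
          (l₁.flatMap (Item.conj c b m s) ++ Z ++ A ++ Item.conj c b m s x ++ X) := by
        cases x with
        | tail j x => exact .refl _
        | head j x u =>
          by_cases hx : x = b
          · subst hx
            simpa [Item.conj] using hr (l₁.flatMap (Item.conj c x m s)) A X j u
          · exact .of_eq (by simp [Item.conj, hx])
      refine Eqv.trans (.of_eq (by simp)) (h0.trans (Eqv.trans (.of_eq (by simp))
        (h1.trans (.of_eq (by simp)))))
  have h1 := hL l₁ []
  have h2 := hR l₂ []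
  simp only [List.nil_append, List.append_nil] at h1 h2
  exact h1.trans h2

omit [DecidableEq β] in
theorem listsAll_none_cons {T : List β} :
    ListsAll (none :: T.map some) ↔ ListsAll T := by
  simp [ListsAll, List.nodup_map_iff (Option.some_injective β), Option.forall]

/-- A tail place may be moved backwards over a head, whereby its arrows are conjugated: an additional place
with marker `none` is created in front of the head, all tails slide there, and it takes the name `b`. -/
theorem Eqv.slide_letter (l₁ l₂ : List (Item n β β)) (i : Fin n) (c b : β) (s : ℤˣ) (hcb : c ≠ b) :
    Eqv (l₁ ++ [.head i c s, .tail i b] ++ l₂)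
      (l₁.flatMap (Item.conj c b b s) ++ [.tail i b, .head i c s]
        ++ l₂.flatMap (Item.conj c b b s)) := by
  have : Nonempty β := ⟨b⟩
  refine .of_valid ?_ fun hv => ?_
  · simp only [tailsOf_append, tailsOf_conj]
    exact Iff.rfl
  have hb : ∀ x ∈ tailsOf l₁ ++ tailsOf l₂, x ≠ b := by
    have := hv.1
    simp only [tailsOf_append] at this
    have h2 : (b :: (tailsOf l₁ ++ tailsOf l₂)).Nodup :=
      (List.perm_middle (l₁ := tailsOf l₁) (l₂ := tailsOf l₂) (a := b)).nodup_iff.1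
        (by simpa [tailsOf, List.filterMap_cons, Item.getTail?] using this)
    intro x hx e
    exact (List.nodup_cons.1 h2).1 (e ▸ hx)
  have tails : ∀ A B : List (Item n β β), ListsAll (tailsOf (A.map (Item.bimap some id)
      ++ [.tail i none, .head i c s, .tail i (some b)] ++ B.map (Item.bimap some id)))
      ↔ ListsAll (b :: (tailsOf A ++ tailsOf B)) := by
    intro A B
    rw [← listsAll_none_cons (β := β)]
    refine listsAll_of_perm ?_
    simp only [tailsOf_append, tailsOf_bimap]
    simp only [tailsOf, Item.getTail?, List.filterMap_cons, List.filterMap_nil, List.map_cons,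
      List.map_append, List.append_assoc, List.cons_append, List.nil_append]
    refine List.perm_middle.trans (.cons _ ?_)
    exact List.perm_middle
  have hA := Eqv.merge (l₁.map (Item.bimap some id)
      ++ [.tail i none, .head i c s, .tail i (some b)] ++ l₂.map (Item.bimap some id))
    (some : β → Option β) (fun o => o.toList) (by
      intro o
      cases o <;> simp [eq_comm]) (by
      rw [tails, tailsOf_expand]
      refine listsAll_of_perm ?_
      simp only [tailsOf_append, tailsOf_bimap]
      simp only [tailsOf, Item.getTail?, List.filterMap_cons, List.filterMap_nil,
        List.flatMap_append, List.flatMap_map, Option.toList, List.flatMap_cons, List.flatMap_nil,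
        List.append_nil, List.nil_append, List.append_assoc]
      simp only [List.flatMap_singleton']
      exact List.perm_middle)
  have hB := Eqv.conj_context (l₁.map (Item.bimap some some)) (l₂.map (Item.bimap some some)) i
    (some c) (some b) none s (by simp) (by simpa using hcb)
  let g : β → Option β := fun x => if x = b then none else some x
  let pre : Option β → List β := fun o => o.elim [b] fun x => if x = b then [] else [x]
  have hC := Eqv.merge ((l₁.flatMap (Item.conj c b b s)).map (Item.bimap some id)
      ++ [.tail i none, .head i c s, .tail i (some b)]
      ++ (l₂.flatMap (Item.conj c b b s)).map (Item.bimap some id)) g pre (by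
      intro o
      rcases o with _ | x
      · simp [pre, g]
      · by_cases hx : x = b
        · simp only [pre, g, Option.elim, hx, if_true]
          refine ⟨List.nodup_nil, fun y => ?_⟩
          by_cases hy : y = b <;> simp [hy]
        · simp only [pre, g, Option.elim, hx, if_false]
          refine ⟨List.nodup_singleton _, fun y => ?_⟩
          by_cases hy : y = b
          · simp [hy, Ne.symm hx]
          · simp [hy]) (by
      rw [tails, tailsOf_expand]
      refine listsAll_of_perm ?_
      simp only [tailsOf_append, tailsOf_bimap, tailsOf_conj]
      have e : ∀ L : List β, (∀ x ∈ L, x ≠ b) → (L.map some).flatMap pre = L := by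
        intro L hL
        induction L with
        | nil => rfl
        | cons x L ih =>
          rw [List.map_cons, List.flatMap_cons, ih fun y hy => hL y (List.mem_cons_of_mem _ hy)]
          simp [pre, hL x List.mem_cons_self]
      rw [List.flatMap_append, List.flatMap_append,
        e _ fun x hx => hb x (List.mem_append_left _ hx),
        e _ fun x hx => hb x (List.mem_append_right _ hx)]
      simp only [tailsOf, Item.getTail?, List.filterMap_cons, List.filterMap_nil, pre]
      simp)
  have e1 : ∀ l : List (Item n β β),
      (l.map (Item.bimap some id)).flatMap (Item.expand fun o : Option β => o.toList) = l := by
    intro l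
    induction l with
    | nil => rfl
    | cons x l ih => rw [List.map_cons, List.flatMap_cons, ih]; cases x <;> rfl
  have e2 : ∀ l : List (Item n β β), (l.map (Item.bimap (some : β → Option β) id)).map
      (Item.mapHead some) = l.map (Item.bimap some some) := by
    intro l
    rw [List.map_map]
    refine List.map_congr_left fun x _ => ?_
    cases x <;> rfl
  have e3 : ∀ l : List (Item n β β), (l.map (Item.bimap some some)).flatMap
      (Item.conj (some c) (some b) none s)
      = ((l.flatMap (Item.conj c b b s)).map (Item.bimap some id)).map (Item.mapHead g) := by
    intro l
    induction l with
    | nil => rfl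
    | cons x l ih =>
      rw [List.map_cons, List.flatMap_cons, List.flatMap_cons, ih, List.map_append, List.map_append]
      congr 1
      cases x with
      | tail j x => rfl
      | head j x u =>
        by_cases hx : x = b
        · simp [Item.conj, Item.bimap, Item.mapHead, g, hx, hcb]
        · simp [Item.conj, Item.bimap, Item.mapHead, g, hx]
  have e4 : ∀ l : List (Item n β β), (∀ x ∈ tailsOf l, x ≠ b) →
      (l.map (Item.bimap some id)).flatMap (Item.expand pre) = l := by
    intro l hl
    induction l with
    | nil => rfl
    | cons x l ih =>
      rw [List.map_cons, List.flatMap_cons]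
      cases x with
      | tail j x =>
        rw [ih fun y hy => hl y (List.mem_cons_of_mem _ hy)]
        have : x ≠ b := hl x List.mem_cons_self
        simp [Item.bimap, Item.expand, pre, this]
      | head j x u => rw [ih hl]; rfl
  simp only [List.flatMap_append, List.map_append, e1, e2] at hA
  simp only [e3] at hB
  rw [List.flatMap_append, List.flatMap_append, e4, e4, List.map_append, List.map_append] at hC
  · refine Eqv.trans ?_ (hB.trans (Eqv.trans (.of_eq ?_) (hC.symm.trans (.of_eq ?_))))
    · exact hA
    · simp [Item.mapHead, g, hcb]
    · simp [Item.expand, pre]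
  all_goals
    rw [tailsOf_conj]
    intro x hx
    exact hb x (by simp [hx])

end Slide

/-! ### Diagrams with blocks of heads -/

/-- An item on a strand: the place of the tails with marker `b`, or consecutive heads that form a word with
the value `g`. -/
inductive BItem (n : ℕ) (τ G : Type) where
  | mark (i : Fin n) (b : τ)
  | block (i : Fin n) (g : G)

namespace BItem

variable {n : ℕ} {τ τ' G H β : Type}

/-- Apply a map to the values of the blocks. -/
def mapBlock (f : G → H) : BItem n τ G → BItem n τ H
  | mark i b => mark i b
  | block i g => block i (f g)

/-- Put the places listed by `pre b` in place of `b`. -/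
def expand (pre : τ' → List τ) : BItem n τ' G → List (BItem n τ G)
  | mark i b => (pre b).map (mark i)
  | block i g => [block i g]

/-- The marker of a place. -/
def marker? : BItem n τ G → Option τ
  | mark _ b => some b
  | block _ _ => none

variable [DecidableEq β]

/-- The heads and places of tails that an item stands for. -/
def items : BItem n τ (FreeGroup β) → List (Item n τ β)
  | mark i b => [.tail i b]
  | block i g => g.toWord.map fun p => .head i p.1 (sgn p.2)

theorem items_block (i : Fin n) (g : FreeGroup β) :
    (block i g : BItem n β (FreeGroup β)).items = wordHeads i g.toWord := by
  simp [items, wordHeads, heads]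

end BItem

section BEqv

variable {n : ℕ} {τ β β' β'' : Type} [DecidableEq β] [DecidableEq β'] [DecidableEq β'']

theorem tailsOf_items (B : List (BItem n τ (FreeGroup β))) :
    tailsOf (B.flatMap BItem.items) = B.filterMap BItem.marker? := by
  induction B with
  | nil => rfl
  | cons x B ih =>
    rw [List.flatMap_cons, tailsOf_append, ih]
    cases x with
    | mark i b => rfl
    | block i g =>
      have : ∀ l : List (β × Bool),
          tailsOf (l.map fun p => (Item.head i p.1 (sgn p.2) : Item n τ β)) = [] := by
        intro l
        induction l with
        | nil => rfl
        | cons y l ih => exact ih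
      rw [BItem.items, this]
      rfl

/-- Equivalence of diagrams with blocks: that of the lists of items that they stand for. -/
def BEqv (B : List (BItem n β (FreeGroup β))) (B' : List (BItem n β' (FreeGroup β'))) : Prop :=
  Eqv (B.flatMap BItem.items) (B'.flatMap BItem.items)

theorem BEqv.symm {B : List (BItem n β (FreeGroup β))} {B' : List (BItem n β' (FreeGroup β'))}
    (h : BEqv B B') : BEqv B' B := Eqv.symm h

theorem BEqv.trans {B : List (BItem n β (FreeGroup β))} {B' : List (BItem n β' (FreeGroup β'))}
    {B'' : List (BItem n β'' (FreeGroup β''))} (h : BEqv B B') (h' : BEqv B' B'') : BEqv B B'' :=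
  Eqv.trans h h'

variable [Nonempty β] [Nonempty β']

/-- The free nilpotent group of class three on the markers: the quotient in which the values of blocks are
relevant. -/
abbrev NilGroup (β : Type) : Type := FreeGroup β ⧸ lcs β 3

/-- The quotient map onto `NilGroup β`. -/
abbrev nil {β : Type} : FreeGroup β →* NilGroup β := QuotientGroup.mk' (lcs β 3)

/-- The values of blocks matter only modulo commutators of weight four. -/
theorem BEqv.of_cong {B B' : List (BItem n β (FreeGroup β))}
    (h : B.map (BItem.mapBlock nil)
      = B'.map (BItem.mapBlock nil)) : BEqv B B' := by
  have key : ∀ (B B' : List (BItem n β (FreeGroup β))),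
      B.map (BItem.mapBlock nil)
        = B'.map (BItem.mapBlock nil) →
      ∀ l : List (Item n β β), Eqv (l ++ B.flatMap BItem.items) (l ++ B'.flatMap BItem.items) := by
    intro B
    induction B with
    | nil =>
      intro B' h l
      cases B' with
      | nil => exact .refl _
      | cons y B' => cases h
    | cons x B ih =>
      intro B' h l
      cases B' with
      | nil => cases h
      | cons y B' =>
        rw [List.map_cons, List.map_cons, List.cons.injEq] at h
        have h1 := ih B' h.2 (l ++ y.items)
        have h0 : Eqv (l ++ x.items ++ B.flatMap BItem.items)
            (l ++ y.items ++ B.flatMap BItem.items) := by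
          cases x with
          | mark i b =>
            cases y with
            | mark j c => cases h.1; exact .refl _
            | block j g => cases h.1
          | block i f =>
            cases y with
            | mark j c => cases h.1
            | block j g =>
              have h2 := h.1
              simp only [BItem.mapBlock, BItem.block.injEq] at h2
              obtain ⟨rfl, h2⟩ := h2
              rw [BItem.items_block, BItem.items_block]
              refine Eqv.congr_lcs i _ _ ?_
              rw [FreeGroup.mk_toWord, FreeGroup.mk_toWord]
              exact QuotientGroup.eq.1 h2
        rw [List.flatMap_cons, List.flatMap_cons, ← List.append_assoc, ← List.append_assoc]
        exact h0.trans h1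
  exact key B B' h []

theorem BEqv.block_mul (l₁ l₂ : List (BItem n β (FreeGroup β))) (i : Fin n) (g h : FreeGroup β) :
    BEqv (l₁ ++ [.block i g, .block i h] ++ l₂) (l₁ ++ [.block i (g * h)] ++ l₂) := by
  have h1 := Eqv.red i (l₁.flatMap BItem.items) (l₂.flatMap BItem.items)
    (v := g.toWord ++ h.toWord) (w := (g * h).toWord)
    (by rw [← FreeGroup.mul_mk, FreeGroup.mk_toWord, FreeGroup.mk_toWord, FreeGroup.mk_toWord])
  rw [wordHeads_append] at h1
  simpa [BEqv, BItem.items_block] using h1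

theorem BEqv.block_one (l₁ l₂ : List (BItem n β (FreeGroup β))) (i : Fin n) :
    BEqv (l₁ ++ [.block i 1] ++ l₂) (l₁ ++ l₂) :=
  Eqv.of_eq (by simp [BItem.items])

/-- Gathering places: `pre` splits every place of `Q`, and `g` names the place from which a place has been
split off. -/
theorem BEqv.merge (Q : List (BItem n β' (FreeGroup β))) (g : β → β') (pre : β' → List β)
    (hpre : ∀ b', (pre b').Nodup ∧ ∀ b, b ∈ pre b' ↔ g b = b')
    (ht : ListsAll ((Q.filterMap BItem.marker?).flatMap pre) ↔ ListsAll (Q.filterMap BItem.marker?)) :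
    BEqv (Q.flatMap (BItem.expand pre)) (Q.map (BItem.mapBlock (FreeGroup.map g))) := by
  have h := Eqv.merge (Q.flatMap BItem.items) g pre hpre (by
    rw [tailsOf_expand, tailsOf_items]; exact ht)
  have e1 : (Q.flatMap BItem.items).flatMap (Item.expand pre)
      = (Q.flatMap (BItem.expand pre)).flatMap BItem.items := by
    rw [List.flatMap_assoc, List.flatMap_assoc]
    refine congrArg (fun f => Q.flatMap f) (funext fun x => ?_)
    cases x with
    | mark i b =>
      simp only [BItem.items, BItem.expand, Item.expand, List.flatMap_cons, List.flatMap_nil,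
        List.append_nil, List.flatMap_map]
      exact List.map_eq_flatMap
    | block i w =>
      simp only [BItem.items, BItem.expand, List.flatMap_cons, List.flatMap_nil,
        List.append_nil, List.flatMap_map, Item.expand]
      exact List.map_eq_flatMap.symm
  rw [e1] at h
  refine Eqv.trans h ?_
  clear h e1 ht
  have key : ∀ l : List (Item n β' β'), Eqv (l ++ (Q.flatMap BItem.items).map (Item.mapHead g))
      (l ++ (Q.map (BItem.mapBlock (FreeGroup.map g))).flatMap BItem.items) := by
    induction Q with
    | nil => intro l; exact .refl _
    | cons x Q ih =>
      intro l
      have h1 := ih (l ++ (x.mapBlock (FreeGroup.map g)).items)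
      have h0 : Eqv (l ++ x.items.map (Item.mapHead g) ++ (Q.flatMap BItem.items).map (Item.mapHead g))
          (l ++ (x.mapBlock (FreeGroup.map g)).items
            ++ (Q.flatMap BItem.items).map (Item.mapHead g)) := by
        cases x with
        | mark i b => exact .refl _
        | block i w =>
          have h2 := Eqv.red i l ((Q.flatMap BItem.items).map (Item.mapHead g))
            (v := w.toWord.map fun p => (g p.1, p.2)) (w := (FreeGroup.map g w).toWord) (by
              rw [FreeGroup.mk_toWord, ← FreeGroup.map.mk, FreeGroup.mk_toWord])
          rw [BItem.mapBlock, BItem.items_block]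
          convert h2 using 3
          simp [BItem.items, wordHeads, heads, Item.mapHead]
      rw [List.flatMap_cons, List.map_append, List.map_cons, List.flatMap_cons, ← List.append_assoc,
        ← List.append_assoc]
      exact h0.trans h1
  simpa using key []

/-- Blocks whose values agree after the gathering of places may be exchanged. -/
theorem BEqv.of_merge {Q Q' : List (BItem n β' (FreeGroup β))} (g : β → β') (pre : β' → List β)
    (hpre : ∀ b', (pre b').Nodup ∧ ∀ b, b ∈ pre b' ↔ g b = b')
    (ht : ListsAll ((Q.filterMap BItem.marker?).flatMap pre) ↔ ListsAll (Q.filterMap BItem.marker?))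
    (hQ : Q.map (BItem.mapBlock (FreeGroup.map g)) = Q'.map (BItem.mapBlock (FreeGroup.map g))) :
    BEqv (Q.flatMap (BItem.expand pre)) (Q'.flatMap (BItem.expand pre)) := by
  have e : Q.filterMap BItem.marker? = Q'.filterMap BItem.marker? := by
    have : ∀ Q : List (BItem n β' (FreeGroup β)), (Q.map (BItem.mapBlock (FreeGroup.map g))).filterMap
        BItem.marker? = Q.filterMap BItem.marker? := by
      intro Q
      induction Q with
      | nil => rfl
      | cons x Q ih =>
        cases x with
        | mark i b => exact congrArg (b :: ·) ih
        | block i w => exact ih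
    rw [← this Q, hQ, this]
  exact (BEqv.merge Q g pre hpre ht).trans (hQ ▸ (BEqv.merge Q' g pre hpre (e ▸ ht)).symm)

/-- Replace the generator `b` by its conjugate `w⁻¹ * b * w`. -/
def conjHom (b : β) (w : FreeGroup β) : FreeGroup β →* FreeGroup β :=
  FreeGroup.lift fun x => if x = b then w⁻¹ * FreeGroup.of b * w else FreeGroup.of x

/-- The elements that can be written without the generator `b`. -/
def avoiding (b : β) : Subgroup (FreeGroup β) := Subgroup.closure (FreeGroup.of '' {b}ᶜ)

omit [DecidableEq β] [Nonempty β] in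
theorem of_mem_avoiding {b x : β} (h : x ≠ b) : FreeGroup.of x ∈ avoiding b :=
  Subgroup.subset_closure ⟨x, h, rfl⟩

omit [Nonempty β] in
theorem conjHom_of_ne {b x : β} (h : x ≠ b) (w : FreeGroup β) :
    conjHom b w (FreeGroup.of x) = FreeGroup.of x := by
  simp [conjHom, h]

omit [Nonempty β] in
theorem conjHom_self (b : β) (w : FreeGroup β) :
    conjHom b w (FreeGroup.of b) = w⁻¹ * FreeGroup.of b * w := by
  simp [conjHom]

omit [Nonempty β] in
theorem conjHom_avoiding {b : β} (w : FreeGroup β) {g : FreeGroup β} (hg : g ∈ avoiding b) :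
    conjHom b w g = g := by
  have : avoiding b ≤ (conjHom b w).eqLocus (MonoidHom.id _) := by
    refine (Subgroup.closure_le _).2 ?_
    rintro _ ⟨x, hx, rfl⟩
    exact conjHom_of_ne hx w
  exact this hg

omit [Nonempty β] in
theorem conjHom_comp {b : β} {v : FreeGroup β} (hv : v ∈ avoiding b) {w : FreeGroup β}
    (hw : w ∈ avoiding b) (g : FreeGroup β) :
    conjHom b v (conjHom b w g) = conjHom b (v * w) g := by
  have : (conjHom b v).comp (conjHom b w) = conjHom b (v * w) := by
    refine FreeGroup.ext_hom _ _ fun x => ?_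
    by_cases hx : x = b
    · subst hx
      simp only [MonoidHom.comp_apply, conjHom_self, map_mul, map_inv, conjHom_avoiding v hw]
      group
    · simp [MonoidHom.comp_apply, conjHom_of_ne hx]
  exact DFunLike.congr_fun this g

/-- On the values of blocks, conjugating the heads with marker `b` is `conjHom`. -/
theorem flatMap_conj_items (b c : β) (t : Bool) (B : List (BItem n β (FreeGroup β)))
    (l₁ l₂ : List (Item n β β)) :
    Eqv (l₁ ++ (B.flatMap BItem.items).flatMap (Item.conj c b b (sgn t)) ++ l₂)
      (l₁ ++ (B.map (BItem.mapBlock (conjHom b (FreeGroup.mk [(c, t)])))).flatMap BItem.items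
        ++ l₂) := by
  have word : ∀ (i : Fin n) (v : List (β × Bool)), ∃ v' : List (β × Bool),
      (wordHeads i v).flatMap (Item.conj c b b (sgn t)) = wordHeads i v' ∧
      FreeGroup.mk v' = conjHom b (FreeGroup.mk [(c, t)]) (FreeGroup.mk v) := by
    intro i v
    induction v with
    | nil => exact ⟨[], rfl, by rw [← FreeGroup.one_eq_mk, map_one]⟩
    | cons p v ih =>
      obtain ⟨v', h1, h2⟩ := ih
      obtain ⟨x, u⟩ := p
      have e : FreeGroup.mk ((x, u) :: v) = FreeGroup.mk [(x, u)] * FreeGroup.mk v := by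
        rw [FreeGroup.mul_mk]; rfl
      have eu : ∀ x : β, FreeGroup.mk [(x, u)] = if u then FreeGroup.of x else (FreeGroup.of x)⁻¹ := by
        intro x; cases u <;> rfl
      by_cases hx : x = b
      · subst hx
        refine ⟨[(c, !t), (x, u), (c, t)] ++ v', ?_, ?_⟩
        · rw [wordHeads_append, ← h1]
          simp [wordHeads, heads, Item.conj, sgn_not]
        · rw [e, map_mul, ← FreeGroup.mul_mk, h2]
          congr 1
          have : FreeGroup.mk [(c, !t), (x, u), (c, t)]
              = (FreeGroup.mk [(c, t)])⁻¹ * FreeGroup.mk [(x, u)] * FreeGroup.mk [(c, t)] := by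
            rw [FreeGroup.inv_mk, FreeGroup.mul_mk, FreeGroup.mul_mk]; rfl
          rw [this, eu]
          cases u
          · simp [conjHom_self, mul_assoc]
          · simp [conjHom_self]
      · refine ⟨(x, u) :: v', ?_, ?_⟩
        · have : wordHeads i ((x, u) :: v') = wordHeads i [(x, u)] ++ wordHeads i v' := by
            rw [← wordHeads_append]; rfl
          rw [this, ← h1]
          simp [wordHeads, heads, Item.conj, hx]
        · have : FreeGroup.mk ((x, u) :: v') = FreeGroup.mk [(x, u)] * FreeGroup.mk v' := by
            rw [FreeGroup.mul_mk]; rfl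
          rw [e, map_mul, this, h2, eu]
          cases u <;> simp [conjHom_of_ne hx]
  induction B generalizing l₁ with
  | nil => exact .refl _
  | cons x B ih =>
    have h1 := ih (l₁ ++ (x.mapBlock (conjHom b (FreeGroup.mk [(c, t)]))).items)
    have h0 : Eqv (l₁ ++ x.items.flatMap (Item.conj c b b (sgn t))
          ++ ((B.flatMap BItem.items).flatMap (Item.conj c b b (sgn t)) ++ l₂))
        (l₁ ++ (x.mapBlock (conjHom b (FreeGroup.mk [(c, t)]))).items
          ++ ((B.flatMap BItem.items).flatMap (Item.conj c b b (sgn t)) ++ l₂)) := by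
      cases x with
      | mark i x => exact .refl _
      | block i w =>
        rw [BItem.mapBlock, BItem.items_block, BItem.items_block]
        obtain ⟨v', e1, e2⟩ := word i w.toWord
        rw [e1]
        refine Eqv.red i _ _ ?_
        rw [e2, FreeGroup.mk_toWord, FreeGroup.mk_toWord]
    refine Eqv.trans (.of_eq (by simp)) (h0.trans (Eqv.trans (.of_eq (by simp))
      (h1.trans (.of_eq (by simp)))))

/-- A place may be moved backwards over a block, whereby its arrows are conjugated. -/
theorem BEqv.slide (i : Fin n) (b : β) {w : FreeGroup β} (hw : w ∈ avoiding b)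
    (l₁ l₂ : List (BItem n β (FreeGroup β))) :
    BEqv (l₁ ++ [.block i w, .mark i b] ++ l₂)
      (l₁.map (BItem.mapBlock (conjHom b w)) ++ [.mark i b, .block i w]
        ++ l₂.map (BItem.mapBlock (conjHom b w))) := by
  have letter : ∀ (c : β) (t : Bool), c ≠ b → ∀ l₁ l₂ : List (BItem n β (FreeGroup β)),
      BEqv (l₁ ++ [.block i (FreeGroup.mk [(c, t)]), .mark i b] ++ l₂)
        (l₁.map (BItem.mapBlock (conjHom b (FreeGroup.mk [(c, t)])))
          ++ [.mark i b, .block i (FreeGroup.mk [(c, t)])]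
          ++ l₂.map (BItem.mapBlock (conjHom b (FreeGroup.mk [(c, t)])))) := by
    intro c t hc l₁ l₂
    have h := Eqv.slide_letter (l₁.flatMap BItem.items) (l₂.flatMap BItem.items) i c b (sgn t) hc
    have h1 := flatMap_conj_items b c t l₁ [] ([.tail i b, .head i c (sgn t)]
      ++ (l₂.flatMap BItem.items).flatMap (Item.conj c b b (sgn t)))
    have h2 := flatMap_conj_items b c t l₂
      ((l₁.map (BItem.mapBlock (conjHom b (FreeGroup.mk [(c, t)])))).flatMap BItem.items
        ++ [.tail i b, .head i c (sgn t)]) []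
    have e : (FreeGroup.mk [(c, t)]).toWord = [(c, t)] := by
      cases t
      · exact (FreeGroup.toWord_inv (FreeGroup.of c)).trans (by simp [FreeGroup.invRev])
      · exact FreeGroup.toWord_of c
    simp only [List.append_assoc, List.nil_append, List.append_nil] at h h1 h2
    simp only [BEqv, List.flatMap_append, List.flatMap_cons, List.flatMap_nil, BItem.items, e,
      List.map_cons, List.map_nil, List.append_assoc, List.append_nil]
    exact h.trans (h1.trans h2)
  have comp : ∀ (c : β) (t : Bool) (v : FreeGroup β), c ≠ b → v ∈ avoiding b →
      (∀ l₁ l₂ : List (BItem n β (FreeGroup β)), BEqv (l₁ ++ [.block i v, .mark i b] ++ l₂)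
        (l₁.map (BItem.mapBlock (conjHom b v)) ++ [.mark i b, .block i v]
          ++ l₂.map (BItem.mapBlock (conjHom b v)))) →
      ∀ l₁ l₂ : List (BItem n β (FreeGroup β)),
        BEqv (l₁ ++ [.block i (FreeGroup.mk [(c, t)] * v), .mark i b] ++ l₂)
        (l₁.map (BItem.mapBlock (conjHom b (FreeGroup.mk [(c, t)] * v)))
          ++ [.mark i b, .block i (FreeGroup.mk [(c, t)] * v)]
          ++ l₂.map (BItem.mapBlock (conjHom b (FreeGroup.mk [(c, t)] * v)))) := by
    intro c t v hc hv ih l₁ l₂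
    have hu : FreeGroup.mk [(c, t)] ∈ avoiding b := by
      cases t
      · exact inv_mem (of_mem_avoiding hc)
      · exact of_mem_avoiding hc
    set u := FreeGroup.mk [(c, t)] with hu'
    have ec : ∀ l : List (BItem n β (FreeGroup β)), (l.map (BItem.mapBlock (conjHom b v))).map
        (BItem.mapBlock (conjHom b u)) = l.map (BItem.mapBlock (conjHom b (u * v))) := by
      intro l
      rw [List.map_map]
      refine List.map_congr_left fun x _ => ?_
      cases x with
      | mark j x => rfl
      | block j g => simp [BItem.mapBlock, conjHom_comp hu hv]
    have h1 := (BEqv.block_mul l₁ ([.mark i b] ++ l₂) i u v).symm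
    have h2 := ih (l₁ ++ [.block i u]) l₂
    have h3 := letter c t hc (l₁.map (BItem.mapBlock (conjHom b v)))
      ([.block i v] ++ l₂.map (BItem.mapBlock (conjHom b v)))
    have h4 := BEqv.block_mul (l₁.map (BItem.mapBlock (conjHom b (u * v))) ++ [.mark i b])
      (l₂.map (BItem.mapBlock (conjHom b (u * v)))) i u v
    rw [← hu', List.map_append, ec, ec] at h3
    simp only [List.append_assoc, List.cons_append, List.nil_append, List.map_append, List.map_cons,
      List.map_nil, BItem.mapBlock, conjHom_avoiding _ hu, conjHom_avoiding _ hv] at h1 h2 h3 h4 ⊢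
    exact h1.trans (h2.trans (h3.trans h4))
  induction hw using Subgroup.closure_induction_left generalizing l₁ l₂ with
  | one =>
    refine Eqv.of_eq ?_
    have : ∀ l : List (BItem n β (FreeGroup β)), l.map (BItem.mapBlock (conjHom b 1)) = l := by
      intro l
      have e : conjHom b (1 : FreeGroup β) = MonoidHom.id _ := FreeGroup.ext_hom _ _ fun x => by
        by_cases hx : x = b <;> simp [conjHom, hx]
      rw [e]
      conv_rhs => rw [← List.map_id l]
      refine List.map_congr_left fun x _ => ?_
      cases x <;> rfl
    simp [this, BItem.items]
  | mul_left x hx v hv ih =>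
    obtain ⟨c, hc, rfl⟩ := hx
    exact comp c true v hc hv (fun l₁ l₂ => ih l₁ l₂) l₁ l₂
  | inv_mul_cancel x hx v hv ih =>
    obtain ⟨c, hc, rfl⟩ := hx
    exact comp c false v hc hv (fun l₁ l₂ => ih l₁ l₂) l₁ l₂

end BEqv

/-! ### Commutators of weight three in groups of nilpotency class three -/

/-- In a group of nilpotency class three, commutators of weight four are trivial. -/
class IsClassThree (G : Type*) [Group G] : Prop where
  comm_eq_one (a b c d : G) : ⁅⁅⁅a, b⁆, c⁆, d⁆ = 1

/-- The center as a commutative group whose group structure is visibly the one of a subgroup. -/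
instance {G : Type*} [Group G] : CommGroup (Subgroup.center G) :=
  { (inferInstance : Group (Subgroup.center G)) with
    mul_comm := fun a b => Subtype.ext (Subgroup.mem_center_iff.1 b.2 a) }

section ClassThree

variable {G : Type*} [Group G] [IsClassThree G]

/-- The commutator `⁅⁅a, b⁆, c⁆` as an element of the center, written additively. -/
def tri (a b c : G) : Additive (Subgroup.center G) :=
  .ofMul ⟨⁅⁅a, b⁆, c⁆, Subgroup.mem_center_iff.2 fun d =>
    (commutatorElement_eq_one_iff_mul_comm.1 (IsClassThree.comm_eq_one a b c d)).symm⟩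

/-- A central element, as an element of the group. -/
def cen (z : Additive (Subgroup.center G)) : G := (z.toMul : G)

omit [IsClassThree G] in
theorem cen_add (z w : Additive (Subgroup.center G)) : cen (z + w) = cen z * cen w := rfl

omit [IsClassThree G] in
theorem cen_neg (z : Additive (Subgroup.center G)) : cen (-z) = (cen z)⁻¹ := rfl

omit [IsClassThree G] in
theorem cen_zero : cen (0 : Additive (Subgroup.center G)) = 1 := rfl

omit [IsClassThree G] in
theorem cen_comm (z : Additive (Subgroup.center G)) (x : G) : x * cen z = cen z * x :=
  Subgroup.mem_center_iff.1 z.toMul.2 x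

omit [IsClassThree G] in
theorem cen_injective : Function.Injective (cen : Additive (Subgroup.center G) → G) :=
  Subtype.val_injective

theorem cen_tri (a b c : G) : cen (tri a b c) = ⁅⁅a, b⁆, c⁆ := rfl

omit [IsClassThree G] in
theorem comm_cen_mul (z : Additive (Subgroup.center G)) (x y : G) : ⁅cen z * x, y⁆ = ⁅x, y⁆ := by
  simp only [commutatorElement_def, mul_inv_rev]
  rw [show cen z * x * y * (x⁻¹ * (cen z)⁻¹) * y⁻¹ = cen z * (x * y * x⁻¹) * (cen z)⁻¹ * y⁻¹ by group,
    ← cen_comm]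
  group

theorem conj_tri (a b c x : G) : x * ⁅⁅a, b⁆, c⁆ * x⁻¹ = ⁅⁅a, b⁆, c⁆ := by
  rw [← cen_tri, cen_comm, mul_inv_cancel_right]

theorem tri_mul_right (a b c d : G) : tri a b (c * d) = tri a b c + tri a b d := by
  apply cen_injective
  rw [cen_add, cen_tri, cen_tri, cen_tri, commutatorElement_mul_right_eq_mul_conj, mul_assoc, mul_assoc,
    ← mul_assoc c, conj_tri]

theorem tri_one_right (a b : G) : tri a b 1 = 0 := by
  apply cen_injective
  rw [cen_tri, commutatorElement_one_right, cen_zero]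

theorem tri_inv_right (a b c : G) : tri a b c⁻¹ = -tri a b c := by
  rw [eq_neg_iff_add_eq_zero, ← tri_mul_right, inv_mul_cancel, tri_one_right]

theorem tri_mul_left (a b c d : G) : tri (a * b) c d = tri a c d + tri b c d := by
  apply cen_injective
  have e : ⁅a * b, c⁆ = cen (-tri b c a) * (⁅b, c⁆ * ⁅a, c⁆) := by
    rw [cen_neg, cen_tri, commutatorElement_inv]
    simp only [commutatorElement_def]
    group
  rw [cen_tri, e, comm_cen_mul, commutatorElement_mul_left_eq_conj_mul, conj_tri, cen_add,
    cen_tri, cen_tri]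

theorem tri_one_left (a b : G) : tri 1 a b = 0 := by
  apply cen_injective
  rw [cen_tri, commutatorElement_one_left, commutatorElement_one_left, cen_zero]

theorem tri_inv_left (a b c : G) : tri a⁻¹ b c = -tri a b c := by
  rw [eq_neg_iff_add_eq_zero, ← tri_mul_left, inv_mul_cancel, tri_one_left]

theorem tri_swap (a b c : G) : tri a b c = -tri b a c := by
  apply cen_injective
  have h := conj_tri b a c ⁅b, a⁆⁻¹
  rw [cen_neg, cen_tri, cen_tri, ← commutatorElement_inv b a, commutatorElement_inv_left,
    ← commutatorElement_inv ⁅b, a⁆ c]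
  nth_rewrite 2 [← h]
  group

theorem tri_mul_mid (a b c d : G) : tri a (b * c) d = tri a b d + tri a c d := by
  rw [tri_swap, tri_mul_left, tri_swap b, tri_swap c]; abel

theorem tri_inv_mid (a b c : G) : tri a b⁻¹ c = -tri a b c := by
  rw [tri_swap, tri_inv_left, tri_swap b]; abel

/-- The Jacobi identity. -/
theorem tri_jacobi (a b c : G) : tri a b c + tri b c a + tri c a b = 0 := by
  have h : tri a b (b * c * b⁻¹) + tri b c (c * a * c⁻¹) + tri c a (a * b * a⁻¹) = 0 :=
    cen_injective (commutatorElement_commutatorElement_conj_mul a b c)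
  simp only [tri_mul_right, tri_inv_right] at h
  rw [← h]
  abel

theorem tri_sum (a b c : G) : tri a b c + tri c a b = tri c b a := by
  rw [tri_swap c b a, eq_neg_iff_add_eq_zero, ← tri_jacobi a b c]
  abel

theorem comm_swap_inv_left (a b c : G) : ⁅⁅a, b⁆, c⁆ = ⁅⁅b⁻¹, a⁆, c⁆ := by
  rw [← cen_tri, ← cen_tri, tri_inv_left, ← tri_swap]

theorem comm_swap_inv_right (a b c : G) : ⁅⁅a, b⁆, c⁆ = ⁅⁅b, a⁆, c⁻¹⁆ := by
  rw [← cen_tri, ← cen_tri, tri_inv_right, ← tri_swap]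

theorem comm_inv_left (a b c : G) : ⁅⁅a⁻¹, b⁆, c⁆ = ⁅⁅a, b⁆, c⁻¹⁆ := by
  rw [← cen_tri, ← cen_tri, tri_inv_right, tri_inv_left]

theorem comm_conj (a e y : G) : ⁅e⁻¹ * a * e, y⁆ = ⁅⁅a, e⁆, y⁆ * ⁅a, y⁆ := by
  have h : e⁻¹ * a * e = a * ⁅a⁻¹, e⁻¹⁆ := by simp [commutatorElement_def, mul_assoc]
  rw [h, commutatorElement_mul_left_eq_conj_mul, conj_tri, ← cen_tri, tri_inv_left, tri_inv_mid,
    neg_neg, cen_tri]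

end ClassThree

/-! ### Conjugating a generator modulo commutators of weight four -/

section Substitution

variable {n : ℕ} {β : Type}

instance : IsClassThree (NilGroup β) where
  comm_eq_one a b c d := by
    obtain ⟨a, rfl⟩ := QuotientGroup.mk_surjective a
    obtain ⟨b, rfl⟩ := QuotientGroup.mk_surjective b
    obtain ⟨c, rfl⟩ := QuotientGroup.mk_surjective c
    obtain ⟨d, rfl⟩ := QuotientGroup.mk_surjective d
    refine (QuotientGroup.eq_one_iff _).2 ?_
    have h1 : ⁅a, b⁆ ∈ lcs β 1 :=
      Subgroup.commutator_mem_commutator (Subgroup.mem_top a) (Subgroup.mem_top b)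
    have h2 : ⁅⁅a, b⁆, c⁆ ∈ lcs β 2 := Subgroup.commutator_mem_commutator h1 (Subgroup.mem_top c)
    exact Subgroup.commutator_mem_commutator h2 (Subgroup.mem_top d)

theorem nil_comm (x y z : FreeGroup β) : nil ⁅⁅x, y⁆, z⁆ = cen (tri (nil x) (nil y) (nil z)) := by
  rw [cen_tri, map_commutatorElement, map_commutatorElement]

variable [DecidableEq β]

theorem nil_conjHom_of_central (b : β) {w : FreeGroup β} (hw : ∀ x, x * nil w = nil w * x)
    (g : FreeGroup β) : nil (conjHom b w g) = nil g := by
  have : nil.comp (conjHom b w) = nil := FreeGroup.ext_hom _ _ fun x => by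
    by_cases hx : x = b
    · subst hx
      rw [MonoidHom.comp_apply, conjHom_self, map_mul, map_mul, map_inv, mul_assoc, hw,
        inv_mul_cancel_left]
    · rw [MonoidHom.comp_apply, conjHom_of_ne hx]
  exact DFunLike.congr_fun this g

/-- A homomorphism to an abelian group does not notice that a generator is conjugated. -/
theorem additive_conjHom {A : Type*} [AddCommGroup A] (F : NilGroup β → A)
    (hF : ∀ x y, F (x * y) = F x + F y) (b : β) (w g : FreeGroup β) :
    F (nil (conjHom b w g)) = F (nil g) := by
  let Φ : FreeGroup β →* Multiplicative A := (MonoidHom.mk' (fun x => Multiplicative.ofAdd (F x))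
    fun x y => by rw [hF]; rfl).comp nil
  have : Φ.comp (conjHom b w) = Φ := FreeGroup.ext_hom _ _ fun x => by
    by_cases hx : x = b
    · subst hx
      rw [MonoidHom.comp_apply, conjHom_self, map_mul, map_mul, map_inv, mul_right_comm,
        inv_mul_cancel, one_mul]
    · rw [MonoidHom.comp_apply, conjHom_of_ne hx]
  exact DFunLike.congr_fun this g

/-- Commutators of weight three do not change when a generator is conjugated. -/
theorem nil_conjHom_comm (b : β) (w x y z : FreeGroup β) :
    nil (conjHom b w ⁅⁅x, y⁆, z⁆) = nil ⁅⁅x, y⁆, z⁆ := by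
  rw [map_commutatorElement (conjHom b w), map_commutatorElement (conjHom b w), nil_comm, nil_comm,
    additive_conjHom (fun u => tri u _ _) (fun u v => tri_mul_left u v _ _),
    additive_conjHom (fun u => tri _ u _) (fun u v => tri_mul_mid _ u v _),
    additive_conjHom (fun u => tri _ _ u) (fun u v => tri_mul_right _ _ u v)]

omit [DecidableEq β] in
theorem nil_comm_central (x y z : FreeGroup β) (u : NilGroup β) :
    u * nil ⁅⁅x, y⁆, z⁆ = nil ⁅⁅x, y⁆, z⁆ * u := by
  rw [nil_comm, cen_comm]

/-! ### Adjacent places -/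

/-- The substitution of `a` for `b`. -/
def subst (b a : β) : FreeGroup β →* FreeGroup β := FreeGroup.map fun x => if x = b then a else x

theorem subst_self (b a : β) : subst b a (FreeGroup.of b) = FreeGroup.of a := by simp [subst]

theorem subst_of_ne {b x : β} (h : x ≠ b) (a : β) : subst b a (FreeGroup.of x) = FreeGroup.of x := by
  simp [subst, h]

theorem subst_avoiding {b : β} (a : β) {g : FreeGroup β} (hg : g ∈ avoiding b) :
    subst b a g = g := by
  have : avoiding b ≤ (subst b a).eqLocus (MonoidHom.id _) := by
    refine (Subgroup.closure_le _).2 ?_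
    rintro _ ⟨x, hx, rfl⟩
    exact subst_of_ne hx a
  exact this hg

theorem marker_mapBlock {τ G H : Type} (f : G → H) (B : List (BItem n τ G)) :
    (B.map (BItem.mapBlock f)).filterMap BItem.marker? = B.filterMap BItem.marker? := by
  induction B with
  | nil => rfl
  | cons x B ih =>
    cases x with
    | mark i b => exact congrArg (b :: ·) ih
    | block i w => exact ih

/-- Arrows whose tails are at adjacent places are equivalent. -/
theorem BEqv.identify (l₁ l₂ : List (BItem n β (FreeGroup β))) (i : Fin n) {a b : β} (hab : a ≠ b) :
    BEqv (l₁ ++ [.mark i b, .mark i a] ++ l₂)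
      (l₁.map (BItem.mapBlock (subst b a)) ++ [.mark i b, .mark i a]
        ++ l₂.map (BItem.mapBlock (subst b a))) := by
  have : Nonempty β := ⟨a⟩
  have : Nonempty {x // x ≠ b} := ⟨⟨a, hab⟩⟩
  refine Eqv.of_valid ?_ fun hv => ?_
  · rw [tailsOf_items, tailsOf_items]
    simp only [List.filterMap_append, marker_mapBlock]
  rw [tailsOf_items, List.filterMap_append, List.filterMap_append] at hv
  simp only [List.filterMap_cons, List.filterMap_nil, BItem.marker?] at hv
  set m₁ := l₁.filterMap BItem.marker? with hm₁
  set m₂ := l₂.filterMap BItem.marker? with hm₂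
  have hm : ∀ x ∈ m₁ ++ m₂, x ≠ b ∧ x ≠ a := by
    have h2 : (b :: a :: (m₁ ++ m₂)).Nodup := by
      refine List.Perm.nodup (List.Perm.trans (.of_eq ?_) (List.Perm.trans
        List.perm_middle (.cons _ List.perm_middle))) hv.1
      simp
    intro x hx
    constructor
    · rintro rfl
      exact (List.nodup_cons.1 h2).1 (List.mem_cons_of_mem _ hx)
    · rintro rfl
      exact (List.nodup_cons.1 (List.nodup_cons.1 h2).2).1 hx
  let f : β → {x // x ≠ b} := fun x => if h : x = b then ⟨a, hab⟩ else ⟨x, h⟩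
  have fa : f a = ⟨a, hab⟩ := by simp [f, hab]
  let pre : {x // x ≠ b} → List β := fun x => if x.1 = a then [b, a] else [x.1]
  let tag : BItem n β (FreeGroup β) → BItem n {x // x ≠ b} (FreeGroup β) := fun
    | .mark j x => .mark j (f x)
    | .block j g => .block j g
  have htag : ∀ l : List (BItem n β (FreeGroup β)),
      (l.map tag).filterMap BItem.marker? = (l.filterMap BItem.marker?).map f := by
    intro l
    induction l with
    | nil => rfl
    | cons x l ih =>
      cases x with
      | mark j x => exact congrArg (f x :: ·) ih
      | block j g => exact ih
  have hexp : ∀ l : List (BItem n β (FreeGroup β)),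
      (∀ x ∈ l.filterMap BItem.marker?, x ≠ b ∧ x ≠ a) →
      (l.map tag).flatMap (BItem.expand pre) = l := by
    intro l hl
    induction l with
    | nil => rfl
    | cons x l ih =>
      rw [List.map_cons, List.flatMap_cons]
      cases x with
      | mark j x =>
        rw [ih fun y hy => hl y (List.mem_cons_of_mem _ hy)]
        have hx : x ≠ b ∧ x ≠ a := hl x List.mem_cons_self
        simp [tag, BItem.expand, pre, f, hx.1, hx.2]
      | block j g => rw [ih hl]; rfl
  have h := BEqv.of_merge (Q := l₁.map tag ++ [BItem.mark i (f a)] ++ l₂.map tag)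
    (Q' := (l₁.map (BItem.mapBlock (subst b a))).map tag ++ [BItem.mark i (f a)]
      ++ (l₂.map (BItem.mapBlock (subst b a))).map tag) f pre (by
      rintro ⟨x, hx⟩
      by_cases hxa : x = a
      · subst hxa
        simp only [pre, if_true]
        refine ⟨by simp [Ne.symm hab], fun y => ?_⟩
        by_cases hy : y = b
        · simp [f, hy]
        · simp [f, hy]
      · simp only [pre, hxa, if_false]
        refine ⟨List.nodup_singleton _, fun y => ?_⟩
        by_cases hy : y = b
        · simp [f, hy, Ne.symm hx, Ne.symm hxa]
        · simp [f, hy]) (by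
      have e : (m₁ ++ [a] ++ m₂).map f = m₁.map f ++ [f a] ++ m₂.map f := by simp
      rw [List.filterMap_append, List.filterMap_append, htag, htag, ← hm₁, ← hm₂]
      refine iff_of_true ?_ ?_
      · have hp : ∀ m : List β, (∀ x ∈ m, x ≠ b ∧ x ≠ a) → (m.map f).flatMap pre = m := by
          intro m hm
          induction m with
          | nil => rfl
          | cons x m ih =>
            have hx := hm x List.mem_cons_self
            rw [List.map_cons, List.flatMap_cons, ih fun y hy => hm y (List.mem_cons_of_mem _ hy)]
            simp [pre, f, hx.1, hx.2]
        rw [List.flatMap_append, List.flatMap_append, hp, hp]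
        · simpa [fa, pre, BItem.marker?] using hv
        · exact fun x hx => hm x (List.mem_append_right _ hx)
        · exact fun x hx => hm x (List.mem_append_left _ hx)
      · have hne : ∀ x ∈ m₁ ++ [a] ++ m₂, x ≠ b := by
          intro x hx
          simp only [List.mem_append, List.mem_singleton] at hx
          rcases hx with (hx | hx) | hx
          · exact (hm x (List.mem_append_left _ hx)).1
          · exact hx ▸ hab
          · exact (hm x (List.mem_append_right _ hx)).1
        change ListsAll (m₁.map f ++ [f a] ++ m₂.map f)
        rw [← e]
        refine ⟨List.Nodup.map_on (fun x hx y hy hxy => ?_) ?_, fun x => ?_⟩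
        · simpa [f, hne x hx, hne y hy] using hxy
        · refine hv.1.sublist ?_
          simp
        · have hx := hv.2 x.1
          refine List.mem_map.2 ⟨x.1, ?_, by simp [f, x.2]⟩
          simpa [x.2] using hx) (by
      have hs : ∀ g, FreeGroup.map f (subst b a g) = FreeGroup.map f g := by
        intro g
        have : (FreeGroup.map f).comp (subst b a) = FreeGroup.map f :=
          FreeGroup.ext_hom _ _ fun x => by
            by_cases hx : x = b
            · subst hx
              simp [subst, f, hab]
            · simp [subst_of_ne hx]
        exact DFunLike.congr_fun this g
      simp only [List.map_append, List.map_map]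
      congr 1
      · congr 1
        refine List.map_congr_left fun x _ => ?_
        cases x with
        | mark j x => rfl
        | block j g => exact congrArg _ (hs g).symm
      · refine List.map_congr_left fun x _ => ?_
        cases x with
        | mark j x => rfl
        | block j g => exact congrArg _ (hs g).symm)
  rw [List.flatMap_append, List.flatMap_append, List.flatMap_append, List.flatMap_append,
    hexp, hexp, hexp, hexp] at h
  · have h' := h
    simp only [fa, BItem.expand, pre, List.flatMap_cons, List.flatMap_nil, if_true, List.map_cons,
      List.map_nil, List.append_nil] at h'
    exact h'
  all_goals
    intro x hx
    try rw [marker_mapBlock] at hx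
    exact hm x (by simp [hm₁, hm₂, hx])

end Substitution

/-! ### The square relation -/

section Square

variable {n : ℕ} {β : Type} [DecidableEq β]

/-- Two groups of items after a list of items, in one order or the other. -/
def arr {α : Type} (d : Bool) (l z z' : List α) : List α := if d then l ++ z ++ z' else l ++ z' ++ z

theorem arr_not {α : Type} (d : Bool) (l z z' : List α) : arr (!d) l z z' = arr d l z' z := by
  cases d <;> rfl

theorem map_arr {α γ : Type} (f : α → γ) (d : Bool) (l z z' : List α) :
    (arr d l z z').map f = arr d (l.map f) (z.map f) (z'.map f) := by
  cases d <;> simp [arr]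

theorem BEqv.arr_cong [Nonempty β] (d : Bool) {l z z' y y' : List (BItem n β (FreeGroup β))}
    (h : z.map (BItem.mapBlock nil) = y.map (BItem.mapBlock nil))
    (h' : z'.map (BItem.mapBlock nil) = y'.map (BItem.mapBlock nil)) :
    BEqv (arr d l z z') (arr d l y y') :=
  .of_cong (by rw [map_arr, map_arr, h, h'])

theorem BEqv.arr_mul [Nonempty β] (d : Bool) (l p q z : List (BItem n β (FreeGroup β))) (i : Fin n)
    (g h : FreeGroup β) : BEqv (arr d l (p ++ [.block i g, .block i h] ++ q) z)
      (arr d l (p ++ [.block i (g * h)] ++ q) z) := by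
  cases d
  · simpa [arr] using BEqv.block_mul (l ++ z ++ p) q i g h
  · simpa [arr] using BEqv.block_mul (l ++ p) (q ++ z) i g h

theorem BEqv.arr_one [Nonempty β] (d : Bool) (l p q z : List (BItem n β (FreeGroup β))) (i : Fin n) :
    BEqv (arr d l (p ++ [.block i 1] ++ q) z) (arr d l (p ++ q) z) := by
  cases d
  · simpa [arr] using BEqv.block_one (l ++ z ++ p) q i
  · simpa [arr] using BEqv.block_one (l ++ p) (q ++ z) i

/-- Applying the endomorphism `φ` to the blocks of `l` gives `l'`, modulo commutators of weight four. -/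
abbrev Moves (φ : FreeGroup β →* FreeGroup β) (l l' : List (BItem n β (FreeGroup β))) : Prop :=
  l.map (BItem.mapBlock fun g => nil (φ g)) = l'.map (BItem.mapBlock nil)

omit [DecidableEq β] in
theorem Moves.map_eq {φ : FreeGroup β →* FreeGroup β} {l l' : List (BItem n β (FreeGroup β))}
    (h : Moves φ l l') : (l.map (BItem.mapBlock φ)).map (BItem.mapBlock nil)
      = l'.map (BItem.mapBlock nil) := by
  rw [← h, List.map_map]
  refine List.map_congr_left fun x _ => ?_
  cases x <;> rfl

theorem BEqv.arr_slide (d : Bool) (i : Fin n) (b : β) {w : FreeGroup β} (hw : w ∈ avoiding b)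
    {l p q z l' p' q' z' : List (BItem n β (FreeGroup β))} (hl : Moves (conjHom b w) l l')
    (hp : Moves (conjHom b w) p p') (hq : Moves (conjHom b w) q q') (hz : Moves (conjHom b w) z z') :
    BEqv (arr d l (p ++ [.block i w, .mark i b] ++ q) z)
      (arr d l' (p' ++ [.mark i b, .block i w] ++ q') z') := by
  have : Nonempty β := ⟨b⟩
  have h0 : BEqv (arr d (l.map (BItem.mapBlock (conjHom b w)))
        (p.map (BItem.mapBlock (conjHom b w)) ++ [.mark i b, .block i w]
          ++ q.map (BItem.mapBlock (conjHom b w))) (z.map (BItem.mapBlock (conjHom b w))))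
      (arr d l' (p' ++ [.mark i b, .block i w] ++ q') z') :=
    .of_cong (by
      rw [map_arr, map_arr]
      simp only [List.map_append, hl.map_eq, hp.map_eq, hq.map_eq, hz.map_eq])
  refine BEqv.trans ?_ h0
  cases d
  · simpa [arr] using BEqv.slide i b hw (l ++ z ++ p) q
  · simpa [arr] using BEqv.slide i b hw (l ++ p) (q ++ z)

theorem BEqv.arr_identify (d : Bool) (i : Fin n) {a b : β} (hab : a ≠ b)
    {l p q z l' p' q' z' : List (BItem n β (FreeGroup β))} (hl : Moves (subst b a) l l')
    (hp : Moves (subst b a) p p') (hq : Moves (subst b a) q q') (hz : Moves (subst b a) z z') :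
    BEqv (arr d l (p ++ [.mark i b, .mark i a] ++ q) z)
      (arr d l' (p' ++ [.mark i b, .mark i a] ++ q') z') := by
  have : Nonempty β := ⟨b⟩
  have h0 : BEqv (arr d (l.map (BItem.mapBlock (subst b a)))
        (p.map (BItem.mapBlock (subst b a)) ++ [.mark i b, .mark i a]
          ++ q.map (BItem.mapBlock (subst b a))) (z.map (BItem.mapBlock (subst b a))))
      (arr d l' (p' ++ [.mark i b, .mark i a] ++ q') z') :=
    .of_cong (by
      rw [map_arr, map_arr]
      simp only [List.map_append, hl.map_eq, hp.map_eq, hq.map_eq, hz.map_eq])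
  refine BEqv.trans ?_ h0
  cases d
  · simpa [arr] using BEqv.identify (l ++ z ++ p) q i hab
  · simpa [arr] using BEqv.identify (l ++ p) (q ++ z) i hab

variable {i j : Fin n} {a a₂ e e₂ : β}

/-- A list of items that is not affected by the operations used for the square relation. -/
structure Inert (a₂ a e₂ e : β) (l : List (BItem n β (FreeGroup β))) : Prop where
  conj (b : β) (w : FreeGroup β) : Moves (conjHom b w) l l
  subst_left : Moves (subst a₂ a) l l
  subst_right : Moves (subst e₂ e) l l

/-- Two places `a` on the strand `j` and `e` on the strand `i`, each next to a block of commutators of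
weight three in which `y`, `a` and `e` occur, may be moved over these blocks simultaneously. The proof
computes the result of pulling the two places across each other's commutators in both orders; the additional
places `a₂` and `e₂` keep copies of the tails. -/
theorem BEqv.square (d : Bool) {l : List (BItem n β (FreeGroup β))} (hl : Inert a₂ a e₂ e l)
    {y : FreeGroup β} (ya : y ∈ avoiding a) (ya₂ : y ∈ avoiding a₂) (ye : y ∈ avoiding e)
    (ye₂ : y ∈ avoiding e₂) (haa : a ≠ a₂) (hee : e ≠ e₂) (hae : a ≠ e) (hae₂ : a ≠ e₂)
    (hea₂ : e ≠ a₂) (haa₂ : a₂ ≠ e₂) :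
    BEqv (arr d l [.mark j a₂, .mark j a, .block j ⁅⁅y, FreeGroup.of a⁆, FreeGroup.of e⁆]
        [.block i ⁅⁅FreeGroup.of a, FreeGroup.of e⁆, y⁆, .mark i e₂, .mark i e])
      (arr d l [.block j ⁅⁅y, FreeGroup.of a⁆, FreeGroup.of e⁆, .mark j a₂, .mark j a]
        [.mark i e₂, .mark i e, .block i ⁅⁅FreeGroup.of a, FreeGroup.of e⁆, y⁆]) := by
  have : Nonempty β := ⟨a⟩
  set A : FreeGroup β := .of a with hA
  set A₂ : FreeGroup β := .of a₂ with hA₂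
  set E : FreeGroup β := .of e with hE
  set E₂ : FreeGroup β := .of e₂ with hE₂
  set M : FreeGroup β := ⁅⁅y, A⁆, E⁆ with hM
  set Λ : FreeGroup β := ⁅⁅A, E⁆, y⁆ with hΛ
  set K : FreeGroup β := ⁅A, y⁆ with hK
  have eΛ : nil ⁅E⁻¹ * A * E, y⁆ = nil Λ * nil K := by
    simp only [hΛ, hK, map_commutatorElement, map_mul, map_inv]
    exact comm_conj _ _ _
  have eM : K⁻¹ * E * K = M * E := by
    simp [hM, hK, commutatorElement_def, mul_assoc]
  have eM' : K⁻¹ * E * K * E⁻¹ = M := by rw [eM, mul_inv_cancel_right]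
  have cM : ∀ x, x * nil M = nil M * x := nil_comm_central _ _ _
  have cΛ : ∀ x, x * nil Λ = nil Λ * x := nil_comm_central _ _ _
  have aE : E ∈ avoiding a := of_mem_avoiding hae.symm
  have a₂E : E ∈ avoiding a₂ := of_mem_avoiding hea₂
  have eA : A ∈ avoiding e := of_mem_avoiding hae
  have e₂A : A ∈ avoiding e₂ := of_mem_avoiding hae₂
  have a₂A : A ∈ avoiding a₂ := of_mem_avoiding haa
  have e₂E : E ∈ avoiding e₂ := of_mem_avoiding hee
  have comm_mem : ∀ {b : β} {g h : FreeGroup β}, g ∈ avoiding b → h ∈ avoiding b →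
      ⁅g, h⁆ ∈ avoiding b := fun hg hh =>
    mul_mem (mul_mem (mul_mem hg hh) (inv_mem hg)) (inv_mem hh)
  have eK : K ∈ avoiding e := comm_mem eA ye
  have e₂Λ : Λ ∈ avoiding e₂ := comm_mem (comm_mem e₂A e₂E) ye₂
  have a₂M : M ∈ avoiding a₂ := comm_mem (comm_mem ya₂ a₂A) a₂E
  -- `E` between the two copies of `a` is compensated by `E₂⁻¹`, and `K` between the two copies of `e` by
  -- `⁅A₂, y⁆⁻¹`. Moving `a` back over `E` changes `K` into `Λ * K`; then `e` is moved back over `K`.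
  have path₁ : BEqv (arr d l [.mark j a₂, .block j E, .mark j a, .block j E₂⁻¹]
        [.mark i e₂, .block i K, .mark i e, .block i ⁅A₂, y⁆⁻¹])
      (arr d l [.mark j a₂, .mark j a, .block j M] [.block i Λ, .mark i e₂, .mark i e]) := by
    have s₁ := BEqv.arr_slide d j a aE (hl.conj a E) (p := [.mark j a₂]) (p' := [.mark j a₂])
      (q := [.block j E₂⁻¹]) (q' := [.block j E₂⁻¹])
      (z := [.mark i e₂, .block i K, .mark i e, .block i ⁅A₂, y⁆⁻¹])
      (z' := [.mark i e₂, .block i ⁅E⁻¹ * A * E, y⁆, .mark i e, .block i ⁅A₂, y⁆⁻¹]) rfl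
      (by simp [BItem.mapBlock, Moves, hE₂, conjHom_of_ne hae₂.symm])
      (by simp only [Moves, List.map_cons, List.map_nil, BItem.mapBlock, map_commutatorElement,
            map_inv, hK, hA, hA₂, conjHom_self, conjHom_avoiding _ ya, conjHom_of_ne haa.symm])
    have s₂ := BEqv.arr_identify d j haa hl.subst_left (p := []) (p' := [])
      (q := [.block j E, .block j E₂⁻¹]) (q' := [.block j E, .block j E₂⁻¹])
      (z := [.mark i e₂, .block i ⁅E⁻¹ * A * E, y⁆, .mark i e, .block i ⁅A₂, y⁆⁻¹])
      (z' := [.mark i e₂, .block i (Λ * K), .mark i e, .block i K⁻¹]) rfl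
      (by simp [BItem.mapBlock, Moves, hE₂, hE, subst_of_ne haa₂.symm, subst_of_ne hea₂])
      (by simp only [Moves, List.map_cons, List.map_nil, BItem.mapBlock, map_mul nil, ← eΛ]
          simp only [map_commutatorElement, map_mul,
            map_inv, hK, hA, hA₂, hE, subst_self, subst_avoiding _ ya₂, subst_of_ne haa,
            subst_of_ne hea₂])
    have s₃ := (BEqv.arr_mul (!d) l [.mark i e₂] [.mark i e, .block i K⁻¹]
      [.mark j a₂, .mark j a, .block j E, .block j E₂⁻¹] i Λ K).symm
    have s₄ := BEqv.arr_slide (!d) i e eK (hl.conj e K) (p := [.mark i e₂, .block i Λ])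
      (p' := [.mark i e₂, .block i Λ]) (q := [.block i K⁻¹]) (q' := [.block i K⁻¹])
      (z := [.mark j a₂, .mark j a, .block j E, .block j E₂⁻¹])
      (z' := [.mark j a₂, .mark j a, .block j (K⁻¹ * E * K), .block j E₂⁻¹])
      (by simp only [Moves, List.map_cons, List.map_nil, BItem.mapBlock, hΛ, nil_conjHom_comm])
      (by simp only [Moves, List.map_cons, List.map_nil, BItem.mapBlock, map_inv,
            conjHom_avoiding _ eK])
      (by simp only [Moves, List.map_cons, List.map_nil, BItem.mapBlock, map_inv, hE, hE₂,
            conjHom_self, conjHom_of_ne hee.symm])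
    have s₅ := (BEqv.arr_mul (!d) l [.mark i e₂, .block i Λ, .mark i e] []
      [.mark j a₂, .mark j a, .block j (K⁻¹ * E * K), .block j E₂⁻¹] i K K⁻¹)
    rw [mul_inv_cancel] at s₅
    have s₆ := (BEqv.arr_one (!d) l [.mark i e₂, .block i Λ, .mark i e] []
      [.mark j a₂, .mark j a, .block j (K⁻¹ * E * K), .block j E₂⁻¹] i)
    have s₇ := (BEqv.arr_slide (!d) i e₂ e₂Λ (hl.conj e₂ Λ) (p := []) (p' := []) (q := [.mark i e])
      (q' := [.mark i e]) (z := [.mark j a₂, .mark j a, .block j (K⁻¹ * E * K), .block j E₂⁻¹])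
      (z' := [.mark j a₂, .mark j a, .block j (K⁻¹ * E * K), .block j E₂⁻¹]) rfl rfl
      (by simp only [Moves, List.map_cons, List.map_nil, BItem.mapBlock,
            nil_conjHom_of_central _ cΛ])).symm
    have s₈ := BEqv.arr_identify (!d) i hee hl.subst_right (p := [.block i Λ]) (p' := [.block i Λ])
      (q := []) (q' := []) (z := [.mark j a₂, .mark j a, .block j (K⁻¹ * E * K), .block j E₂⁻¹])
      (z' := [.mark j a₂, .mark j a, .block j (K⁻¹ * E * K), .block j E⁻¹])
      (by simp only [Moves, List.map_cons, List.map_nil, BItem.mapBlock, subst_avoiding _ e₂Λ]) rfl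
      (by simp only [Moves, List.map_cons, List.map_nil, BItem.mapBlock, map_inv, map_mul, hE, hE₂,
            subst_self, subst_of_ne hee, hK, map_commutatorElement, subst_avoiding _ ye₂,
            subst_avoiding _ e₂A])
    have s₉ := BEqv.arr_mul d l [.mark j a₂, .mark j a] []
      [.block i Λ, .mark i e₂, .mark i e] j (K⁻¹ * E * K) E⁻¹
    rw [eM'] at s₉
    simp only [arr_not] at s₃ s₄ s₅ s₆ s₇ s₈
    exact s₁.trans (s₂.trans (s₃.trans (s₄.trans (s₅.trans (s₆.trans (s₇.trans (s₈.trans s₉)))))))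
  -- In the other order, moving `e` back over `K` changes `E` into `M * E`; then `a` is moved back over `E`.
  have path₂ : BEqv (arr d l [.mark j a₂, .block j E, .mark j a, .block j E₂⁻¹]
        [.mark i e₂, .block i K, .mark i e, .block i ⁅A₂, y⁆⁻¹])
      (arr d l [.block j M, .mark j a₂, .mark j a] [.mark i e₂, .mark i e, .block i Λ]) := by
    have s₁ := BEqv.arr_slide (!d) i e eK (hl.conj e K) (p := [.mark i e₂])
      (p' := [.mark i e₂]) (q := [.block i ⁅A₂, y⁆⁻¹]) (q' := [.block i ⁅A₂, y⁆⁻¹])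
      (z := [.mark j a₂, .block j E, .mark j a, .block j E₂⁻¹])
      (z' := [.mark j a₂, .block j (K⁻¹ * E * K), .mark j a, .block j E₂⁻¹]) rfl
      (by simp only [Moves, List.map_cons, List.map_nil, BItem.mapBlock, map_inv,
            map_commutatorElement, conjHom_avoiding _ ye, hA₂, conjHom_of_ne hea₂.symm])
      (by simp only [Moves, List.map_cons, List.map_nil, BItem.mapBlock, map_inv, hE, hE₂,
            conjHom_self, conjHom_of_ne hee.symm])
    have s₂ := BEqv.arr_identify (!d) i hee hl.subst_right (p := []) (p' := [])
      (q := [.block i K, .block i ⁅A₂, y⁆⁻¹]) (q' := [.block i K, .block i ⁅A₂, y⁆⁻¹])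
      (z := [.mark j a₂, .block j (K⁻¹ * E * K), .mark j a, .block j E₂⁻¹])
      (z' := [.mark j a₂, .block j (K⁻¹ * E * K), .mark j a, .block j E⁻¹]) rfl
      (by simp only [Moves, List.map_cons, List.map_nil, BItem.mapBlock, map_inv,
            subst_avoiding _ ye₂, subst_avoiding _ e₂A, hA₂, subst_of_ne haa₂, hK,
            map_commutatorElement])
      (by simp only [Moves, List.map_cons, List.map_nil, BItem.mapBlock, map_inv, map_mul, hE,
            hE₂, subst_self, subst_of_ne hee, hK, map_commutatorElement, subst_avoiding _ ye₂,
            subst_avoiding _ e₂A])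
    rw [eM] at s₁ s₂
    have s₃ := (BEqv.arr_mul d l [.mark j a₂] [.mark j a, .block j E⁻¹]
      [.mark i e₂, .mark i e, .block i K, .block i ⁅A₂, y⁆⁻¹] j M E).symm
    have s₄ := BEqv.arr_slide d j a aE (hl.conj a E) (p := [.mark j a₂, .block j M])
      (p' := [.mark j a₂, .block j M]) (q := [.block j E⁻¹]) (q' := [.block j E⁻¹])
      (z := [.mark i e₂, .mark i e, .block i K, .block i ⁅A₂, y⁆⁻¹])
      (z' := [.mark i e₂, .mark i e, .block i ⁅E⁻¹ * A * E, y⁆, .block i ⁅A₂, y⁆⁻¹])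
      (by simp only [Moves, List.map_cons, List.map_nil, BItem.mapBlock, hM, nil_conjHom_comm])
      (by simp only [Moves, List.map_cons, List.map_nil, BItem.mapBlock, map_inv,
            conjHom_avoiding _ aE])
      (by simp only [Moves, List.map_cons, List.map_nil, BItem.mapBlock, map_commutatorElement,
            map_inv, hK, hA, hA₂, conjHom_self, conjHom_avoiding _ ya, conjHom_of_ne haa.symm])
    have s₅ := (BEqv.arr_mul d l [.mark j a₂, .block j M, .mark j a] []
      [.mark i e₂, .mark i e, .block i ⁅E⁻¹ * A * E, y⁆, .block i ⁅A₂, y⁆⁻¹] j E E⁻¹)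
    rw [mul_inv_cancel] at s₅
    have s₆ := (BEqv.arr_one d l [.mark j a₂, .block j M, .mark j a] []
      [.mark i e₂, .mark i e, .block i ⁅E⁻¹ * A * E, y⁆, .block i ⁅A₂, y⁆⁻¹] j)
    have s₇ := (BEqv.arr_slide d j a₂ a₂M (hl.conj a₂ M) (p := []) (p' := []) (q := [.mark j a])
      (q' := [.mark j a])
      (z := [.mark i e₂, .mark i e, .block i ⁅E⁻¹ * A * E, y⁆, .block i ⁅A₂, y⁆⁻¹])
      (z' := [.mark i e₂, .mark i e, .block i ⁅E⁻¹ * A * E, y⁆, .block i ⁅A₂, y⁆⁻¹]) rfl rfl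
      (by simp only [Moves, List.map_cons, List.map_nil, BItem.mapBlock,
            nil_conjHom_of_central _ cM])).symm
    have s₈ := BEqv.arr_identify d j haa hl.subst_left (p := [.block j M]) (p' := [.block j M])
      (q := []) (q' := [])
      (z := [.mark i e₂, .mark i e, .block i ⁅E⁻¹ * A * E, y⁆, .block i ⁅A₂, y⁆⁻¹])
      (z' := [.mark i e₂, .mark i e, .block i ⁅E⁻¹ * A * E, y⁆, .block i K⁻¹])
      (by simp only [Moves, List.map_cons, List.map_nil, BItem.mapBlock, subst_avoiding _ a₂M]) rfl
      (by simp only [Moves, List.map_cons, List.map_nil, BItem.mapBlock, map_inv, map_mul,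
            map_commutatorElement, hA₂, subst_self, hA, hE, subst_of_ne haa, subst_of_ne hea₂, hK,
            subst_avoiding _ ya₂])
    have s₉ := BEqv.arr_mul (!d) l [.mark i e₂, .mark i e] []
      [.block j M, .mark j a₂, .mark j a] i ⁅E⁻¹ * A * E, y⁆ K⁻¹
    have s₁₀ := BEqv.arr_cong (!d) (l := l) (z := [.mark i e₂, .mark i e,
        .block i (⁅E⁻¹ * A * E, y⁆ * K⁻¹)]) (y := [.mark i e₂, .mark i e, .block i Λ])
      (z' := [.block j M, .mark j a₂, .mark j a]) (y' := [.block j M, .mark j a₂, .mark j a])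
      (by simp only [List.map_cons, List.map_nil, BItem.mapBlock, map_mul, eΛ, map_inv,
            mul_inv_cancel_right]) rfl
    simp only [arr_not] at s₁ s₂ s₉ s₁₀
    exact s₁.trans (s₂.trans (s₃.trans (s₄.trans (s₅.trans (s₆.trans (s₇.trans (s₈.trans
      (s₉.trans s₁₀))))))))
  exact path₁.symm.trans path₂

end Square

/-! ### Exchanging a place before a block for a place after it -/

section Relations

variable {n : ℕ} {β β' : Type} [DecidableEq β] [DecidableEq β'] [Nonempty β] [Nonempty β']

/-- The strand of an item. -/
def BItem.strand {τ G : Type} : BItem n τ G → Fin n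
  | mark i _ => i
  | block i _ => i

theorem BEqv.swap (l₁ u v l₂ : List (BItem n β (FreeGroup β)))
    (h : ∀ x ∈ u, ∀ y ∈ v, x.strand ≠ y.strand) : BEqv (l₁ ++ u ++ v ++ l₂) (l₁ ++ v ++ u ++ l₂) := by
  have hs : ∀ (x : BItem n β (FreeGroup β)), ∀ y ∈ x.items, y.strand = x.strand := by
    intro x y hy
    cases x with
    | mark i b => rw [List.mem_singleton.1 hy]; rfl
    | block i g =>
      obtain ⟨p, -, rfl⟩ := List.mem_map.1 hy
      rfl
  simp only [BEqv, List.flatMap_append]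
  refine Eqv.swap _ _ _ _ fun x hx y hy => ?_
  obtain ⟨x', hx', hx⟩ := List.mem_flatMap.1 hx
  obtain ⟨y', hy', hy⟩ := List.mem_flatMap.1 hy
  rw [hs x' x hx, hs y' y hy]
  exact h x' hx' y' hy'

/-- A form of `BEqv.merge` for computations: `m` lists the markers of `Q`, so that `ht` is decidable. -/
theorem BEqv.merge_to {B : List (BItem n β (FreeGroup β))} {B' : List (BItem n β' (FreeGroup β'))}
    (Q : List (BItem n β' (FreeGroup β))) (g : β → β') (pre : β' → List β)
    (hpre : ∀ b', (pre b').Nodup ∧ ∀ b, b ∈ pre b' ↔ g b = b') (m : List β')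
    (hm : Q.filterMap BItem.marker? = m) (ht : ListsAll (m.flatMap pre) ∧ ListsAll m)
    (hB : Q.flatMap (BItem.expand pre) = B)
    (hB' : Q.map (BItem.mapBlock fun w => nil (FreeGroup.map g w)) = B'.map (BItem.mapBlock nil)) :
    BEqv B B' := by
  have h := BEqv.merge Q g pre hpre (by rw [hm]; exact iff_of_true ht.1 ht.2)
  rw [hB] at h
  refine h.trans (.of_cong ?_)
  rw [← hB', List.map_map]
  refine List.map_congr_left fun x _ => ?_
  cases x <;> rfl

end Relations

section Exchange

variable {n : ℕ}

/-- Generators of the free group on `Fin m`. -/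
abbrev gen {m : ℕ} (k : Fin m) : FreeGroup (Fin m) := FreeGroup.of k

theorem zpow_gen_mem_avoiding {m : ℕ} {k b : Fin m} (h : k ≠ b) (s : ℤ) : gen k ^ s ∈ avoiding b :=
  zpow_mem (of_mem_avoiding h) s

/-- The left-normed commutator of weight three. -/
abbrev comm₃ {G : Type*} [Group G] (x y z : G) : G := ⁅⁅x, y⁆, z⁆

/-- A tail whose place is before the block may be moved behind the block, if it is the last tail of a
commutator in which another tail has its place before the block. -/
theorem BEqv.exchange_before (i j : Fin n) (k : ℤ) (m : ℕ) :
    BEqv (β := Fin 3) (β' := Fin 3) [.block j (comm₃ (gen 2) (gen 0) (gen 0) ^ m), .mark j 2, .mark i 0,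
        .block i (comm₃ (gen 2 ^ k) (gen 0) (gen 0)), .mark i 1]
      [.block j (comm₃ (gen 2) (gen 0) (gen 0) ^ m), .mark j 2, .mark i 0,
        .block i (comm₃ (gen 2 ^ k) (gen 0) (gen 1)), .mark i 1] := by
  have sq := BEqv.square (i := i) (j := i) false (a := (0 : Fin 5)) (a₂ := 1) (e := 2) (e₂ := 3)
    (y := gen 4 ^ k)
    (l := [.block j (comm₃ (gen 4) (gen 2) (gen 2) ^ m), .mark j 4])
    ⟨fun b w => by
        simp only [Moves, List.map_cons, List.map_nil, BItem.mapBlock, map_pow, comm₃,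
          nil_conjHom_comm],
      by simp [Moves, BItem.mapBlock, subst, comm₃, map_commutatorElement],
      by simp [Moves, BItem.mapBlock, subst, comm₃, map_commutatorElement]⟩
    (zpow_gen_mem_avoiding (by decide) k) (zpow_gen_mem_avoiding (by decide) k)
    (zpow_gen_mem_avoiding (by decide) k) (zpow_gen_mem_avoiding (by decide) k)
    (by decide) (by decide) (by decide) (by decide) (by decide) (by decide)
  have h₁ : BEqv (β := Fin 5) (β' := Fin 3) _
      [.block j (comm₃ (gen 2) (gen 0) (gen 0) ^ m), .mark j 2, .block i 1, .mark i 0,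
      .block i (comm₃ (gen 2 ^ k) (gen 0) (gen 0)), .mark i 1] :=
    BEqv.merge_to (β := Fin 5) [.block j (comm₃ (gen 4) (gen 2) (gen 2) ^ m), .mark j 2,
      .block i (comm₃ (gen 0) (gen 2) (gen 4 ^ k)), .mark i 0,
      .block i (comm₃ (gen 4 ^ k) (gen 0) (gen 2)), .mark i 1]
      ![0, 0, 0, 0, 2] ![[3, 2, 1, 0], [], [4]] (by decide) [2, 0, 1] rfl (by decide) rfl (by
        simp [BItem.mapBlock, comm₃, map_commutatorElement])
  have h₂ : BEqv (β := Fin 5) (β' := Fin 3) _ [.block j (comm₃ (gen 2) (gen 0) (gen 0) ^ m), .mark j 2, .mark i 0,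
      .block i (comm₃ (gen 1) (gen 0) (gen 2 ^ k)), .block i (comm₃ (gen 2 ^ k) (gen 1) (gen 0)),
      .mark i 1] :=
    BEqv.merge_to (β := Fin 5) [.block j (comm₃ (gen 4) (gen 2) (gen 2) ^ m), .mark j 2, .mark i 0,
      .block i (comm₃ (gen 0) (gen 2) (gen 4 ^ k)), .block i (comm₃ (gen 4 ^ k) (gen 0) (gen 2)), .mark i 1]
      ![1, 1, 0, 0, 2] ![[3, 2], [1, 0], [4]] (by decide) [2, 0, 1] rfl (by decide) rfl (by
        simp [BItem.mapBlock, comm₃, map_commutatorElement])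
  have h₃ := BEqv.block_one (β := Fin 3) [.block j (comm₃ (gen 2) (gen 0) (gen 0) ^ m), .mark j 2]
    [.mark i 0, .block i (comm₃ (gen 2 ^ k) (gen 0) (gen 0)), .mark i 1] i
  have h₄ := BEqv.block_mul (β := Fin 3) [.block j (comm₃ (gen 2) (gen 0) (gen 0) ^ m), .mark j 2, .mark i 0]
    [.mark i 1] i (comm₃ (gen 1) (gen 0) (gen 2 ^ k)) (comm₃ (gen 2 ^ k) (gen 1) (gen 0))
  refine h₃.symm.trans (h₁.symm.trans (sq.trans (h₂.trans (h₄.trans (.of_cong ?_)))))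
  -- by the Jacobi identity, the two blocks have the product `⁅⁅2 ^ k, 0⁆, 1⁆`
  have e := congrArg cen (tri_sum (nil (gen (1 : Fin 3))) (nil (gen 0)) (nil (gen 2 ^ k)))
  rw [cen_add] at e
  simp only [List.map_append, List.map_cons, List.map_nil, BItem.mapBlock, map_mul, comm₃, nil_comm, e]
  rfl

/-- A tail whose place is before the block may be moved behind the block, if it is the last tail of a
commutator in which another tail has its place behind the block. -/
theorem BEqv.exchange_behind (i j : Fin n) (k : ℤ) :
    BEqv (β := Fin 3) (β' := Fin 3)
      [.mark j 2, .mark i 0, .block i (comm₃ (gen 2 ^ k) (gen 1) (gen 0)), .mark i 1]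
      [.mark j 2, .mark i 0, .block i (comm₃ (gen 2 ^ k) (gen 1) (gen 1)), .mark i 1] := by
  have sq := BEqv.square (i := i) (j := i) true (a := (0 : Fin 5)) (a₂ := 1) (e := 2) (e₂ := 3)
    (y := gen 4 ^ k) (l := [.mark j 4]) ⟨fun b w => rfl, rfl, rfl⟩
    (zpow_gen_mem_avoiding (by decide) k) (zpow_gen_mem_avoiding (by decide) k)
    (zpow_gen_mem_avoiding (by decide) k) (zpow_gen_mem_avoiding (by decide) k)
    (by decide) (by decide) (by decide) (by decide) (by decide) (by decide)
  have h₁ : BEqv (β := Fin 5) (β' := Fin 3) _ [.mark j 2, .mark i 0, .block i (comm₃ (gen 2 ^ k) (gen 0) (gen 1)),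
      .block i (comm₃ (gen 0) (gen 1) (gen 2 ^ k)), .mark i 1] :=
    BEqv.merge_to (β := Fin 5) [.mark j 2, .mark i 0, .block i (comm₃ (gen 4 ^ k) (gen 0) (gen 2)),
      .block i (comm₃ (gen 0) (gen 2) (gen 4 ^ k)), .mark i 1]
      ![0, 0, 1, 1, 2] ![[1, 0], [3, 2], [4]] (by decide) [2, 0, 1] rfl (by decide) rfl (by
        simp [BItem.mapBlock, comm₃, map_commutatorElement])
  have h₂ : BEqv (β := Fin 5) (β' := Fin 3) _ [.mark j 2, .mark i 0, .block i (comm₃ (gen 2 ^ k) (gen 1) (gen 1)),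
      .mark i (1 : Fin 3), .block i 1] :=
    BEqv.merge_to (β := Fin 5) [.mark j 2, .mark i 0, .block i (comm₃ (gen 4 ^ k) (gen 0) (gen 2)), .mark i 1,
      .block i (comm₃ (gen 0) (gen 2) (gen 4 ^ k))]
      ![1, 1, 1, 1, 2] ![[], [1, 0, 3, 2], [4]] (by decide) [2, 0, 1] rfl (by decide) rfl (by
        simp [BItem.mapBlock, comm₃, map_commutatorElement])
  have h₃ := BEqv.block_one (β := Fin 3) [.mark j 2, .mark i 0, .block i (comm₃ (gen 2 ^ k) (gen 1) (gen 1)),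
      .mark i 1] [] i
  have h₄ := BEqv.block_mul (β := Fin 3) [.mark j 2, .mark i 0] [.mark i 1] i
    (comm₃ (gen 2 ^ k) (gen 0) (gen 1)) (comm₃ (gen 0) (gen 1) (gen 2 ^ k))
  refine BEqv.trans (.of_cong ?_) (h₄.symm.trans (h₁.symm.trans (sq.trans (h₂.trans h₃))))
  -- by the Jacobi identity, the two blocks have the product `⁅⁅2 ^ k, 1⁆, 0⁆`
  have e := congrArg cen (tri_sum (nil (gen (0 : Fin 3))) (nil (gen 1)) (nil (gen 2 ^ k)))
  rw [add_comm, cen_add] at e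
  simp only [List.map_append, List.map_cons, List.map_nil, BItem.mapBlock, map_mul, comm₃, nil_comm, e]
  rfl

/-- The relation between pairs of blocks on two strands: the square relation is applied to places on both
strands, and `BEqv.exchange_before` is used to move one tail back. -/
theorem BEqv.exchange_strands {i j : Fin n} (hij : i ≠ j) :
    BEqv (β := Fin 4) (β' := Fin 3)
      [.mark i 2, .mark j 0, .block j (comm₃ (gen 0) (gen 2) (gen 2)), .mark j 1,
        .block i (comm₃ (gen 3) (gen 1) (gen 2)), .mark i 3]
      [.block j (comm₃ (gen 2) (gen 0) (gen 0)), .mark j 2, .mark i 0,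
        .block i (comm₃ (gen 0) (gen 2) (gen 1)), .mark i 1] := by
  have sq := BEqv.square (i := i) (j := j) true (a := (0 : Fin 5)) (a₂ := 1) (e := 2) (e₂ := 3)
    (y := gen 4 ^ (-1 : ℤ)) (l := [.mark i 4]) ⟨fun b w => rfl, rfl, rfl⟩
    (zpow_gen_mem_avoiding (by decide) _) (zpow_gen_mem_avoiding (by decide) _)
    (zpow_gen_mem_avoiding (by decide) _) (zpow_gen_mem_avoiding (by decide) _)
    (by decide) (by decide) (by decide) (by decide) (by decide) (by decide)
  have h₁ : BEqv (β := Fin 5) (β' := Fin 4)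
      [.mark i 4, .mark i 3, .mark j 1, .block j (comm₃ (gen 1) (gen 4) (gen 3)), .mark j 0,
      .block i (comm₃ (gen 2) (gen 0) (gen 4)), .mark i 2] [.mark i 2, .mark j 0,
        .block j (comm₃ (gen 0) (gen 2) (gen 2)), .mark j 1,
        .block i (comm₃ (gen 3) (gen 1) (gen 2)), .mark i 3] :=
    BEqv.merge_to (β := Fin 5) [.mark i 2, .mark j 0, .block j (comm₃ (gen 1) (gen 4) (gen 3)), .mark j 1,
      .block i (comm₃ (gen 2) (gen 0) (gen 4)), .mark i 3]
      ![1, 0, 3, 2, 2] ![[1], [0], [4, 3], [2]] (by decide) [2, 0, 1, 3] rfl (by decide) rfl (by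
        simp [BItem.mapBlock, comm₃, map_commutatorElement])
  -- the left-hand side is split into the places `0`, `1` on `j` and `2`, `3`, `4` on `i`, which are then
  -- arranged as in the square relation
  have h₂ := BEqv.swap (β := Fin 5) [.mark i 4] [.mark i 3]
    [.mark j 1, .block j (comm₃ (gen 1) (gen 4) (gen 3)), .mark j 0]
    [.block i (comm₃ (gen 2) (gen 0) (gen 4)), .mark i 2] (by simp [BItem.strand, hij])
  have mem : ∀ {b x y z : Fin 5}, x ≠ b → y ≠ b → z ≠ b → (comm₃ (gen x) (gen y) (gen z)) ∈ avoiding b := by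
    intro b x y z hx hy hz
    have := @of_mem_avoiding (Fin 5) b
    have comm_mem : ∀ {g h : FreeGroup (Fin 5)}, g ∈ avoiding b → h ∈ avoiding b →
        ⁅g, h⁆ ∈ avoiding b := fun hg hh =>
      mul_mem (mul_mem (mul_mem hg hh) (inv_mem hg)) (inv_mem hh)
    exact comm_mem (comm_mem (this hx) (this hy)) (this hz)
  have h₃ := BEqv.arr_slide true j (0 : Fin 5) (w := (comm₃ (gen 1) (gen 4) (gen 3)))
    (mem (by decide) (by decide) (by decide)) (l := [.mark i 4]) (l' := [.mark i 4])
    (p := [.mark j 1]) (p' := [.mark j 1]) (q := []) (q' := [])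
    (z := [.mark i 3, .block i (comm₃ (gen 2) (gen 0) (gen 4)), .mark i 2])
    (z' := [.mark i 3, .block i (comm₃ (gen 2) (gen 0) (gen 4)), .mark i 2]) rfl rfl rfl
    (by simp only [Moves, List.map_cons, List.map_nil, BItem.mapBlock, comm₃,
          nil_conjHom_comm])
  have h₄ := (BEqv.arr_slide false i (3 : Fin 5) (w := (comm₃ (gen 2) (gen 0) (gen 4)))
    (mem (by decide) (by decide) (by decide)) (l := [.mark i 4]) (l' := [.mark i 4])
    (p := []) (p' := []) (q := [.mark i 2]) (q' := [.mark i 2])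
    (z := [.mark j 1, .mark j 0, .block j (comm₃ (gen 1) (gen 4) (gen 3))])
    (z' := [.mark j 1, .mark j 0, .block j (comm₃ (gen 1) (gen 4) (gen 3))]) rfl rfl rfl
    (by simp only [Moves, List.map_cons, List.map_nil, BItem.mapBlock, comm₃,
          nil_conjHom_comm])).symm
  have h₅ := BEqv.arr_identify true j (a := (0 : Fin 5)) (b := 1) (by decide)
    (l := [.mark i 4]) (l' := [.mark i 4]) (p := []) (p' := [])
    (q := [.block j (comm₃ (gen 1) (gen 4) (gen 3))]) (q' := [.block j (comm₃ (gen 0) (gen 4) (gen 3))])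
    (z := [.block i (comm₃ (gen 2) (gen 0) (gen 4)), .mark i 3, .mark i 2])
    (z' := [.block i (comm₃ (gen 2) (gen 0) (gen 4)), .mark i 3, .mark i 2]) rfl rfl
    (by simp [Moves, BItem.mapBlock, subst, comm₃, map_commutatorElement])
    (by simp [Moves, BItem.mapBlock, subst, comm₃, map_commutatorElement])
  have h₆ := BEqv.arr_identify false i (a := (2 : Fin 5)) (b := 3) (by decide)
    (l := [.mark i 4]) (l' := [.mark i 4]) (p := [.block i (comm₃ (gen 2) (gen 0) (gen 4))])
    (p' := [.block i (comm₃ (gen 0) (gen 2) (gen 4 ^ (-1 : ℤ)))]) (q := []) (q' := [])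
    (z := [.mark j 1, .mark j 0, .block j (comm₃ (gen 0) (gen 4) (gen 3))])
    (z' := [.mark j 1, .mark j 0, .block j (comm₃ (gen 4 ^ (-1 : ℤ)) (gen 0) (gen 2))]) rfl
    (by
      simp only [Moves, List.map_cons, List.map_nil, BItem.mapBlock, subst, comm₃, map_commutatorElement,
        FreeGroup.map.of, zpow_neg_one, map_inv]
      simpa using comm_swap_inv_right _ _ _)
    rfl
    (by
      simp only [Moves, List.map_cons, List.map_nil, BItem.mapBlock, subst, comm₃, map_commutatorElement,
        FreeGroup.map.of, zpow_neg_one, map_inv]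
      simpa using comm_swap_inv_left _ _ _)
  have h₇ := BEqv.swap (β := Fin 5) [] [.mark i 4]
    [.block j (comm₃ (gen 4 ^ (-1 : ℤ)) (gen 0) (gen 2)), .mark j 1, .mark j 0]
    [.mark i 3, .mark i 2, .block i (comm₃ (gen 0) (gen 2) (gen 4 ^ (-1 : ℤ)))]
    (by simp [BItem.strand, hij])
  have h₈ : BEqv (β := Fin 5) (β' := Fin 3) _ [.block j (comm₃ (gen 2) (gen 0) (gen 0) ^ 1), .mark j 2, .mark i 0,
        .block i (comm₃ (gen 2 ^ (-1 : ℤ)) (gen 0) (gen 0)), .mark i 1] :=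
    BEqv.merge_to (β := Fin 5) [.block j (comm₃ (gen 4 ^ (-1 : ℤ)) (gen 0) (gen 2)), .mark j 2, .mark i 0,
      .block i (comm₃ (gen 0) (gen 2) (gen 4 ^ (-1 : ℤ))), .mark i 1]
      ![2, 2, 0, 0, 0] ![[4, 3, 2], [], [1, 0]] (by decide) [2, 0, 1] rfl (by decide) rfl (by
        simp only [List.map_cons, List.map_nil, BItem.mapBlock, comm₃, map_commutatorElement,
          FreeGroup.map.of, zpow_neg_one, map_inv]
        simpa using ⟨(comm_swap_inv_left _ _ _).symm, (comm_inv_left _ _ _).symm⟩)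
  have h₉ := BEqv.exchange_before i j (-1) 1
  refine h₁.symm.trans (h₂.trans (h₃.trans (h₄.trans (h₅.trans (h₆.trans (sq.trans (h₇.trans
    (h₈.trans (h₉.trans (.of_cong ?_))))))))))
  simp only [List.map_cons, List.map_nil, BItem.mapBlock, comm₃, map_commutatorElement, pow_one,
    zpow_neg_one, map_inv]
  simpa using (comm_swap_inv_left _ _ _).symm

end Exchange

/-! ### Surgery along trees for the trivial diagram -/

section Trees

variable {n k : ℕ} {β : Type} [DecidableEq β] [Nonempty β]

/-- The endpoints of the tree `T` for the trivial diagram are, in an order that is compatible with the one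
on every strand, the tails in `A₁`, the head on the strand `i`, and the tails in `A₂`. -/
def Placed (T : WTreeFor (Diagram.trivial n) k) (A₁ : List (Fin n × Fin k)) (i : Fin n)
    (A₂ : List (Fin n × Fin k)) : Prop :=
  T.place.strand = fun j => (strandOf (A₁.map (Prod.map id some) ++ [(i, none)]
    ++ A₂.map (Prod.map id some)) j).map Sum.inr

/-- A block with value `g` between places of tails. -/
def around (A₁ : List (Fin n × β)) (i : Fin n) (g : FreeGroup β) (A₂ : List (Fin n × β)) :
    List (BItem n β (FreeGroup β)) :=
  A₁.map (fun p => .mark p.1 p.2) ++ [.block i g] ++ A₂.map (fun p => .mark p.1 p.2)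

theorem Eqv.heads_block (i : Fin n) (w : List (β × ℤˣ)) (l₁ l₂ : List (Item n β β)) :
    Eqv (l₁ ++ heads i w ++ l₂)
      (l₁ ++ (BItem.block i (groupWord w) : BItem n β (FreeGroup β)).items ++ l₂) := by
  rw [heads_eq_wordHeads, BItem.items_block]
  exact Eqv.red i l₁ l₂ FreeGroup.mk_toWord.symm

omit [Nonempty β] in
theorem items_around (A₁ : List (Fin n × β)) (i : Fin n) (g : FreeGroup β) (A₂ : List (Fin n × β)) :
    (around A₁ i g A₂).flatMap BItem.items = A₁.map (fun p => .tail p.1 p.2)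
      ++ (BItem.block i g : BItem n β (FreeGroup β)).items ++ A₂.map (fun p => .tail p.1 p.2) := by
  have : ∀ A : List (Fin n × β), (A.map fun p => (BItem.mark p.1 p.2 : BItem n β (FreeGroup β))).flatMap
      BItem.items = A.map fun p => .tail p.1 p.2 := by
    intro A
    rw [List.flatMap_map]
    exact List.map_eq_flatMap.symm
  rw [around, List.flatMap_append, List.flatMap_append, this, this]
  simp

theorem eqv_treeItems [Nonempty (Fin k)] (t : WTree (Fin k)) (A₁ A₂ : List (Fin n × Fin k))
    (i : Fin n) : Eqv (treeItems A₁ i t A₂) ((around A₁ i (treeValue t) A₂).flatMap BItem.items) := by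
  rw [items_around, ← groupWord_word, treeItems]
  exact Eqv.heads_block i t.word _ _

omit [DecidableEq β] [Nonempty β] in
theorem tailsOf_places (A : List (Fin n × β)) :
    tailsOf (A.map fun p => (Item.tail p.1 p.2 : Item n β β)) = A.map Prod.snd := by
  induction A with
  | nil => rfl
  | cons p A ih => exact congrArg (p.2 :: ·) ih

theorem tailsOf_treeItems (t : WTree (Fin k)) (A₁ A₂ : List (Fin n × Fin k)) (i : Fin n) :
    tailsOf (treeItems A₁ i t A₂) = A₁.map Prod.snd ++ A₂.map Prod.snd := by
  rw [treeItems, tailsOf_append, tailsOf_append, tailsOf_heads, tailsOf_places, tailsOf_places,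
    List.append_nil]

omit [DecidableEq β] [Nonempty β] in
theorem nil_map_congr {β' : Type} (f : β → β') {g h : FreeGroup β} (hgh : nil g = nil h) :
    nil (FreeGroup.map f g) = nil (FreeGroup.map f h) := by
  refine QuotientGroup.eq.2 ?_
  rw [← map_inv, ← map_mul]
  have := Subgroup.mem_map_of_mem (FreeGroup.map f) (QuotientGroup.eq.1 hgh)
  rw [Subgroup.map_lowerCentralSeries] at this
  exact Subgroup.lowerCentralSeries_mono 3 le_top this

theorem beqv_around (A₁ A₂ : List (Fin n × β)) (i : Fin n) {g h : FreeGroup β} (hgh : nil g = nil h) :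
    BEqv (around A₁ i g A₂) (around A₁ i h A₂) :=
  .of_cong (by simp only [around, List.map_append, List.map_cons, List.map_nil, BItem.mapBlock, hgh])

/-- Trees with equivalent expansions have `w_4`-equivalent surgeries. -/
theorem wkEquiv_of_beqv [Nonempty (Fin k)] {T T' : WTreeFor (Diagram.trivial n) k}
    {A₁ A₂ A₁' A₂' : List (Fin n × Fin k)} {i i' : Fin n} (hT : Placed T A₁ i A₂)
    (hT' : Placed T' A₁' i' A₂') (hA : ListsAll (A₁.map Prod.snd ++ A₂.map Prod.snd))
    {g g' : FreeGroup (Fin k)} (hg : nil (treeValue T.tree) = nil g)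
    (hg' : nil (treeValue T'.tree) = nil g') (h : BEqv (around A₁ i g A₂) (around A₁' i' g' A₂')) :
    WkEquiv 4 T.link T'.link :=
  Eqv.wkEquiv ((eqv_treeItems T.tree A₁ A₂ i).trans (Eqv.trans ((beqv_around A₁ A₂ i hg).trans
      (h.trans (beqv_around A₁' A₂' i' hg').symm)) (eqv_treeItems T'.tree A₁' A₂' i').symm))
    (by rw [tailsOf_treeItems]; exact hA) (realizes_trivial T A₁ A₂ i hT)
    (realizes_trivial T' A₁' A₂' i' hT')

/-- The product of two diagrams with one block each, on disjoint sets of markers. -/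
def aroundMul (A₁ : List (Fin n × Fin k)) (i : Fin n) (g : FreeGroup (Fin k))
    (A₂ B₁ : List (Fin n × Fin k)) (j : Fin n) (h : FreeGroup (Fin k)) (B₂ : List (Fin n × Fin k)) :
    List (BItem n (Fin k ⊕ Fin k) (FreeGroup (Fin k ⊕ Fin k))) :=
  around (A₁.map (Prod.map id .inl)) i (FreeGroup.map .inl g) (A₂.map (Prod.map id .inl))
    ++ around (B₁.map (Prod.map id .inr)) j (FreeGroup.map .inr h)
      (B₂.map (Prod.map id .inr))

omit [DecidableEq β] [Nonempty β] in
theorem map_treeItems (f : Fin k → β) (t : WTree (Fin k)) (A₁ A₂ : List (Fin n × Fin k)) (i : Fin n) :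
    (treeItems A₁ i t A₂).map (Item.bimap f f) = (A₁.map (Prod.map id f)).map (fun p => .tail p.1 p.2)
      ++ heads i (t.word.map (Prod.map f id))
      ++ (A₂.map (Prod.map id f)).map (fun p => .tail p.1 p.2) := by
  simp [treeItems, heads, Item.bimap, Function.comp_def]

omit [DecidableEq β] [Nonempty β] in
theorem groupWord_map (f : Fin k → β) (w : List (Fin k × ℤˣ)) :
    groupWord (w.map (Prod.map f id)) = FreeGroup.map f (groupWord w) := by
  rw [groupWord, groupWord, FreeGroup.map.mk]
  simp [Function.comp_def]

theorem eqv_treeItems_mul [Nonempty (Fin k)] (t u : WTree (Fin k)) (A₁ A₂ B₁ B₂ : List (Fin n × Fin k))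
    (i j : Fin n) :
    Eqv ((treeItems A₁ i t A₂).map (Item.bimap (Sum.inl : _ → Fin k ⊕ Fin k) Sum.inl)
        ++ (treeItems B₁ j u B₂).map (Item.bimap Sum.inr Sum.inr))
      ((aroundMul A₁ i (treeValue t) A₂ B₁ j (treeValue u) B₂).flatMap BItem.items) := by
  have : Nonempty (Fin k ⊕ Fin k) := ⟨.inl (Classical.arbitrary _)⟩
  rw [map_treeItems, map_treeItems, aroundMul, List.flatMap_append, items_around, items_around,
    ← groupWord_word, ← groupWord_word, ← groupWord_map, ← groupWord_map]
  have h₁ := Eqv.heads_block i (t.word.map (Prod.map (Sum.inl : _ → Fin k ⊕ Fin k) id))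
    ((A₁.map (Prod.map id Sum.inl)).map fun p => .tail p.1 p.2)
    ((A₂.map (Prod.map id Sum.inl)).map (fun p => .tail p.1 p.2)
      ++ ((B₁.map (Prod.map id Sum.inr)).map (fun p => .tail p.1 p.2)
        ++ heads j (u.word.map (Prod.map Sum.inr id))
        ++ (B₂.map (Prod.map id Sum.inr)).map fun p => .tail p.1 p.2))
  have h₂ := Eqv.heads_block j (u.word.map (Prod.map (Sum.inr : _ → Fin k ⊕ Fin k) id))
    ((A₁.map (Prod.map id Sum.inl)).map (fun p => .tail p.1 p.2)
      ++ (BItem.block i (groupWord (t.word.map (Prod.map Sum.inl id))) :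
        BItem n (Fin k ⊕ Fin k) (FreeGroup (Fin k ⊕ Fin k))).items
      ++ (A₂.map (Prod.map id Sum.inl)).map (fun p => .tail p.1 p.2)
      ++ (B₁.map (Prod.map id Sum.inr)).map fun p => .tail p.1 p.2)
    ((B₂.map (Prod.map id Sum.inr)).map fun p => .tail p.1 p.2)
  simp only [List.append_assoc] at h₁ h₂ ⊢
  exact h₁.trans h₂

theorem beqv_aroundMul [Nonempty (Fin k)] (A₁ A₂ B₁ B₂ : List (Fin n × Fin k)) (i j : Fin n)
    {f f' g g' : FreeGroup (Fin k)} (hf : nil f = nil f') (hg : nil g = nil g') :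
    BEqv (aroundMul A₁ i f A₂ B₁ j g B₂) (aroundMul A₁ i f' A₂ B₁ j g' B₂) := by
  have : Nonempty (Fin k ⊕ Fin k) := ⟨.inl (Classical.arbitrary _)⟩
  refine .of_cong ?_
  simp only [aroundMul, around, List.map_append, List.map_cons, List.map_nil, BItem.mapBlock,
    nil_map_congr _ hf, nil_map_congr _ hg]

/-- Products of trees with equivalent expansions have `w_4`-equivalent surgeries. -/
theorem wkEquiv_mul_of_beqv [Nonempty (Fin k)] {T U T' U' : WTreeFor (Diagram.trivial n) k}
    {A₁ A₂ B₁ B₂ A₁' A₂' B₁' B₂' : List (Fin n × Fin k)} {i j i' j' : Fin n}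
    (hT : Placed T A₁ i A₂) (hU : Placed U B₁ j B₂) (hT' : Placed T' A₁' i' A₂')
    (hU' : Placed U' B₁' j' B₂')
    (hA : ListsAll ((A₁.map Prod.snd ++ A₂.map Prod.snd).map Sum.inl
      ++ (B₁.map Prod.snd ++ B₂.map Prod.snd).map Sum.inr))
    {f g f' g' : FreeGroup (Fin k)} (hf : nil (treeValue T.tree) = nil f)
    (hg : nil (treeValue U.tree) = nil g) (hf' : nil (treeValue T'.tree) = nil f')
    (hg' : nil (treeValue U'.tree) = nil g')
    (h : BEqv (aroundMul A₁ i f A₂ B₁ j g B₂) (aroundMul A₁' i' f' A₂' B₁' j' g' B₂')) :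
    WkEquiv 4 (T.link * U.link) (T'.link * U'.link) :=
  Eqv.wkEquiv (D := T.surgery.mul U.surgery) (D' := T'.surgery.mul U'.surgery)
    ((eqv_treeItems_mul T.tree U.tree A₁ A₂ B₁ B₂ i j).trans
      (Eqv.trans ((beqv_aroundMul _ _ _ _ _ _ hf hg).trans
        (h.trans (beqv_aroundMul _ _ _ _ _ _ hf' hg').symm))
        (eqv_treeItems_mul T'.tree U'.tree A₁' A₂' B₁' B₂' i' j').symm))
    (by rw [tailsOf_append, tailsOf_bimap, tailsOf_bimap, tailsOf_treeItems, tailsOf_treeItems]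
        exact hA)
    ((realizes_trivial T A₁ A₂ i hT).mul (realizes_trivial U B₁ B₂ j hU))
    ((realizes_trivial T' A₁' A₂' i' hT').mul (realizes_trivial U' B₁' B₂' j' hU'))

end Trees

section Relations

variable {n : ℕ}

/-- The derived equality test of a sum is lawful, so that membership in lists over it is decidable. -/
instance {α α' : Type} [BEq α] [BEq α'] [LawfulBEq α] [LawfulBEq α'] : LawfulBEq (α ⊕ α') where
  rfl {a} := by cases a <;> simp [BEq.beq, Sum.instBEq.beq]
  eq_of_beq {a b} h := by cases a <;> cases b <;> simp_all [BEq.beq, Sum.instBEq.beq]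

open WTree in
theorem nil_treeValue_left {β : Type} (a b c : β) :
    nil (treeValue (node (node (leaf a) (leaf b)) (leaf c)))
      = nil (comm₃ (FreeGroup.of a) (FreeGroup.of b) (FreeGroup.of c)) := by
  simp only [treeValue, comm₃, map_commutatorElement, map_inv]
  rw [← cen_tri, ← cen_tri, tri_inv_right, tri_inv_mid, neg_neg]

open WTree in
theorem nil_treeValue_right {β : Type} (a b c : β) :
    nil (treeValue (node (leaf b) (node (leaf a) (leaf c))))
      = nil (comm₃ (FreeGroup.of c) (FreeGroup.of a) (FreeGroup.of b)) := by
  simp only [treeValue, comm₃, map_commutatorElement, map_inv, commutatorElement_inv]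
  rw [← commutatorElement_inv ⁅(nil (FreeGroup.of c))⁻¹, _⁆, ← cen_tri, ← cen_tri, ← cen_neg,
    tri_inv_left, neg_neg]

theorem nil_treeValue_bead {β : Type} {t : WTree β} {a b c : FreeGroup β}
    (h : nil (treeValue t) = nil (comm₃ a b c)) :
    nil (treeValue (.bead t)) = nil (comm₃ b a c) := by
  rw [treeValue, map_inv, h, nil_comm, nil_comm, ← cen_neg, ← tri_swap]

/-- The relation for the pairs `treeTO₁`, `treeTO₂` and `treeOT₁`, `treeOT₂`: the tail `1` moves from before
the head to the place behind it. -/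
theorem beqv_before (i j : Fin n) :
    BEqv (around [(j, 2), (i, 0), (i, 1)] i (comm₃ (gen 2) (gen 0) (gen (1 : Fin 3))) [])
      (around [(j, 2), (i, 0)] i (comm₃ (gen 2) (gen 0) (gen 1)) [(i, (1 : Fin 3))]) := by
  have h₁ : BEqv (β' := Fin 3)
      (around [(j, 2), (i, 0), (i, 1)] i (comm₃ (gen 2) (gen 0) (gen (1 : Fin 3))) [])
      [.mark j 2, .mark i 0, .block i (comm₃ (gen 2) (gen 0) (gen 0)), .mark i 1] :=
    BEqv.merge_to [.mark j 2, .mark i 0, .block i (comm₃ (gen 2) (gen 0) (gen 1)), .mark i 1]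
      ![0, 0, 2] ![[0, 1], [], [2]] (by decide) [2, 0, 1] rfl (by decide) rfl (by
        simp [BItem.mapBlock, comm₃, map_commutatorElement])
  have h₂ := BEqv.exchange_before i j 1 0
  simp only [pow_zero, zpow_one] at h₂
  have h₃ := BEqv.block_one (β := Fin 3) []
    [.mark j 2, .mark i 0, .block i (comm₃ (gen 2) (gen 0) (gen 0)), .mark i 1] j
  have h₄ := BEqv.block_one (β := Fin 3) []
    [.mark j 2, .mark i 0, .block i (comm₃ (gen 2) (gen 0) (gen 1)), .mark i 1] j
  exact h₁.trans (h₃.symm.trans (h₂.trans h₄))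

/-- The relation for the pairs `treeTO₃`, `treeTO₄` and `treeOT₃`, `treeOT₄`: the tail `0` moves from before
the head to the place behind it. -/
theorem beqv_behind (i j : Fin n) :
    BEqv (around [(j, 2), (i, 0)] i (comm₃ (gen 1) (gen 2) (gen 0)) [(i, (1 : Fin 3))])
      (around [(j, 2)] i (comm₃ (gen 1) (gen 2) (gen 0)) [(i, 0), (i, (1 : Fin 3))]) := by
  have h₁ : BEqv (β' := Fin 3)
      (around [(j, 2)] i (comm₃ (gen 1) (gen 2) (gen 0)) [(i, 0), (i, (1 : Fin 3))])
      [.mark j 2, .mark i 0, .block i (comm₃ (gen 1) (gen 2) (gen 1)), .mark i 1] :=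
    BEqv.merge_to [.mark j 2, .mark i 0, .block i (comm₃ (gen 1) (gen 2) (gen 0)), .mark i 1]
      ![1, 1, 2] ![[], [0, 1], [2]] (by decide) [2, 0, 1] rfl (by decide) rfl (by
        simp [BItem.mapBlock, comm₃, map_commutatorElement])
  have e : ∀ x : FreeGroup (Fin 3), nil (comm₃ (gen 2 ^ (-1 : ℤ)) (gen 1) x)
      = nil (comm₃ (gen 1) (gen 2) x) := by
    intro x
    simp only [comm₃, map_commutatorElement, zpow_neg_one, map_inv]
    exact (comm_swap_inv_left _ _ _).symm
  refine BEqv.trans (.of_cong ?_) ((BEqv.exchange_behind i j (-1)).trans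
    (BEqv.trans (.of_cong ?_) h₁.symm))
  · simp only [around, List.map_append, List.map_cons, List.map_nil, BItem.mapBlock, e]
    rfl
  · simp only [List.map_cons, List.map_nil, BItem.mapBlock, e]

/-- The relation for the pair `treeF`, `treeF'`. Here all endpoints are on one strand, and the places
`2` and `0` of `BEqv.exchange_behind` are united. -/
theorem beqv_one_strand (i : Fin n) :
    BEqv (around [(i, 0)] i (comm₃ (gen 0) (gen 2) (gen 1)) [(i, 1), (i, (2 : Fin 3))])
      (around [(i, 0), (i, 1)] i (comm₃ (gen 0) (gen 2) (gen 1)) [(i, (2 : Fin 3))]) := by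
  have h₁ : BEqv (β' := Fin 2)
      (around [(i, 0)] i (comm₃ (gen 0) (gen 2) (gen 1)) [(i, 1), (i, (2 : Fin 3))])
      [.mark i 0, .block i (comm₃ (gen 0) (gen 1) (gen 1)), .mark i 1] :=
    BEqv.merge_to [.mark i 0, .block i (comm₃ (gen 0) (gen 2) (gen 1)), .mark i 1]
      ![0, 1, 1] ![[0], [1, 2]] (by decide) [0, 1] rfl (by decide) rfl (by
        simp [BItem.mapBlock, comm₃, map_commutatorElement])
  have h₂ : BEqv (β' := Fin 2)
      (around [(i, 0), (i, 1)] i (comm₃ (gen 0) (gen 2) (gen 1)) [(i, (2 : Fin 3))])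
      [.mark i 0, .block i (comm₃ (gen 0) (gen 1) (gen 0)), .mark i 1] :=
    BEqv.merge_to [.mark i 0, .block i (comm₃ (gen 0) (gen 2) (gen 1)), .mark i 1]
      ![0, 0, 1] ![[0, 1], [2]] (by decide) [0, 1] rfl (by decide) rfl (by
        simp [BItem.mapBlock, comm₃, map_commutatorElement])
  have h₃ : BEqv (β := Fin 3) (β' := Fin 2) [.mark i 2, .mark i 0,
        .block i (comm₃ (gen 2 ^ (1 : ℤ)) (gen 1) (gen 0)), .mark i 1]
      [.mark i 0, .block i (comm₃ (gen 0) (gen 1) (gen 0)), .mark i 1] :=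
    BEqv.merge_to (β := Fin 3) [.mark i 0, .block i (comm₃ (gen 2 ^ (1 : ℤ)) (gen 1) (gen 0)), .mark i 1]
      ![0, 1, 0] ![[2, 0], [1]] (by decide) [0, 1] rfl (by decide) rfl (by
        simp [BItem.mapBlock, comm₃, map_commutatorElement])
  have h₄ : BEqv (β := Fin 3) (β' := Fin 2) [.mark i 2, .mark i 0,
        .block i (comm₃ (gen 2 ^ (1 : ℤ)) (gen 1) (gen 1)), .mark i 1]
      [.mark i 0, .block i (comm₃ (gen 0) (gen 1) (gen 1)), .mark i 1] :=
    BEqv.merge_to (β := Fin 3) [.mark i 0, .block i (comm₃ (gen 2 ^ (1 : ℤ)) (gen 1) (gen 1)), .mark i 1]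
      ![0, 1, 0] ![[2, 0], [1]] (by decide) [0, 1] rfl (by decide) rfl (by
        simp [BItem.mapBlock, comm₃, map_commutatorElement])
  exact h₁.trans (h₄.symm.trans ((BEqv.exchange_behind i i 1).symm.trans (h₃.trans h₂.symm)))

/-- The relation for the products of trees, where `j` is the strand of the head of the first factor. -/
theorem beqv_product {i j : Fin n} (hij : i ≠ j) {x p q : Fin 3}
    (h : (x = 0 ∧ p = 1 ∧ q = 2) ∨ (x = 2 ∧ p = 0 ∧ q = 1)) :
    BEqv (aroundMul [(i, p), (i, q), (j, x)] j (comm₃ (gen x) (gen p) (gen q)) []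
        [(j, 2), (i, 0)] i (comm₃ (gen 1) (gen 2) (gen 0)) [(i, 1)])
      (aroundMul [] j (comm₃ (gen x) (gen q) (gen p)) [(j, x), (i, p), (i, q)]
        [(j, 2), (i, 0)] i (comm₃ (gen 0) (gen 2) (gen 1)) [(i, 1)]) := by
  set inl : FreeGroup (Fin 3) →* FreeGroup (Fin 3 ⊕ Fin 3) := FreeGroup.map .inl with hl
  set inr : FreeGroup (Fin 3) →* FreeGroup (Fin 3 ⊕ Fin 3) := FreeGroup.map .inr with hr
  have : Nonempty (Fin 3 ⊕ Fin 3) := ⟨.inl 0⟩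
  have h₁ := BEqv.swap (β := Fin 3 ⊕ Fin 3) [.mark i (.inl p), .mark i (.inl q)] [.mark j (.inl x),
      .block j (inl (comm₃ (gen x) (gen p) (gen q))), .mark j (.inr 2)] [.mark i (.inr 0)]
    [.block i (inr (comm₃ (gen 1) (gen 2) (gen 0))), .mark i (.inr 1)]
    (by simp [BItem.strand, hij.symm])
  have h₂ : BEqv (β := Fin 3 ⊕ Fin 3) (β' := Fin 4) _ [.mark i 2, .mark j 0,
      .block j (comm₃ (gen 0) (gen 2) (gen 2)), .mark j 1,
      .block i (comm₃ (gen 3) (gen 1) (gen 2)), .mark i 3] :=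
    BEqv.merge_to (β := Fin 3 ⊕ Fin 3) [.mark i 2, .mark j 0,
      .block j (inl (comm₃ (gen x) (gen p) (gen q))), .mark j 1,
      .block i (inr (comm₃ (gen 1) (gen 2) (gen 0))), .mark i 3]
      (Sum.elim (fun z => if z = x then 0 else 2) ![2, 3, 1])
      ![[.inl x], [.inr 2], [.inl p, .inl q, .inr 0], [.inr 1]]
      (by rcases h with ⟨rfl, rfl, rfl⟩ | ⟨rfl, rfl, rfl⟩ <;> decide) [2, 0, 1, 3] rfl
      (by rcases h with ⟨rfl, rfl, rfl⟩ | ⟨rfl, rfl, rfl⟩ <;> decide) rfl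
      (by rcases h with ⟨rfl, rfl, rfl⟩ | ⟨rfl, rfl, rfl⟩ <;>
            simp [BItem.mapBlock, comm₃, map_commutatorElement, hl, hr])
  have h₃ := BEqv.swap (β := Fin 3 ⊕ Fin 3) [.block j (inl (comm₃ (gen x) (gen q) (gen p))),
      .mark j (.inl x)] [.mark i (.inl p), .mark i (.inl q)] [.mark j (.inr 2)]
    [.mark i (.inr 0), .block i (inr (comm₃ (gen 0) (gen 2) (gen 1))), .mark i (.inr 1)]
    (by simp [BItem.strand, hij])
  have h₄ : BEqv (β := Fin 3 ⊕ Fin 3) (β' := Fin 3) _ [.block j (comm₃ (gen 2) (gen 0) (gen 0)),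
      .mark j 2, .mark i 0, .block i (comm₃ (gen 0) (gen 2) (gen 1)), .mark i 1] :=
    BEqv.merge_to (β := Fin 3 ⊕ Fin 3) [.block j (inl (comm₃ (gen x) (gen q) (gen p))), .mark j 2,
      .mark i 0, .block i (inr (comm₃ (gen 0) (gen 2) (gen 1))), .mark i 1]
      (Sum.elim (fun z => if z = x then 2 else 0) ![0, 1, 2])
      ![[.inl p, .inl q, .inr 0], [.inr 1], [.inl x, .inr 2]]
      (by rcases h with ⟨rfl, rfl, rfl⟩ | ⟨rfl, rfl, rfl⟩ <;> decide) [2, 0, 1] rfl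
      (by rcases h with ⟨rfl, rfl, rfl⟩ | ⟨rfl, rfl, rfl⟩ <;> decide) rfl
      (by rcases h with ⟨rfl, rfl, rfl⟩ | ⟨rfl, rfl, rfl⟩ <;>
            simp [BItem.mapBlock, comm₃, map_commutatorElement, hl, hr])
  exact h₁.trans (h₂.trans ((BEqv.exchange_strands hij).trans (h₄.symm.trans h₃.symm)))

end Relations

end Welded

open Welded in
theorem mainTheorem11 :
    Welded.WkEquiv 4 Welded.treeF'.link Welded.treeF.headBead.link
    ∧ Welded.WkEquiv 4 Welded.treeTO₁.link Welded.treeTO₂.headBead.link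
    ∧ Welded.WkEquiv 4 Welded.treeTO₃.link Welded.treeTO₄.headBead.link
    ∧ Welded.WkEquiv 4 Welded.treeOT₁.link Welded.treeOT₂.headBead.link
    ∧ Welded.WkEquiv 4 Welded.treeOT₃.link Welded.treeOT₄.headBead.link
    ∧ Welded.WkEquiv 4 (Welded.treeA.link * Welded.treeOT₃.link)
        (Welded.treeB.link * Welded.treeOT₂.link)
    ∧ Welded.WkEquiv 4 (Welded.treeC.link * Welded.treeTO₃.link)
        (Welded.treeD.link * Welded.treeTO₂.link) := by
  refine ⟨?_, ?_, ?_, ?_, ?_, ?_, ?_⟩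
  -- endpoints on different strands may be listed in any order; the one chosen fits the relations
  · exact wkEquiv_of_beqv (A₁ := [(0, 0)]) (i := 0) (A₂ := [(0, 1), (0, 2)])
      (A₁' := [(0, 0), (0, 1)]) (i' := 0) (A₂' := [(0, 2)])
      (by funext j; fin_cases j; rfl) (by funext j; fin_cases j; rfl) (by decide)
      (nil_treeValue_left _ _ _) (nil_treeValue_bead (nil_treeValue_right _ _ _)) (beqv_one_strand 0)
  · exact wkEquiv_of_beqv (A₁ := [(1, 2), (0, 0), (0, 1)]) (i := 0) (A₂ := [])
      (A₁' := [(1, 2), (0, 0)]) (i' := 0) (A₂' := [(0, 1)])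
      (by funext j; fin_cases j <;> rfl) (by funext j; fin_cases j <;> rfl) (by decide)
      (nil_treeValue_right _ _ _) (nil_treeValue_bead (nil_treeValue_left _ _ _)) (beqv_before 0 1)
  · exact wkEquiv_of_beqv (A₁ := [(1, 2), (0, 0)]) (i := 0) (A₂ := [(0, 1)])
      (A₁' := [(1, 2)]) (i' := 0) (A₂' := [(0, 0), (0, 1)])
      (by funext j; fin_cases j <;> rfl) (by funext j; fin_cases j <;> rfl) (by decide)
      (nil_treeValue_right _ _ _) (nil_treeValue_bead (nil_treeValue_left _ _ _)) (beqv_behind 0 1)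
  · exact wkEquiv_of_beqv (A₁ := [(0, 2), (1, 0), (1, 1)]) (i := 1) (A₂ := [])
      (A₁' := [(0, 2), (1, 0)]) (i' := 1) (A₂' := [(1, 1)])
      (by funext j; fin_cases j <;> rfl) (by funext j; fin_cases j <;> rfl) (by decide)
      (nil_treeValue_left _ _ _) (nil_treeValue_bead (nil_treeValue_right _ _ _)) (beqv_before 1 0)
  · exact wkEquiv_of_beqv (A₁ := [(0, 2), (1, 0)]) (i := 1) (A₂ := [(1, 1)])
      (A₁' := [(0, 2)]) (i' := 1) (A₂' := [(1, 0), (1, 1)])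
      (by funext j; fin_cases j <;> rfl) (by funext j; fin_cases j <;> rfl) (by decide)
      (nil_treeValue_left _ _ _) (nil_treeValue_bead (nil_treeValue_right _ _ _)) (beqv_behind 1 0)
  · exact wkEquiv_mul_of_beqv (A₁ := [(1, 1), (1, 2), (0, 0)]) (i := 0) (A₂ := [])
      (B₁ := [(0, 2), (1, 0)]) (j := 1) (B₂ := [(1, 1)])
      (A₁' := []) (i' := 0) (A₂' := [(0, 0), (1, 1), (1, 2)])
      (B₁' := [(0, 2), (1, 0)]) (j' := 1) (B₂' := [(1, 1)])
      (by funext j; fin_cases j <;> rfl) (by funext j; fin_cases j <;> rfl)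
      (by funext j; fin_cases j <;> rfl) (by funext j; fin_cases j <;> rfl) (by decide)
      (nil_treeValue_left _ _ _) (nil_treeValue_left _ _ _) (nil_treeValue_right _ _ _)
      (nil_treeValue_right _ _ _) (beqv_product (by decide) (.inl ⟨rfl, rfl, rfl⟩))
  · exact wkEquiv_mul_of_beqv (A₁ := [(0, 0), (0, 1), (1, 2)]) (i := 1) (A₂ := [])
      (B₁ := [(1, 2), (0, 0)]) (j := 0) (B₂ := [(0, 1)])
      (A₁' := []) (i' := 1) (A₂' := [(1, 2), (0, 0), (0, 1)])
      (B₁' := [(1, 2), (0, 0)]) (j' := 0) (B₂' := [(0, 1)])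
      (by funext j; fin_cases j <;> rfl) (by funext j; fin_cases j <;> rfl)
      (by funext j; fin_cases j <;> rfl) (by funext j; fin_cases j <;> rfl) (by decide)
      (nil_treeValue_right _ _ _) (nil_treeValue_right _ _ _) (nil_treeValue_left _ _ _)
      (nil_treeValue_left _ _ _) (beqv_product (by decide) (.inr ⟨rfl, rfl, rfl⟩))
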